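/- All Banach spaces are complex. Let $P_+=\{z\in\mathbb C:\operatorname{Im} z>0\}$. **Notation.** For a Banach space $Z$: * $M(\mathbb R;Z)$ is the space of countably additive $Z$-valued Borel measures $\mu$ on $\mathbb R$ with finite total variation, with norm $\|\mu\|=|\mu|(\mathbb R)$. The Poisson integral of $\mu$ is $\phi_\mu(u+iv)=\frac1\pi\int_{\mathbb R}\frac{v}{(u-t)^2+v^2}\,d\mu(t)$, for $u\in\mathbb R$, $v>0$. * $\mathbf h^1(P_+;Z)$ is the space of harmonic functions $\phi:P_+\to Z$ such that $u\mapsto\phi(u+iv)$ belongs to $L^1(\mathbb R;Z)$ for all $v>0$ and $\|\phi\|:=\sup_{v>0}\int_{\mathbb R}\|\phi(u+iv)\|\,du<\infty$. $\mathbf H^1(P_+;Z)$ is its subspace of holomorphic functions, with the same norm. * $H^1(\mathbb R)=\{h\in L^1(\mathbb R):\widehat h(u)=0 \text{ for all } u\le 0\}$, and $H^1(\mathbb R;Z)$ is the closure of $H^1(\mathbb R)\otimes Z$ in the Bochner space $L^1(\mathbb R;Z)$. * $H^\infty(\mathbb R)$ is the space of $g\in L^\infty(\mathbb R)$ whose (distributional)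 Fourier transform is supported in $[0,\infty)$, and $Z_0=\{f\in C_0(\mathbb R): f(-\,\cdot)\in H^\infty(\mathbb R)\}$. Let $X$ be a Banach space. $C_0(\mathbb R;X)$ is the space of continuous functions $\mathbb R\to X$ vanishing at infinity, with the supremum norm; $f\otimes x$ is the function $t\mapsto f(t)x$; $Z_0\otimes X\subset C_0(\mathbb R;X)$ is the linear span of the $f\otimes x$ with $f\in Z_0$, $x\in X$; and the injective tensor product $Z_0\overset{\vee}{\otimes}X$ is its closure in $C_0(\mathbb R;X)$. For $\mu\in M(\mathbb R;X^*)$ and $x\in X$, put $\mu^x(E)=\langle\mu(E),x\rangle$. **Proposition.** There are isometric isomorphisms $$J:M(\mathbb R;X^*)\to C_0(\mathbb R;X)^*,\qquad \langle J\mu,f\otimes x\rangle=\int_{\mathbb R}f(-t)\,d\mu^x(t)\quad(f\in C_0(\mathbb R),\ x\in X),$$ $$P:M(\mathbb R;X^*)\to\mathbf h^1(P_+;X^*),\qquad P\mu=\phi_\mu,$$ and through them $(Z_0\otimes X)^\perp=\mathbf H^1(P_+;X^*)$, that is, for every $\mu\in M(\mathbb R;X^*)$, the functional $J\mu$ vanishes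 on $Z_0\otimes X$ if and only if $\phi_\mu\in\mathbf H^1(P_+;X^*)$. Hence there is an isometric isomorphism $$\Psi:\Bigl(\frac{C_0(\mathbb R;X)}{Z_0\overset{\vee}{\otimes}X}\Bigr)^*\to\mathbf H^1(P_+;X^*),\qquad \xi([F])=\bigl\langle J P^{-1}\Psi(\xi),F\bigr\rangle\quad(F\in C_0(\mathbb R;X)).$$ Let moreover $S^\infty$ be the space of compact operators on $\ell^2$ with the operator norm and $S^1$ the space of trace class operators on $\ell^2$ with the trace norm. Then there is an isometric isomorphism $K:H^1(\mathbb R;S^1)\to\mathbf H^1(P_+;(S^\infty)^*)$ given, for $h\in H^1(\mathbb R;S^1)$, $u+iv\in P_+$, $a\in S^\infty$, by $$\langle K(h)(u+iv),a\rangle=\frac1\pi\int_{\mathbb R}\frac{v}{(u-t)^2+v^2}\,\operatorname{tr}(a\,h(t))\,dt ,$$ and an isometric isomorphism $$\Theta:\Bigl(\frac{C_0(\mathbb R;S^\infty)}{Z_0\overset{\vee}{\otimes}S^\infty}\Bigr)^*\to H^1(\mathbb R;S^1),\qquad \xi([F])=\int_{\mathbb R}\operatorname{tr}\bigl(F(-t)\,\Theta(\xi)(t)\bigr)\,dt\quad(F\in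 C_0(\mathbb R;S^\infty)).$$ -/

import Mathlib

open MeasureTheory UpperHalfPlane
open scoped ENNReal ZeroAtInfty SchwartzMap FourierTransform

set_option linter.unusedSectionVars false

noncomputable section

namespace VHardy

/-! ### Bounded vector measures on the line -/

section Measures

variable (Z : Type*) [NormedAddCommGroup Z] [NormedSpace ℂ Z]

/-- The countably additive `Z`-valued Borel measures on `ℝ` with finite total variation. -/
def finiteVariation : Submodule ℂ (VectorMeasure ℝ Z) where
  carrier := {μ | μ.variation Set.univ ≠ ∞}
  zero_mem' := by simp
  add_mem' := by
    intro μ ν hμ hν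
    refine ne_top_of_le_ne_top (ENNReal.add_ne_top.2 ⟨hμ, hν⟩) ?_
    simpa using (VectorMeasure.variation_add_le (μ := μ) (ν := ν)) Set.univ
  smul_mem' := by
    intro c μ hμ
    simp only [Set.mem_ofPred_eq, VectorMeasure.variation_smul, Measure.smul_apply]
    exact ENNReal.mul_ne_top ENNReal.coe_ne_top hμ

/-- The space `M(ℝ; Z)` of bounded `Z`-valued Borel measures on `ℝ`; its norm is the total
variation `|μ|(ℝ)`. -/
def BddMeasure : Type _ := finiteVariation Z

instance : AddCommGroup (BddMeasure Z) := inferInstanceAs (AddCommGroup (finiteVariation Z))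
instance : Module ℂ (BddMeasure Z) := inferInstanceAs (Module ℂ (finiteVariation Z))

variable {Z}

/-- The underlying vector measure. -/
def BddMeasure.toVM (μ : BddMeasure Z) : VectorMeasure ℝ Z := Subtype.val μ

instance : Norm (BddMeasure Z) := ⟨fun μ => (μ.toVM.variation Set.univ).toReal⟩

theorem BddMeasure.norm_def (μ : BddMeasure Z) :
    ‖μ‖ = (μ.toVM.variation Set.univ).toReal := rfl

theorem BddMeasure.normedSpaceCore : NormedSpace.Core ℂ (BddMeasure Z) where
  norm_nonneg μ := ENNReal.toReal_nonneg
  norm_smul c μ := by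
    have h : (c • μ).toVM = c • μ.toVM := rfl
    simp [BddMeasure.norm_def, h, VectorMeasure.variation_smul]
  norm_triangle μ ν := by
    have h : (μ + ν).toVM = μ.toVM + ν.toVM := rfl
    rw [BddMeasure.norm_def, BddMeasure.norm_def, BddMeasure.norm_def, h,
      ← ENNReal.toReal_add (a := μ.toVM.variation Set.univ) (b := ν.toVM.variation Set.univ)
        μ.2 ν.2]
    refine ENNReal.toReal_mono (ENNReal.add_ne_top.2 ⟨μ.2, ν.2⟩) ?_
    simpa using (VectorMeasure.variation_add_le (μ := μ.toVM) (ν := ν.toVM)) Set.univ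
  norm_eq_zero_iff μ := by
    constructor
    · intro h
      rw [BddMeasure.norm_def, ENNReal.toReal_eq_zero_iff] at h
      have h0 := h.resolve_right μ.2
      rw [Measure.measure_univ_eq_zero, VectorMeasure.variation_eq_zero] at h0
      exact Subtype.ext h0
    · rintro rfl
      have h : (0 : BddMeasure Z).toVM = 0 := rfl
      simp [BddMeasure.norm_def, h]

instance : NormedAddCommGroup (BddMeasure Z) := NormedAddCommGroup.ofCore BddMeasure.normedSpaceCore
instance : NormedSpace ℂ (BddMeasure Z) := NormedSpace.ofCore BddMeasure.normedSpaceCore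

/-- The Poisson kernel of the upper half-plane `P₊ = ℍ`. -/
def halfPlanePoisson (z : ℍ) (t : ℝ) : ℝ := (1 / Real.pi) * (z.im / ((z.re - t) ^ 2 + z.im ^ 2))

/-- The Poisson integral `φ_μ : P₊ → Z` of a bounded vector measure. -/
def poissonIntegral (μ : BddMeasure Z) (z : ℍ) : Z := ∫ᵛ t, halfPlanePoisson z t ∂•μ.toVM

/-- For `μ ∈ M(ℝ; X*)` and `x ∈ X`, the complex measure `μ^x(E) = ⟨μ(E), x⟩`. -/
def evalMeasure {X : Type*} [NormedAddCommGroup X] [NormedSpace ℂ X]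
    (μ : BddMeasure (StrongDual ℂ X)) (x : X) : VectorMeasure ℝ ℂ :=
  μ.toVM.mapRange (ContinuousLinearMap.apply ℂ ℂ x : StrongDual ℂ X →+ ℂ)
    (ContinuousLinearMap.apply ℂ ℂ x).continuous

end Measures

/-! ### Hardy spaces on the upper half-plane -/

section HalfPlane

variable (Z : Type*) [NormedAddCommGroup Z] [NormedSpace ℂ Z]

/-- The horizontal slice `φ^v(u) = φ(u + iv)`, for `v > 0`. -/
def slice {Z : Type*} (φ : ℍ → Z) (v : ℝ) (u : ℝ) : Z := φ (ofComplex (u + v * Complex.I))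

/-- The harmonic functions `φ : P₊ → Z` whose slices `φ^v` are bounded in `L¹(ℝ; Z)`. -/
def h1Submodule : Submodule ℂ (ℍ → Z) where
  carrier := {φ | InnerProductSpace.HarmonicOnNhd (φ ∘ ofComplex) {z : ℂ | 0 < z.im} ∧
    (∀ v > 0, Integrable (slice φ v)) ∧ ∃ C : ℝ, ∀ v > 0, ∫ u, ‖slice φ v u‖ ≤ C}
  zero_mem' := by
    refine ⟨?_, ?_, 0, ?_⟩
    · exact InnerProductSpace.harmonicOnNhd_const (0 : Z)
    · intro v _
      exact integrable_zero ℝ Z volume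
    · intro v _
      simp [slice]
  add_mem' := by
    rintro φ ψ ⟨h1, i1, C, hC⟩ ⟨h2, i2, D, hD⟩
    refine ⟨h1.add h2, fun v hv => (i1 v hv).add (i2 v hv), C + D, fun v hv => ?_⟩
    calc ∫ u, ‖slice (φ + ψ) v u‖ ≤ ∫ u, (‖slice φ v u‖ + ‖slice ψ v u‖) :=
          integral_mono ((i1 v hv).add (i2 v hv)).norm ((i1 v hv).norm.add (i2 v hv).norm)
            fun u => norm_add_le _ _
      _ = (∫ u, ‖slice φ v u‖) + ∫ u, ‖slice ψ v u‖ :=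
          integral_add (i1 v hv).norm (i2 v hv).norm
      _ ≤ C + D := add_le_add (hC v hv) (hD v hv)
  smul_mem' := by
    rintro c φ ⟨h1, i1, C, hC⟩
    refine ⟨fun z hz => ?_, fun v hv => (i1 v hv).smul c, ‖c‖ * C, fun v hv => ?_⟩
    · exact (h1 z hz).comp_CLM
        (l := (c • ContinuousLinearMap.id ℂ Z).restrictScalars ℝ)
    · have : ∀ u, ‖slice (c • φ) v u‖ = ‖c‖ * ‖slice φ v u‖ := fun u => norm_smul _ _
      simp_rw [this, integral_const_mul]
      exact mul_le_mul_of_nonneg_left (hC v hv) (norm_nonneg _)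

/-- The Banach space `h¹(P₊; Z)` of harmonic functions, normed by
`sup_{v > 0} ∫ ‖φ(u + iv)‖ du`. -/
def HarmonicH1 : Type _ := h1Submodule Z

instance : AddCommGroup (HarmonicH1 Z) := inferInstanceAs (AddCommGroup (h1Submodule Z))
instance : Module ℂ (HarmonicH1 Z) := inferInstanceAs (Module ℂ (h1Submodule Z))

variable {Z}

/-- The underlying function on the half-plane. -/
def HarmonicH1.toFun (φ : HarmonicH1 Z) : ℍ → Z := Subtype.val φ

instance : Norm (HarmonicH1 Z) :=
  ⟨fun φ => ⨆ v : Set.Ioi (0 : ℝ), ∫ u, ‖slice φ.toFun v u‖⟩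

theorem HarmonicH1.norm_def (φ : HarmonicH1 Z) :
    ‖φ‖ = ⨆ v : Set.Ioi (0 : ℝ), ∫ u, ‖slice φ.toFun v u‖ := rfl

theorem HarmonicH1.integral_slice_le (φ : HarmonicH1 Z) (v : Set.Ioi (0 : ℝ)) :
    ∫ u, ‖slice φ.toFun v u‖ ≤ ‖φ‖ := by
  obtain ⟨C, hC⟩ := φ.2.2.2
  exact le_ciSup (f := fun v : Set.Ioi (0 : ℝ) => ∫ u, ‖slice φ.toFun v u‖)
    ⟨C, by rintro _ ⟨w, rfl⟩; exact hC w w.2⟩ v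

theorem HarmonicH1.continuous_slice (φ : HarmonicH1 Z) {v : ℝ} (hv : 0 < v) :
    Continuous (slice φ.toFun v) := by
  have h : ContinuousOn (φ.toFun ∘ ofComplex) {z : ℂ | 0 < z.im} := φ.2.1.contDiffOn.continuousOn
  refine h.comp_continuous (f := fun u : ℝ => (u : ℂ) + v * Complex.I) (by fun_prop) fun u => ?_
  simpa using hv

theorem HarmonicH1.normedSpaceCore : NormedSpace.Core ℂ (HarmonicH1 Z) where
  norm_nonneg φ := Real.iSup_nonneg fun v => integral_nonneg fun u => norm_nonneg _
  norm_smul c φ := by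
    have : ∀ v u, ‖slice (c • φ).toFun v u‖ = ‖c‖ * ‖slice φ.toFun v u‖ :=
      fun v u => norm_smul _ _
    simp_rw [HarmonicH1.norm_def, this, integral_const_mul]
    exact (Real.mul_iSup_of_nonneg (norm_nonneg c) _).symm
  norm_triangle φ ψ := by
    rw [HarmonicH1.norm_def (φ + ψ)]
    refine ciSup_le fun v => ?_
    have i1 : Integrable (slice φ.toFun v) := φ.2.2.1 v v.2
    have i2 : Integrable (slice ψ.toFun v) := ψ.2.2.1 v v.2
    calc ∫ u, ‖slice (φ + ψ).toFun v u‖ ≤ ∫ u, (‖slice φ.toFun v u‖ + ‖slice ψ.toFun v u‖) :=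
          integral_mono (i1.add i2).norm (i1.norm.add i2.norm) fun u => norm_add_le _ _
      _ = (∫ u, ‖slice φ.toFun v u‖) + ∫ u, ‖slice ψ.toFun v u‖ :=
          integral_add i1.norm i2.norm
      _ ≤ ‖φ‖ + ‖ψ‖ := add_le_add (φ.integral_slice_le v) (ψ.integral_slice_le v)
  norm_eq_zero_iff φ := by
    constructor
    · intro h
      refine Subtype.ext (funext fun z => ?_)
      have hz : (0 : ℝ) < z.im := z.im_pos
      have h0 : ∫ u, ‖slice φ.toFun z.im u‖ = 0 :=
        le_antisymm (h ▸ φ.integral_slice_le ⟨z.im, hz⟩) (integral_nonneg fun u => norm_nonneg _)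
      have hc := φ.continuous_slice hz
      have hi : Integrable (slice φ.toFun z.im) := φ.2.2.1 _ hz
      rw [integral_eq_zero_iff_of_nonneg (fun u => norm_nonneg _) hi.norm] at h0
      have h1 := (Continuous.ae_eq_iff_eq volume hc.norm continuous_const).1 h0
      have h2 : ‖φ.toFun (ofComplex ((z.re : ℂ) + z.im * Complex.I))‖ = 0 := congrFun h1 z.re
      rw [norm_eq_zero] at h2
      have h3 : ofComplex ((z.re : ℂ) + z.im * Complex.I) = z := by
        have : ((z.re : ℂ) + z.im * Complex.I) = (z : ℂ) := Complex.re_add_im _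
        rw [this, ofComplex_apply]
      rw [h3] at h2
      exact h2
    · rintro rfl
      have : ∀ v u, slice (0 : HarmonicH1 Z).toFun v u = 0 := fun v u => rfl
      simp [HarmonicH1.norm_def, this]

instance : NormedAddCommGroup (HarmonicH1 Z) := NormedAddCommGroup.ofCore HarmonicH1.normedSpaceCore
instance : NormedSpace ℂ (HarmonicH1 Z) := NormedSpace.ofCore HarmonicH1.normedSpaceCore

variable (Z)

/-- The Hardy space `𝐇¹(P₊; Z) = h¹(P₊; Z) ∩ Hol(P₊; Z)`, with the norm of `h¹(P₊; Z)`. -/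
def HolomorphicH1 : Submodule ℂ (HarmonicH1 Z) where
  carrier := {φ | DifferentiableOn ℂ (φ.toFun ∘ ofComplex) {z : ℂ | 0 < z.im}}
  zero_mem' := differentiableOn_const (0 : Z)
  add_mem' h1 h2 := DifferentiableOn.add h1 h2
  smul_mem' c _ h := DifferentiableOn.const_smul h c

end HalfPlane

/-! ### Hardy spaces on the line -/

section Line

/-- `H¹(ℝ)`: the integrable functions whose Fourier transform vanishes on `(-∞, 0]` (this does
not depend on the positive factor in the exponent of the Fourier transform). -/
def hardyOne : Submodule ℂ (Lp ℂ 1 (volume : Measure ℝ)) where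
  carrier := {h | ∀ u ≤ 0, 𝓕 (h : ℝ → ℂ) u = 0}
  zero_mem' := by
    intro u _
    rw [Real.fourier_eq, integral_congr_ae (g := fun _ => 0), integral_zero]
    filter_upwards [Lp.coeFn_zero ℂ 1 (volume : Measure ℝ)] with t ht
    rw [ht, Pi.zero_apply, smul_zero]
  add_mem' := by
    intro f g hf hg u hu
    have hfi := L1.integrable_coeFn f
    have hgi := L1.integrable_coeFn g
    have : 𝓕 (⇑(f + g) : ℝ → ℂ) u = 𝓕 (fun t => (f : ℝ → ℂ) t + (g : ℝ → ℂ) t) u := by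
      rw [Real.fourier_eq, Real.fourier_eq]
      refine integral_congr_ae ?_
      filter_upwards [Lp.coeFn_add f g] with t ht
      rw [ht, Pi.add_apply]
    rw [this, Real.fourier_eq]
    have h1 := (Real.fourierIntegral_convergent_iff (f := ⇑f) (V := ℝ) (μ := volume) u).2 hfi
    have h2 := (Real.fourierIntegral_convergent_iff (f := ⇑g) (V := ℝ) (μ := volume) u).2 hgi
    have e1 := hf u hu
    have e2 := hg u hu
    rw [Real.fourier_eq] at e1 e2
    simp only [smul_add]
    rw [integral_add h1 h2, e1, e2, add_zero]
  smul_mem' := by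
    intro c f hf u hu
    have e1 := hf u hu
    rw [Real.fourier_eq] at e1 ⊢
    rw [integral_congr_ae (g := fun t => c • (Real.fourierChar (-inner ℝ t u) • f t)),
      integral_smul, e1, smul_zero]
    filter_upwards [Lp.coeFn_smul c f] with t ht
    rw [ht, Pi.smul_apply, smul_comm]

/-- `H^∞(ℝ)`: the functions of `L^∞(ℝ)` whose Fourier transform, as a tempered distribution,
vanishes on `(-∞, 0)`, i.e. has its support in `[0, ∞)`. -/
def hardyInfty : Submodule ℂ (Lp ℂ ∞ (volume : Measure ℝ)) where
  carrier := {g | Distribution.IsVanishingOn (𝓕 (g : 𝓢'(ℝ, ℂ)) : 𝓢'(ℝ, ℂ)) (Set.Iio (0 : ℝ))}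
  zero_mem' := by
    intro φ _
    have : ((0 : Lp ℂ ∞ (volume : Measure ℝ)) : 𝓢'(ℝ, ℂ)) = 0 :=
      map_zero (Lp.toTemperedDistributionCLM ℂ volume ∞)
    rw [TemperedDistribution.fourier_apply, this]
    rfl
  add_mem' := by
    intro f g hf hg φ hφ
    have : ((f + g : Lp ℂ ∞ (volume : Measure ℝ)) : 𝓢'(ℝ, ℂ)) = (f : 𝓢'(ℝ, ℂ)) + (g : 𝓢'(ℝ, ℂ)) :=
      map_add (Lp.toTemperedDistributionCLM ℂ volume ∞) f g
    have h1 := hf φ hφ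
    have h2 := hg φ hφ
    rw [TemperedDistribution.fourier_apply] at h1 h2 ⊢
    rw [this]
    exact (congrArg₂ (· + ·) h1 h2).trans (add_zero 0)
  smul_mem' := by
    intro c f hf φ hφ
    have : ((c • f : Lp ℂ ∞ (volume : Measure ℝ)) : 𝓢'(ℝ, ℂ)) = c • (f : 𝓢'(ℝ, ℂ)) :=
      map_smul (Lp.toTemperedDistributionCLM ℂ volume ∞) c f
    have h1 := hf φ hφ
    rw [TemperedDistribution.fourier_apply] at h1 ⊢
    rw [this]
    exact (congrArg (c • ·) h1).trans (smul_zero c)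

/-- `Z₀ = C₀(ℝ) ∩ H^∞₋(ℝ)`, where `H^∞₋(ℝ) = {g(-·) : g ∈ H^∞(ℝ)}`. -/
def Z0 : Submodule ℂ C₀(ℝ, ℂ) where
  carrier := {f | ∃ g ∈ hardyInfty, (g : ℝ → ℂ) =ᵐ[volume] fun t => f (-t)}
  zero_mem' := ⟨0, hardyInfty.zero_mem, Lp.coeFn_zero ℂ ∞ volume⟩
  add_mem' := by
    rintro f₁ f₂ ⟨g₁, h₁, e₁⟩ ⟨g₂, h₂, e₂⟩
    refine ⟨g₁ + g₂, hardyInfty.add_mem h₁ h₂, ?_⟩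
    filter_upwards [Lp.coeFn_add g₁ g₂, e₁, e₂] with t ht h1 h2
    rw [ht, Pi.add_apply, h1, h2]
    rfl
  smul_mem' := by
    rintro c f ⟨g, h, e⟩
    refine ⟨c • g, hardyInfty.smul_mem c h, ?_⟩
    filter_upwards [Lp.coeFn_smul c g, e] with t ht h1
    rw [ht, Pi.smul_apply, h1]
    rfl

variable {X : Type*} [NormedAddCommGroup X] [NormedSpace ℂ X]

/-- The elementary tensor `f ⊗ x`, i.e. the function `t ↦ f(t) x` in `C₀(ℝ; X)`. -/
def tensor (f : C₀(ℝ, ℂ)) (x : X) : C₀(ℝ, X) where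
  toFun t := f t • x
  continuous_toFun := (map_continuous f).smul continuous_const
  zero_at_infty' := by simpa using (zero_at_infty f).smul_const x

variable (X)

/-- `Z₀ ⊗ X`, regarded as a subspace of `C₀(ℝ; X)`. -/
def Z0Tensor : Submodule ℂ C₀(ℝ, X) :=
  Submodule.span ℂ {F | ∃ f ∈ Z0, ∃ x : X, F = tensor f x}

/-- The injective tensor product of `Z₀` and `X`, realised as the closure of `Z₀ ⊗ X` in
`C₀(ℝ; X)`, whose supremum norm is the injective norm on `C₀(ℝ) ⊗ X`. -/
def Z0InjTensor : Submodule ℂ C₀(ℝ, X) := (Z0Tensor X).topologicalClosure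

/-- The Bochner-Hardy space `H¹(ℝ; Z)`: the closure of `H¹(ℝ) ⊗ Z` in `L¹(ℝ; Z)`. -/
def bochnerH1 (Z : Type*) [NormedAddCommGroup Z] [NormedSpace ℂ Z] :
    Submodule ℂ (Lp Z 1 (volume : Measure ℝ)) :=
  (Submodule.span ℂ {F : Lp Z 1 (volume : Measure ℝ) | ∃ h ∈ hardyOne, ∃ z : Z,
    (F : ℝ → Z) =ᵐ[volume] fun t => (h : ℝ → ℂ) t • z}).topologicalClosure

variable {X}

/-- The annihilator `W^⊥` of a subspace `W`, inside the dual space. -/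
def annihilator (W : Submodule ℂ X) : Submodule ℂ (StrongDual ℂ X) where
  carrier := {ξ | ∀ x ∈ W, ξ x = 0}
  zero_mem' := fun _ _ => rfl
  add_mem' h1 h2 := fun x hx => by simp [h1 x hx, h2 x hx]
  smul_mem' c _ h := fun x hx => by simp [h x hx]

end Line

/-! ### Trace-class operators -/

section TraceClass

variable {H : Type*} [NormedAddCommGroup H] [InnerProductSpace ℂ H] [CompleteSpace H]

/-- The absolute value `|T| = (T^* T)^{1/2}`. -/
def absOp (T : H →L[ℂ] H) : H →L[ℂ] H := CFC.abs T

theorem absOp_mul_self (T : H →L[ℂ] H) : absOp T * absOp T = star T * T := CFC.abs_mul_abs T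

theorem absOp_nonneg (T : H →L[ℂ] H) : 0 ≤ absOp T := CFC.abs_nonneg T

/-- Approximate polar decomposition. -/
theorem exists_approx_polar (T : H →L[ℂ] H) {ε : ℝ} (hε : 0 < ε) :
    ∃ V : H →L[ℂ] H, ‖V‖ ≤ 1 ∧ ‖absOp T - star V * T‖ ≤ ε ∧ ‖T - V * absOp T‖ ≤ ε := by
  set A := absOp T with hA
  have hA0 : 0 ≤ A := absOp_nonneg T
  have hAsa : IsSelfAdjoint A := IsSelfAdjoint.of_nonneg hA0
  have hs : ∀ x ∈ spectrum ℝ A, 0 ≤ x := fun x hx => spectrum_nonneg_of_nonneg hA0 hx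
  have hAA : star T * T = A * A := (absOp_mul_self T).symm
  let r : ℝ → ℝ := fun x => (x + ε)⁻¹
  have hr : ContinuousOn r (spectrum ℝ A) := by
    refine ContinuousOn.inv₀ (by fun_prop) fun x hx => ?_
    have := hs x hx
    positivity
  set R := cfc r A with hR
  have hRsa : star R = R := (cfc_predicate r A : IsSelfAdjoint _).star_eq
  have hid : cfc (fun x : ℝ => x) A = A := cfc_id' ℝ A
  have e1 : R * (A * A) = cfc (fun x => r x * (x * x)) A := by
    rw [cfc_mul r (fun x => x * x) A hr, cfc_mul (fun x => x) (fun x => x) A, hid]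
  have e2 : R * (A * A) * R = cfc (fun x => r x * (x * x) * r x) A := by
    rw [cfc_mul (fun x => r x * (x * x)) r A (hr.mul (by fun_prop)) hr, e1]
  have e3 : A - R * (A * A) = cfc (fun x => x - r x * (x * x)) A := by
    rw [cfc_sub (fun x => x) (fun x => r x * (x * x)) A (by fun_prop) (hr.mul (by fun_prop)),
      hid, e1]
  have e4 : R * A = cfc (fun x => r x * x) A := by
    rw [cfc_mul r (fun x => x) A hr, hid]
  have e5 : (1 : H →L[ℂ] H) - R * A = cfc (fun x => 1 - r x * x) A := by
    rw [cfc_sub (fun _ => 1) (fun x => r x * x) A (by fun_prop) (hr.mul (by fun_prop)),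
      cfc_const_one ℝ A, e4]
  have e6 : (1 - R * A) * (A * A) * (1 - R * A) =
      cfc (fun x => (1 - r x * x) * (x * x) * (1 - r x * x)) A := by
    have c1 : ContinuousOn (fun x => 1 - r x * x) (spectrum ℝ A) :=
      continuousOn_const.sub (hr.mul (by fun_prop))
    rw [cfc_mul (fun x => (1 - r x * x) * (x * x)) _ A (c1.mul (by fun_prop)) c1,
      cfc_mul (fun x => 1 - r x * x) _ A c1 (by fun_prop), cfc_mul (fun x => x) (fun x => x) A,
      hid, e5]
  have hcomm : A * R = R * A := by
    have h : A * R = cfc (fun x => x * r x) A := by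
      rw [cfc_mul (fun x => x) r A (by fun_prop) hr, hid]
    rw [h, e4]
    exact congrArg (fun f => cfc f A) (funext fun x => mul_comm _ _)
  have key : ∀ x ∈ spectrum ℝ A, 0 ≤ r x * x ∧ r x * x ≤ 1 ∧ (1 - r x * x) * x ≤ ε ∧
      0 ≤ (1 - r x * x) * x := by
    intro x hx
    have h0 := hs x hx
    have hp : 0 < x + ε := by positivity
    have h1 : r x * x ≤ 1 := by
      simp only [r]
      rw [inv_mul_le_one₀ hp]
      linarith
    have h2 : (1 - r x * x) = ε * r x := by
      simp only [r]
      field_simp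
      ring
    have h3 : 0 ≤ r x * x := mul_nonneg (inv_nonneg.2 hp.le) h0
    refine ⟨h3, h1, ?_, mul_nonneg (by linarith) h0⟩
    rw [h2, mul_assoc]
    nlinarith
  refine ⟨T * R, ?_, ?_, ?_⟩
  · have h : ‖star (T * R) * (T * R)‖ ≤ 1 := by
      have : star (T * R) * (T * R) = R * (A * A) * R := by
        rw [star_mul, hRsa, ← hAA]
        simp only [mul_assoc]
      rw [this, e2]
      refine norm_cfc_le zero_le_one fun x hx => ?_
      obtain ⟨k0, k1, -, -⟩ := key x hx
      have : r x * (x * x) * r x = (r x * x) * (r x * x) := by ring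
      rw [this, Real.norm_of_nonneg (mul_nonneg k0 k0)]
      nlinarith
    rw [CStarRing.norm_star_mul_self] at h
    nlinarith [norm_nonneg (T * R)]
  · have : A - star (T * R) * T = A - R * (A * A) := by
      rw [star_mul, hRsa, ← hAA, mul_assoc]
    rw [this, e3]
    refine norm_cfc_le hε.le fun x hx => ?_
    obtain ⟨-, -, k2, k3⟩ := key x hx
    have : x - r x * (x * x) = (1 - r x * x) * x := by ring
    rw [this, Real.norm_of_nonneg k3]
    exact k2
  · have h : ‖star (T - T * R * A) * (T - T * R * A)‖ ≤ ε * ε := by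
      have h1 : T - T * R * A = T * (1 - R * A) := by
        rw [mul_sub, mul_one, mul_assoc]
      have h2 : star (1 - R * A) = 1 - R * A := by
        rw [star_sub, star_one, star_mul, hRsa, hAsa.star_eq, hcomm]
      have : star (T - T * R * A) * (T - T * R * A) = (1 - R * A) * (A * A) * (1 - R * A) := by
        rw [h1, star_mul, h2, ← hAA]
        simp only [mul_assoc]
      rw [this, e6]
      refine norm_cfc_le (by positivity) fun x hx => ?_
      obtain ⟨-, -, k2, k3⟩ := key x hx
      have : (1 - r x * x) * (x * x) * (1 - r x * x) = ((1 - r x * x) * x) * ((1 - r x * x) * x) := by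
        ring
      rw [this, Real.norm_of_nonneg (mul_nonneg k3 k3)]
      exact mul_le_mul k2 k2 k3 hε.le
    rw [CStarRing.norm_star_mul_self] at h
    exact (mul_self_le_mul_self_iff (norm_nonneg _) hε.le).2 h

variable (H) in
/-- The Banach space `S^∞(H)` of compact operators on `H`, with the operator norm. -/
def CompactOp : Type _ := compactOperator (RingHom.id ℂ) H H

instance : NormedAddCommGroup (CompactOp H) :=
  inferInstanceAs (NormedAddCommGroup (compactOperator (RingHom.id ℂ) H H))
instance : NormedSpace ℂ (CompactOp H) :=
  inferInstanceAs (NormedSpace ℂ (compactOperator (RingHom.id ℂ) H H))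

/-- The underlying bounded operator. -/
def CompactOp.toOp (T : CompactOp H) : H →L[ℂ] H := Subtype.val T

variable {ι : Type*} (b : HilbertBasis ι ℂ H)

/-- The trace norm `tr |T| = ∑ₙ ⟨|T| bₙ, bₙ⟩ ∈ [0, ∞]`, computed in an orthonormal basis. -/
def traceNormE (T : H →L[ℂ] H) : ℝ≥0∞ := ∑' n, ENNReal.ofReal (inner ℂ (b n) (absOp T (b n))).re

theorem tsum_enorm_inner_sq (x : H) : ∑' n, ‖inner ℂ (b n) x‖ₑ ^ 2 = ‖x‖ₑ ^ 2 := by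
  have h3 := Complex.hasSum_re (b.hasSum_inner_mul_inner x x)
  have e : ((inner ℂ x x : ℂ)).re = ‖x‖ ^ 2 := by
    rw [inner_self_eq_norm_sq_to_K]
    norm_cast
  have e2 : ∀ n, (inner ℂ x (b n) * inner ℂ (b n) x : ℂ).re = ‖inner ℂ (b n) x‖ ^ 2 := fun n => by
    rw [← inner_conj_symm x (b n), RCLike.conj_mul]
    norm_cast
  rw [e] at h3
  simp only [e2] at h3
  have h4 : ∀ y : ℝ, 0 ≤ y → ENNReal.ofReal (y ^ 2) = ENNReal.ofReal y ^ 2 := fun y hy =>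
    ENNReal.ofReal_pow hy 2
  have h5 := ENNReal.ofReal_tsum_of_nonneg (fun n => sq_nonneg ‖inner ℂ (b n) x‖) h3.summable
  rw [h3.tsum_eq, h4 _ (norm_nonneg _), ofReal_norm] at h5
  rw [h5]
  refine tsum_congr fun n => ?_
  rw [h4 _ (norm_nonneg _), ofReal_norm]

/-- The sum of the squares `‖S bₙ‖²` is the same for `S` and for its adjoint. -/
theorem tsum_enorm_star_sq (S : H →L[ℂ] H) :
    ∑' n, ‖(star S) (b n)‖ₑ ^ 2 = ∑' n, ‖S (b n)‖ₑ ^ 2 := by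
  simp_rw [← tsum_enorm_inner_sq b]
  rw [ENNReal.tsum_comm]
  refine tsum_congr fun n => tsum_congr fun m => ?_
  rw [ContinuousLinearMap.star_eq_adjoint, ContinuousLinearMap.adjoint_inner_right,
    ← inner_conj_symm]
  rw [← ofReal_norm, ← ofReal_norm, RCLike.norm_conj, norm_inner_symm]

theorem exists_sqrt_absOp (T : H →L[ℂ] H) :
    ∃ S : H →L[ℂ] H, star S = S ∧ S * S = absOp T := by
  refine ⟨CFC.sqrt (absOp T), ?_, CFC.sqrt_mul_sqrt_self _ (absOp_nonneg T)⟩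
  exact (IsSelfAdjoint.of_nonneg (CFC.sqrt_nonneg (absOp T))).star_eq

theorem inner_absOp_eq {T S : H →L[ℂ] H} (h1 : star S = S) (h2 : S * S = absOp T) (x y : H) :
    (inner ℂ x (absOp T y) : ℂ) = inner ℂ (S x) (S y) := by
  rw [← h2, mul_apply_eq_comp, ← ContinuousLinearMap.adjoint_inner_left,
    ← ContinuousLinearMap.star_eq_adjoint, h1]

theorem traceNormE_eq {T S : H →L[ℂ] H} (h1 : star S = S) (h2 : S * S = absOp T) :
    traceNormE b T = ∑' n, ‖S (b n)‖ₑ ^ 2 := by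
  refine tsum_congr fun n => ?_
  rw [inner_absOp_eq h1 h2, inner_self_eq_norm_sq_to_K, ← ofReal_norm,
    ← ENNReal.ofReal_pow (norm_nonneg _)]
  norm_cast

/-- The partial sums of `∑ ⟨V bₙ, T bₙ⟩`, for a contraction `V`, are controlled by the trace norm. -/
theorem norm_sum_inner_le {T V : H →L[ℂ] H} (hV : ‖V‖ ≤ 1) (hT : traceNormE b T ≠ ∞)
    (s : Finset ι) : ‖∑ n ∈ s, (inner ℂ (V (b n)) (T (b n)) : ℂ)‖ ≤ (traceNormE b T).toReal := by
  obtain ⟨S, h1, h2⟩ := exists_sqrt_absOp T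
  have hτ := traceNormE_eq b h1 h2
  set τ := (traceNormE b T).toReal with hτd
  have fin_bound : ∀ (f : ι → H), ∑' n, ‖f n‖ₑ ^ 2 ≤ traceNormE b T →
      ∑ n ∈ s, ‖f n‖ ^ 2 ≤ τ := by
    intro f hf
    have h3 : ∑ n ∈ s, ‖f n‖ₑ ^ 2 ≤ traceNormE b T := (ENNReal.sum_le_tsum s).trans hf
    have h4 : ∑ n ∈ s, ‖f n‖ₑ ^ 2 = ENNReal.ofReal (∑ n ∈ s, ‖f n‖ ^ 2) := by
      rw [ENNReal.ofReal_sum_of_nonneg fun n _ => sq_nonneg _]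
      refine Finset.sum_congr rfl fun n _ => ?_
      rw [← ofReal_norm, ENNReal.ofReal_pow (norm_nonneg _)]
    rw [h4] at h3
    exact (ENNReal.ofReal_le_iff_le_toReal hT).1 h3
  refine le_of_forall_pos_le_add fun δ hδ => ?_
  obtain ⟨U, hU, -, hTU⟩ := exists_approx_polar T (ε := δ / (s.card + 1)) (by positivity)
  have hb : ∀ n, ‖b n‖ = 1 := fun n => b.orthonormal.1 n
  have split : ∀ n, (inner ℂ (V (b n)) (T (b n)) : ℂ) =
      inner ℂ (V (b n)) ((T - U * absOp T) (b n)) + inner ℂ ((S * (star U * V)) (b n)) (S (b n)) := by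
    intro n
    have e1 : (inner ℂ ((S * (star U * V)) (b n)) (S (b n)) : ℂ) =
        inner ℂ (V (b n)) ((U * absOp T) (b n)) := by
      simp only [mul_apply_eq_comp]
      rw [← inner_absOp_eq h1 h2, ContinuousLinearMap.star_eq_adjoint,
        ContinuousLinearMap.adjoint_inner_left]
    rw [e1, ← inner_add_right, sub_apply, sub_add_cancel]
  have hW : ∑' n, ‖(S * (star U * V)) (b n)‖ₑ ^ 2 ≤ traceNormE b T := by
    rw [← tsum_enorm_star_sq, hτ]
    refine ENNReal.tsum_le_tsum fun n => ?_
    have e : star (S * (star U * V)) = (star V * U) * S := by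
      simp [h1, mul_assoc]
    rw [e, mul_apply_eq_comp]
    have hc : ‖star V * U‖ ≤ 1 := by
      refine (norm_mul_le _ _).trans ?_
      rw [norm_star]
      exact mul_le_one₀ hV (norm_nonneg _) hU
    have : ‖(star V * U) (S (b n))‖ₑ ≤ ‖S (b n)‖ₑ := by
      rw [← ofReal_norm, ← ofReal_norm]
      refine ENNReal.ofReal_le_ofReal (((star V * U).le_opNorm _).trans ?_)
      exact mul_le_of_le_one_left (norm_nonneg _) hc
    gcongr
  have hS : ∑' n, ‖S (b n)‖ₑ ^ 2 ≤ traceNormE b T := hτ.ge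
  simp_rw [split, Finset.sum_add_distrib]
  have p1 : ‖∑ n ∈ s, (inner ℂ (V (b n)) ((T - U * absOp T) (b n)) : ℂ)‖ ≤ δ := by
    have : ∀ n ∈ s, ‖(inner ℂ (V (b n)) ((T - U * absOp T) (b n)) : ℂ)‖ ≤ δ / (s.card + 1) := by
      intro n _
      have a1 : ‖V (b n)‖ ≤ 1 := (V.le_opNorm _).trans (by rw [hb, mul_one]; exact hV)
      have a2 : ‖(T - U * absOp T) (b n)‖ ≤ δ / (s.card + 1) :=
        ((T - U * absOp T).le_opNorm _).trans (by rw [hb, mul_one]; exact hTU)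
      refine (norm_inner_le_norm _ _).trans ?_
      calc _ ≤ 1 * (δ / (s.card + 1)) := mul_le_mul a1 a2 (norm_nonneg _) zero_le_one
        _ = _ := one_mul _
    refine (norm_sum_le_of_le s this).trans ?_
    rw [Finset.sum_const, nsmul_eq_mul]
    have hc : (0 : ℝ) < s.card + 1 := by positivity
    rw [mul_div_assoc', div_le_iff₀ hc]
    nlinarith
  have p2 : ‖∑ n ∈ s, (inner ℂ ((S * (star U * V)) (b n)) (S (b n)) : ℂ)‖ ≤ τ := by
    refine (norm_sum_le_of_le s fun n _ => norm_inner_le_norm _ _).trans ?_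
    refine (Real.sum_mul_le_sqrt_mul_sqrt s _ _).trans ?_
    calc _ ≤ √τ * √τ := mul_le_mul (Real.sqrt_le_sqrt (fin_bound _ hW))
            (Real.sqrt_le_sqrt (fin_bound _ hS)) (Real.sqrt_nonneg _) (Real.sqrt_nonneg _)
      _ = τ := Real.mul_self_sqrt ENNReal.toReal_nonneg
  linarith [norm_add_le (∑ n ∈ s, (inner ℂ (V (b n)) ((T - U * absOp T) (b n)) : ℂ))
    (∑ n ∈ s, (inner ℂ ((S * (star U * V)) (b n)) (S (b n)) : ℂ))]

theorem traceNormE_add_le (T₁ T₂ : H →L[ℂ] H) :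
    traceNormE b (T₁ + T₂) ≤ traceNormE b T₁ + traceNormE b T₂ := by
  by_cases h₁ : traceNormE b T₁ = ∞
  · simp [h₁]
  by_cases h₂ : traceNormE b T₂ = ∞
  · simp [h₂]
  obtain ⟨S, hS1, hS2⟩ := exists_sqrt_absOp (T₁ + T₂)
  have hpos : ∀ n, 0 ≤ (inner ℂ (b n) (absOp (T₁ + T₂) (b n)) : ℂ).re := by
    intro n
    rw [inner_absOp_eq hS1 hS2]
    exact inner_self_nonneg (𝕜 := ℂ)
  refine ENNReal.summable.tsum_le_of_sum_le fun s => ?_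
  rw [← ENNReal.ofReal_sum_of_nonneg fun n _ => hpos n,
    ← ENNReal.ofReal_toReal (ENNReal.add_ne_top.2 ⟨h₁, h₂⟩), ENNReal.toReal_add h₁ h₂]
  refine ENNReal.ofReal_le_ofReal (le_of_forall_pos_le_add fun δ hδ => ?_)
  obtain ⟨V, hV, hTV, -⟩ := exists_approx_polar (T₁ + T₂) (ε := δ / (s.card + 1)) (by positivity)
  have hb : ∀ n, ‖b n‖ = 1 := fun n => b.orthonormal.1 n
  have main : ∀ n ∈ s, (inner ℂ (b n) (absOp (T₁ + T₂) (b n)) : ℂ).re ≤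
      δ / (s.card + 1) + (inner ℂ (V (b n)) (T₁ (b n)) + inner ℂ (V (b n)) (T₂ (b n)) : ℂ).re := by
    intro n _
    have e : (inner ℂ (b n) (absOp (T₁ + T₂) (b n)) : ℂ) =
        inner ℂ (b n) ((absOp (T₁ + T₂) - star V * (T₁ + T₂)) (b n)) +
          (inner ℂ (V (b n)) (T₁ (b n)) + inner ℂ (V (b n)) (T₂ (b n))) := by
      rw [← inner_add_right, ← add_apply,
        ← ContinuousLinearMap.adjoint_inner_right, ← ContinuousLinearMap.star_eq_adjoint,
        ← mul_apply_eq_comp, ← inner_add_right, sub_apply,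
        sub_add_cancel]
    rw [e, Complex.add_re]
    refine add_le_add_left ?_ _
    refine (Complex.re_le_norm _).trans ((norm_inner_le_norm _ _).trans ?_)
    rw [hb, one_mul]
    refine (ContinuousLinearMap.le_opNorm _ _).trans ?_
    rw [hb, mul_one]
    exact hTV
  refine (Finset.sum_le_sum main).trans ?_
  rw [Finset.sum_add_distrib, Finset.sum_const, nsmul_eq_mul, ← Complex.re_sum,
    Finset.sum_add_distrib]
  have q1 := norm_sum_inner_le b hV h₁ s
  have q2 := norm_sum_inner_le b hV h₂ s
  have q3 : (s.card : ℝ) * (δ / (s.card + 1)) ≤ δ := by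
    have hc : (0 : ℝ) < s.card + 1 := by positivity
    rw [mul_div_assoc', div_le_iff₀ hc]
    nlinarith
  have q4 := (Complex.re_le_norm _).trans (norm_add_le
    (∑ n ∈ s, (inner ℂ (V (b n)) (T₁ (b n)) : ℂ)) (∑ n ∈ s, (inner ℂ (V (b n)) (T₂ (b n)) : ℂ)))
  linarith

theorem traceNormE_smul (c : ℂ) (T : H →L[ℂ] H) :
    traceNormE b (c • T) = ‖c‖ₑ * traceNormE b T := by
  have h : absOp (c • T) = ‖c‖ • absOp T := CFC.abs_smul c T
  simp only [traceNormE]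
  rw [← ENNReal.tsum_mul_left]
  refine tsum_congr fun n => ?_
  rw [h, ← ofReal_norm c, ← ENNReal.ofReal_mul (norm_nonneg c), smul_apply,
    inner_smul_right_eq_smul, Complex.smul_re, smul_eq_mul]

theorem traceNormE_eq_zero {T : H →L[ℂ] H} (h : traceNormE b T = 0) : T = 0 := by
  obtain ⟨S, h1, h2⟩ := exists_sqrt_absOp T
  rw [traceNormE_eq b h1 h2, ENNReal.tsum_eq_zero] at h
  have h3 : ∀ n, S (b n) = 0 := by simpa using h
  have h4 : S = 0 := by
    refine ContinuousLinearMap.ext_on (s := Set.range b) ?_ ?_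
    · have := b.dense_span
      rw [Submodule.dense_iff_topologicalClosure_eq_top]
      exact this
    · rintro _ ⟨n, rfl⟩
      simp [h3]
  have h5 : absOp T = 0 := by rw [← h2, h4, mul_zero]
  exact CFC.abs_eq_zero_iff.1 h5

/-- The trace-class operators on `H`. -/
def traceClassSubmodule : Submodule ℂ (H →L[ℂ] H) where
  carrier := {T | traceNormE b T ≠ ∞}
  zero_mem' := by
    have := traceNormE_smul b 0 (0 : H →L[ℂ] H)
    simp only [zero_smul, enorm_zero, zero_mul] at this
    simp [this]
  add_mem' h₁ h₂ :=
    ne_top_of_le_ne_top (ENNReal.add_ne_top.2 ⟨h₁, h₂⟩) (traceNormE_add_le b _ _)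
  smul_mem' c T h := by
    simp only [Set.mem_ofPred_eq, traceNormE_smul]
    exact ENNReal.mul_ne_top enorm_ne_top h

/-- The space `S¹(H)` of trace-class operators on `H`, with the trace norm. Neither the space nor
its norm depends on the orthonormal basis `b`. -/
def TraceClass : Type _ := traceClassSubmodule b

instance : AddCommGroup (TraceClass b) := inferInstanceAs (AddCommGroup (traceClassSubmodule b))
instance : Module ℂ (TraceClass b) := inferInstanceAs (Module ℂ (traceClassSubmodule b))

variable {b}

/-- The underlying bounded operator. -/
def TraceClass.toOp (T : TraceClass b) : H →L[ℂ] H := Subtype.val T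

instance : Norm (TraceClass b) := ⟨fun T => (traceNormE b T.toOp).toReal⟩

theorem TraceClass.norm_def (T : TraceClass b) : ‖T‖ = (traceNormE b T.toOp).toReal := rfl

theorem TraceClass.normedSpaceCore : NormedSpace.Core ℂ (TraceClass b) where
  norm_nonneg T := ENNReal.toReal_nonneg
  norm_smul c T := by
    have h : (c • T).toOp = c • T.toOp := rfl
    rw [TraceClass.norm_def, h, traceNormE_smul, ENNReal.toReal_mul, TraceClass.norm_def,
      toReal_enorm]
  norm_triangle T₁ T₂ := by
    have h : (T₁ + T₂).toOp = T₁.toOp + T₂.toOp := rfl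
    have f₁ : traceNormE b T₁.toOp ≠ ∞ := T₁.2
    have f₂ : traceNormE b T₂.toOp ≠ ∞ := T₂.2
    rw [TraceClass.norm_def, TraceClass.norm_def, TraceClass.norm_def, h,
      ← ENNReal.toReal_add f₁ f₂]
    exact ENNReal.toReal_mono (ENNReal.add_ne_top.2 ⟨f₁, f₂⟩) (traceNormE_add_le b _ _)
  norm_eq_zero_iff T := by
    constructor
    · intro h
      rw [TraceClass.norm_def, ENNReal.toReal_eq_zero_iff] at h
      exact Subtype.ext (traceNormE_eq_zero b (h.resolve_right T.2))
    · rintro rfl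
      have h : (0 : TraceClass b).toOp = (0 : ℂ) • (0 : H →L[ℂ] H) := (zero_smul _ _).symm
      rw [TraceClass.norm_def, h, traceNormE_smul]
      simp

instance : NormedAddCommGroup (TraceClass b) :=
  NormedAddCommGroup.ofCore TraceClass.normedSpaceCore
instance : NormedSpace ℂ (TraceClass b) := NormedSpace.ofCore TraceClass.normedSpaceCore

variable (b) in
/-- The trace `tr T = ∑ₙ ⟨T bₙ, bₙ⟩`; the series converges absolutely if `T` is of trace class. -/
def opTrace (T : H →L[ℂ] H) : ℂ := ∑' n, inner ℂ (b n) (T (b n))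

end TraceClass

/-- The Hilbert space `ℓ²`. -/
abbrev Ell2 : Type := lp (fun _ : ℕ => ℂ) 2

/-- The canonical orthonormal basis of `ℓ²`. -/
def stdBasis : HilbertBasis ℕ ℂ Ell2 := HilbertBasis.ofRepr (LinearIsometryEquiv.refl ℂ Ell2)

/-- `S^∞`: the compact operators on `ℓ²`, with the operator norm. -/
abbrev SInfty : Type := CompactOp Ell2

/-- `S¹`: the trace-class operators on `ℓ²`, with the trace norm. -/
abbrev SOne : Type := TraceClass stdBasis

/-- The trace duality pairing `⟨b, a⟩ = tr(ab)`, for `a ∈ S^∞` and `b ∈ S¹`. -/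
def tracePairing (b : SOne) (a : SInfty) : ℂ := opTrace stdBasis (a.toOp ∘L b.toOp)

end VHardy

end

open VHardy

/-!
# Duality for the Hardy spaces `H¹` of measures and of operator-valued functions

*The dual of `C₀(ℝ; X)`.* A functional `η` has an absolute value, the positive functional
`f ↦ sup {|η F| : ‖F‖ ≤ f}`, which is given by a measure `|η|` by the Riesz representation theorem
(`absMeasure`). As `|η F| ≤ ∫ ‖F‖ d|η|`, the functional extends to `L¹(|η|; X)`, and its values on
the functions `1_E ⊗ x` form the representing measure (`exists_integralFunctional_eq`). The
uniqueness of the measure comes from the density of `C₀(ℝ; X)` in `L¹(|μ|; X)`. Reflecting the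
variable gives `J` (`dualEquiv`).

*Harmonic functions.* A weak* cluster point of the measures `φ(s + iδ) ds`, as `δ → 0`, has the
Poisson integral `φ`, because a scalar harmonic function with bounded horizontal `L¹` norms is the
Poisson extension of its values on any horizontal line (`poisson_representation`, from the mean
value property and a maximum principle). The Poisson kernels span a dense subspace of `C₀(ℝ)`, so
the measure is unique; this gives `P` (`poissonEquiv`).

*Analytic measures.* The Poisson kernel is a difference of Cauchy kernels, `2πi P_z = k_z - k_{z̄}`
with `k_c(t) = (t - c)⁻¹`. So `φ_μ` is holomorphic iff `μ` kills all `k_{z̄}`, `Im z > 0`: otherwise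
`z ↦ ∫ k_{z̄} dμ` would be holomorphic and antiholomorphic, hence constant, while it vanishes at
infinity (`poissonH1_mem_holomorphicH1_iff`). The kernels `k_{z̄}` belong to `H^∞(ℝ)`; conversely
every function of `C₀(ℝ) ∩ H^∞(ℝ)` is a bounded pointwise limit of functions of `C₀(ℝ)` in `H¹(ℝ)`,
and these are limits of superpositions of the kernels `k_{z̄}` (`IsHardy.apply_eq_zero`). Hence
`(Z₀ ⊗ X)^⊥` is `𝐇¹(P₊; X*)`, and the dual of a quotient is an annihilator.

*The operator case.* Analytic measures are absolutely continuous (`variation_absolutelyContinuous`,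
the theorem of F. and M. Riesz): the indicator function of a compact null set is a bounded pointwise
limit of functions `1 - exp(-n g)`, where the `g` are superpositions of Cauchy kernels. The
trace-class operators are the dual of the compact operators (`traceDual`), and on this dual the
adjoints of the compressions `a ↦ P_n a P_n` converge strongly to the identity
(`tendsto_dualMap_compression`). Therefore an absolutely continuous measure has a Bochner integrable
density, the limit of its finite-dimensional compressions (`exists_density`). If the measure is
analytic, its matrix entries are functions in `H¹(ℝ)`, so that the compressions of the density lie
in `H¹(ℝ) ⊗ S¹`, and the density lies in the closure `H¹(ℝ; S¹)`
(`mem_bochnerH1_of_poissonH1_dualDensity_mem`). The converse inclusion is a closed condition which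
holds for elementary tensors (`poissonH1_dualDensity_mem`).
-/

noncomputable section

open Filter Topology
open scoped NNReal CompactlySupported

namespace VHardy


/-! ### Integration against vector measures -/

section Integration

variable {α E E' F F' G G' : Type*} {mα : MeasurableSpace α}
  [NormedAddCommGroup E] [NormedSpace ℝ E] [NormedAddCommGroup E'] [NormedSpace ℝ E']
  [NormedAddCommGroup F] [NormedSpace ℝ F] [NormedAddCommGroup F'] [NormedSpace ℝ F']
  [NormedAddCommGroup G] [NormedSpace ℝ G] [CompleteSpace G]
  [NormedAddCommGroup G'] [NormedSpace ℝ G'] [CompleteSpace G']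

/-- Change of pairing: an identity `M (B e (μ s)) = B' (ℓ e) (ν s)` on sets passes to integrals. -/
theorem map_integral {μ : VectorMeasure α F} {ν : VectorMeasure α F'}
    [IsFiniteMeasure μ.variation] [IsFiniteMeasure ν.variation]
    {B : E →L[ℝ] F →L[ℝ] G} {B' : E' →L[ℝ] F' →L[ℝ] G'} (ℓ : E →L[ℝ] E') (M : G →L[ℝ] G')
    {C : ℝ≥0∞} (hC : C ≠ ∞) (hνμ : ν.variation ≤ C • μ.variation)
    (h : ∀ e s, MeasurableSet s → M (B e (μ s)) = B' (ℓ e) (ν s))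
    {f : α → E} (hf : μ.Integrable f) :
    M (∫ᵛ t, f t ∂[B; μ]) = ∫ᵛ t, ℓ (f t) ∂[B'; ν] := by
  have hac : ν.variation ≪ μ.variation := Measure.absolutelyContinuous_of_le_smul hνμ
  have hint : ∀ {g : α → E}, μ.Integrable g → ν.Integrable (fun t => ℓ (g t)) := fun hg =>
    ℓ.integrable_comp (hg.of_measure_le_smul hC hνμ)
  refine Integrable.induction
    (P := fun f : α → E => M (∫ᵛ t, f t ∂[B; μ]) = ∫ᵛ t, ℓ (f t) ∂[B'; ν]) ?_ ?_ ?_ ?_ hf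
  · intro c s hs _
    have : (fun t => ℓ (s.indicator (fun _ => c) t)) = s.indicator (fun _ => ℓ c) := by
      ext t
      by_cases ht : t ∈ s <;> simp [ht]
    rw [this, VectorMeasure.integral_indicator_const _ hs,
      VectorMeasure.integral_indicator_const _ hs, h c s hs]
  · intro f g _ hf hg e1 e2
    have := VectorMeasure.integral_fun_add (B := B') (hint hf) (hint hg)
    simp only [Pi.add_apply, map_add]
    rw [VectorMeasure.integral_fun_add hf hg, map_add, e1, e2, this]
  · refine IsSeqClosed.isClosed fun u f hu huf => ?_
    have t1 : Tendsto (fun n => M (∫ᵛ t, u n t ∂[B; μ])) atTop (𝓝 (M (∫ᵛ t, f t ∂[B; μ]))) :=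
      ((M.continuous.comp VectorMeasure.continuous_integral).tendsto f).comp huf
    have t2 : Tendsto (fun n => ∫ᵛ t, ℓ (u n t) ∂[B'; ν]) atTop (𝓝 (∫ᵛ t, ℓ (f t) ∂[B'; ν])) := by
      refine VectorMeasure.tendsto_integral_of_L1 _ (hint (L1.integrable_coeFn f)).1
        (Eventually.of_forall fun n => hint (L1.integrable_coeFn (u n))) ?_
      have t3 : Tendsto (fun n => ‖ℓ‖ₑ * (C * edist (u n) f)) atTop (𝓝 (‖ℓ‖ₑ * (C * 0))) :=
        ENNReal.Tendsto.const_mul (ENNReal.Tendsto.const_mul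
          (tendsto_iff_edist_tendsto_0.1 huf) (Or.inr hC)) (Or.inr enorm_ne_top)
      rw [mul_zero, mul_zero] at t3
      refine tendsto_of_tendsto_of_tendsto_of_le_of_le tendsto_const_nhds t3
        (fun _ => zero_le) fun n => ?_
      calc ∫⁻ t, ‖ℓ (u n t) - ℓ (f t)‖ₑ ∂ν.variation
          ≤ ∫⁻ t, ‖ℓ‖ₑ * ‖u n t - f t‖ₑ ∂ν.variation := by
            refine lintegral_mono fun t => ?_
            rw [← map_sub]
            exact ℓ.le_opENorm _
        _ ≤ ∫⁻ t, ‖ℓ‖ₑ * ‖u n t - f t‖ₑ ∂(C • μ.variation) := lintegral_mono' hνμ le_rfl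
        _ = ‖ℓ‖ₑ * (C * edist (u n) f) := by
            rw [lintegral_smul_measure, lintegral_const_mul' _ _ enorm_ne_top, smul_eq_mul,
              L1.edist_def]
            simp only [edist_eq_enorm_sub]
            ring
    exact tendsto_nhds_unique t1 (t2.congr fun n => (hu n).symm)
  · intro f g hfg _ e
    rw [← VectorMeasure.integral_congr_ae hfg, e]
    refine VectorMeasure.integral_congr_ae (hac.ae_le ?_)
    filter_upwards [hfg] with t ht
    rw [ht]

theorem isFiniteMeasure_variation_withDensityᵥ [CompleteSpace F] {m : Measure α} {h : α → F}
    (hh : Integrable h m) : IsFiniteMeasure (m.withDensityᵥ h).variation := by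
  rw [Measure.variation_withDensityᵥ hh]
  exact isFiniteMeasure_withDensity hh.2.ne

/-- The quantitative statement makes the integrals against the density continuous in `L¹(‖h‖ m; E)`.
The function `f` need only be measurable where `h ≠ 0`, so it is replaced by a measurable
representative there. -/
theorem integrable_pairing_of_withDensity {m : Measure α} {h : α → F} (hh : Integrable h m)
    (B : E →L[ℝ] F →L[ℝ] G) {f : α → E} (hf : Integrable f (m.withDensity fun t => ‖h t‖ₑ)) :
    Integrable (fun t => B (f t) (h t)) m ∧
      ∫⁻ t, ‖B (f t) (h t)‖ₑ ∂m ≤ ‖B‖ₑ * ∫⁻ t, ‖f t‖ₑ ∂(m.withDensity fun t => ‖h t‖ₑ) := by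
  have hhm : AEMeasurable (fun t => ‖h t‖ₑ) m := hh.1.enorm
  obtain ⟨g, hg, hfg⟩ := hf.1
  have hfg' : (fun t => B (f t) (h t)) =ᵐ[m] fun t => B (g t) (h t) := by
    rw [Filter.EventuallyEq, ae_withDensity_iff' hhm] at hfg
    filter_upwards [hfg] with t ht
    by_cases h0 : h t = 0
    · simp [h0]
    · rw [ht (by simpa using h0)]
  have hm : AEStronglyMeasurable (fun t => B (g t) (h t)) m :=
    B.aestronglyMeasurable_comp₂ hg.aestronglyMeasurable hh.1
  have hle : ∫⁻ t, ‖B (f t) (h t)‖ₑ ∂m ≤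
      ‖B‖ₑ * ∫⁻ t, ‖f t‖ₑ ∂(m.withDensity fun t => ‖h t‖ₑ) := by
    have e1 : ∫⁻ t, ‖B (f t) (h t)‖ₑ ∂m = ∫⁻ t, ‖B (g t) (h t)‖ₑ ∂m :=
      lintegral_congr_ae (by filter_upwards [hfg'] with t ht; rw [ht])
    have e2 : ∫⁻ t, ‖f t‖ₑ ∂(m.withDensity fun t => ‖h t‖ₑ) =
        ∫⁻ t, ‖g t‖ₑ ∂(m.withDensity fun t => ‖h t‖ₑ) :=
      lintegral_congr_ae (by filter_upwards [hfg] with t ht; rw [ht])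
    rw [e1, e2, lintegral_withDensity_eq_lintegral_mul₀ hhm hg.enorm.aemeasurable,
      ← lintegral_const_mul' _ _ enorm_ne_top]
    refine lintegral_mono fun t => ?_
    refine ((B (g t)).le_opENorm _).trans ?_
    grw [B.le_opENorm]
    simp only [Pi.mul_apply]
    exact le_of_eq (by ring)
  exact ⟨⟨hm.congr hfg'.symm, hle.trans_lt (ENNReal.mul_lt_top enorm_lt_top hf.2)⟩, hle⟩

/-- The integral against a vector measure with a density. -/
theorem integral_withDensityᵥ [CompleteSpace F] {m : Measure α} {h : α → F} (hh : Integrable h m)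
    (B : E →L[ℝ] F →L[ℝ] G) {f : α → E} (hfm : AEStronglyMeasurable f m) {K : ℝ}
    (hf : ∀ t, ‖f t‖ ≤ K) :
    ∫ᵛ t, f t ∂[B; m.withDensityᵥ h] = ∫ t, B (f t) (h t) ∂m := by
  have hv := Measure.variation_withDensityᵥ hh
  have := isFiniteMeasure_variation_withDensityᵥ hh
  have hfi : (m.withDensityᵥ h).Integrable f := by
    refine Integrable.of_bound ?_ K (Eventually.of_forall hf)
    rw [hv]
    exact hfm.mono_ac (withDensity_absolutelyContinuous _ _)
  have hint : ∀ {g : α → E}, Integrable g (m.withDensityᵥ h).variation →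
      Integrable (fun t => B (g t) (h t)) m := fun hg =>
    (integrable_pairing_of_withDensity hh B (hv ▸ hg)).1
  refine Integrable.induction
    (P := fun f : α → E => ∫ᵛ t, f t ∂[B; m.withDensityᵥ h] = ∫ t, B (f t) (h t) ∂m)
    ?_ ?_ ?_ ?_ hfi
  · intro c s hs _
    have : (fun t => B (s.indicator (fun _ => c) t) (h t)) = s.indicator (fun t => B c (h t)) := by
      ext t
      by_cases ht : t ∈ s <;> simp [ht]
    rw [this, VectorMeasure.integral_indicator_const _ hs, integral_indicator hs,
      (B c).integral_comp_comm hh.integrableOn, withDensityᵥ_apply hh hs]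
  · intro f g _ hf hg e1 e2
    simp only [Pi.add_apply, map_add, add_apply]
    rw [VectorMeasure.integral_fun_add hf hg, e1, e2, integral_add (hint hf) (hint hg)]
  · refine IsSeqClosed.isClosed fun u f hu huf => ?_
    have t1 : Tendsto (fun n => ∫ᵛ t, u n t ∂[B; m.withDensityᵥ h]) atTop
        (𝓝 (∫ᵛ t, f t ∂[B; m.withDensityᵥ h])) :=
      (VectorMeasure.continuous_integral.tendsto f).comp huf
    have t2 : Tendsto (fun n => ∫ t, B (u n t) (h t) ∂m) atTop (𝓝 (∫ t, B (f t) (h t) ∂m)) := by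
      refine tendsto_integral_of_L1 _ (hint (L1.integrable_coeFn f)).1
        (Eventually.of_forall fun n => hint (L1.integrable_coeFn (u n))) ?_
      have t3 : Tendsto (fun n => ‖B‖ₑ * edist (u n) f) atTop (𝓝 (‖B‖ₑ * 0)) :=
        ENNReal.Tendsto.const_mul (tendsto_iff_edist_tendsto_0.1 huf) (Or.inr enorm_ne_top)
      rw [mul_zero] at t3
      refine tendsto_of_tendsto_of_tendsto_of_le_of_le tendsto_const_nhds t3
        (fun _ => zero_le) fun n => ?_
      have := (integrable_pairing_of_withDensity hh B (f := fun t => u n t - f t)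
        (hv ▸ ((L1.integrable_coeFn (u n)).sub (L1.integrable_coeFn f)))).2
      simp only [map_sub, sub_apply] at this
      refine this.trans_eq ?_
      rw [L1.edist_def, ← hv]
      simp only [edist_eq_enorm_sub]
    exact tendsto_nhds_unique t1 (t2.congr fun n => (hu n).symm)
  · intro f g hfg _ e
    rw [← VectorMeasure.integral_congr_ae hfg, e]
    refine integral_congr_ae ?_
    rw [hv, Filter.EventuallyEq, ae_withDensity_iff' hh.1.enorm] at hfg
    filter_upwards [hfg] with t ht
    by_cases h0 : h t = 0
    · simp [h0]
    · rw [ht (by simpa using h0)]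

end Integration


/-! ### The space `C₀(ℝ; X)` -/

section ZeroAtInfty

variable {X : Type*} [NormedAddCommGroup X] [NormedSpace ℂ X]

theorem norm_apply_le (F : C₀(ℝ, X)) (t : ℝ) : ‖F t‖ ≤ ‖F‖ :=
  F.toBCF.norm_coe_le_norm t

theorem zeroAtInfty_norm_le {F : C₀(ℝ, X)} {C : ℝ} (hC : 0 ≤ C) (h : ∀ t, ‖F t‖ ≤ C) : ‖F‖ ≤ C :=
  (BoundedContinuousFunction.norm_le hC).2 h

theorem integrable_zeroAtInfty (m : Measure ℝ) [IsFiniteMeasure m] (F : C₀(ℝ, X)) :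
    Integrable F m :=
  Integrable.of_bound (map_continuous F).aestronglyMeasurable ‖F‖
    (Eventually.of_forall (norm_apply_le F))

/-- The reflection `F ↦ F(-·)` of `C₀(ℝ; X)`. -/
def reflect : C₀(ℝ, X) ≃ₗᵢ[ℂ] C₀(ℝ, X) :=
  let r : C₀(ℝ, X) → C₀(ℝ, X) := fun F =>
    { toFun := fun t => F (-t)
      continuous_toFun := (map_continuous F).comp continuous_neg
      zero_at_infty' := (zero_at_infty F).comp
        (Homeomorph.neg ℝ).isClosedEmbedding.tendsto_cocompact }
  { toFun := r
    invFun := r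
    left_inv := fun F => by ext t; exact congrArg F (neg_neg t)
    right_inv := fun F => by ext t; exact congrArg F (neg_neg t)
    map_add' := fun F G => rfl
    map_smul' := fun c F => rfl
    norm_map' := fun F => by
      refine le_antisymm (zeroAtInfty_norm_le (norm_nonneg _) fun t => norm_apply_le F (-t))
        (zeroAtInfty_norm_le (norm_nonneg _) fun t => ?_)
      have := norm_apply_le (r F) (-t)
      simp only [r, ZeroAtInftyContinuousMap.coe_mk, neg_neg] at this
      exact this }

@[simp] theorem reflect_apply (F : C₀(ℝ, X)) (t : ℝ) : reflect F t = F (-t) := rfl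

@[simp] theorem reflect_reflect (F : C₀(ℝ, X)) : reflect (reflect F) = F := by
  ext t; simp

@[simp] theorem tensor_apply (f : C₀(ℝ, ℂ)) (x : X) (t : ℝ) : tensor f x t = f t • x := rfl

theorem reflect_tensor (f : C₀(ℝ, ℂ)) (x : X) : reflect (tensor f x) = tensor (reflect f) x := rfl

/-- A compactly supported continuous function, as an element of `C₀(ℝ; X)`. -/
def ofHasCompactSupport (F : ℝ → X) (hF : Continuous F) (hc : HasCompactSupport F) : C₀(ℝ, X) where
  toFun := F
  continuous_toFun := hF
  zero_at_infty' := hc.is_zero_at_infty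

@[simp] theorem ofHasCompactSupport_apply {F : ℝ → X} (hF : Continuous F)
    (hc : HasCompactSupport F) (t : ℝ) : ofHasCompactSupport F hF hc t = F t := rfl

/-- The class in `L¹(m; X)` of a function in `C₀(ℝ; X)`, for a finite measure `m`. -/
def toL1 (m : Measure ℝ) [IsFiniteMeasure m] : C₀(ℝ, X) →ₗ[ℂ] Lp X 1 m where
  toFun F := (integrable_zeroAtInfty m F).toL1 F
  map_add' F G := Integrable.toL1_add _ _ (integrable_zeroAtInfty m F) (integrable_zeroAtInfty m G)
  map_smul' c F := Integrable.toL1_smul' _ (integrable_zeroAtInfty m F) c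

theorem coeFn_toL1 (m : Measure ℝ) [IsFiniteMeasure m] (F : C₀(ℝ, X)) : toL1 m F =ᵐ[m] F :=
  Integrable.coeFn_toL1 (integrable_zeroAtInfty m F)

theorem norm_toL1 (m : Measure ℝ) [IsFiniteMeasure m] (F : C₀(ℝ, X)) :
    ‖toL1 m F‖ = ∫ t, ‖F t‖ ∂m := by
  rw [L1.norm_eq_integral_norm]
  refine integral_congr_ae ?_
  filter_upwards [coeFn_toL1 m F] with t ht
  rw [ht]

theorem denseRange_toL1 (m : Measure ℝ) [IsFiniteMeasure m] :
    DenseRange (toL1 m : C₀(ℝ, X) →ₗ[ℂ] Lp X 1 m) := by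
  refine Metric.denseRange_iff.2 fun f r hr => ?_
  obtain ⟨g, hc, hg, hgc, hgi⟩ := (L1.integrable_coeFn f).exists_hasCompactSupport_integral_sub_le
    (half_pos hr)
  refine ⟨ofHasCompactSupport g hgc hc, ?_⟩
  rw [dist_eq_norm, L1.norm_eq_integral_norm]
  refine lt_of_le_of_lt (le_of_eq_of_le (integral_congr_ae ?_) hg) (half_lt_self hr)
  filter_upwards [coeFn_toL1 m (ofHasCompactSupport g hgc hc), Lp.coeFn_sub f
    (toL1 m (ofHasCompactSupport g hgc hc))] with t ht ht'
  rw [ht', Pi.sub_apply, ht, ofHasCompactSupport_apply]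

/-- The trapezoidal cutoff equal to `1` on `[-n, n]` and supported in `[-n-1, n+1]`. -/
def cutoff (n : ℕ) (t : ℝ) : ℝ := max 0 (min 1 (n + 1 - |t|))

theorem continuous_cutoff (n : ℕ) : Continuous (cutoff n) := by
  unfold cutoff; fun_prop

theorem cutoff_nonneg (n : ℕ) (t : ℝ) : 0 ≤ cutoff n t := le_max_left _ _

theorem cutoff_le_one (n : ℕ) (t : ℝ) : cutoff n t ≤ 1 := max_le zero_le_one (min_le_left _ _)

theorem cutoff_eq_one {n : ℕ} {t : ℝ} (h : |t| ≤ n) : cutoff n t = 1 := by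
  rw [cutoff, min_eq_left (by linarith), max_eq_right zero_le_one]

theorem hasCompactSupport_cutoff (n : ℕ) : HasCompactSupport (cutoff n) := by
  refine HasCompactSupport.intro (isCompact_Icc (a := -((n : ℝ) + 1)) (b := n + 1)) fun t ht => ?_
  have : (n : ℝ) + 1 ≤ |t| := by
    by_contra! h
    exact ht ⟨(abs_lt.1 h).1.le, (abs_lt.1 h).2.le⟩
  exact max_eq_left ((min_le_right _ _).trans (by linarith))

/-- The product `χ_n F` with the cutoff. -/
def cutoffMul (n : ℕ) (F : C₀(ℝ, X)) : C₀(ℝ, X) :=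
  ofHasCompactSupport (fun t => cutoff n t • F t) ((continuous_cutoff n).smul (map_continuous F))
    (hasCompactSupport_cutoff n).smul_right

@[simp] theorem cutoffMul_apply (n : ℕ) (F : C₀(ℝ, X)) (t : ℝ) :
    cutoffMul n F t = cutoff n t • F t := rfl

theorem norm_cutoffMul_apply_le (n : ℕ) (F : C₀(ℝ, X)) (t : ℝ) :
    ‖cutoffMul n F t‖ ≤ ‖F t‖ := by
  rw [cutoffMul_apply, norm_smul, Real.norm_of_nonneg (cutoff_nonneg n t)]
  exact mul_le_of_le_one_left (norm_nonneg _) (cutoff_le_one n t)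

theorem tendsto_cutoffMul (F : C₀(ℝ, X)) :
    Tendsto (fun n => cutoffMul n F) atTop (𝓝 F) := by
  rw [ZeroAtInftyContinuousMap.tendsto_iff_tendstoUniformly, Metric.tendstoUniformly_iff]
  intro ε hε
  have h0 : ∀ᶠ t in cocompact ℝ, ‖F t‖ < ε := by
    have := (zero_at_infty F).norm
    rw [norm_zero] at this
    exact this.eventually (gt_mem_nhds hε)
  rw [← Metric.cobounded_eq_cocompact, ← comap_norm_atTop, eventually_comap] at h0
  obtain ⟨R, hR⟩ := eventually_atTop.1 h0
  filter_upwards [eventually_ge_atTop ⌈R⌉₊] with n hn t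
  rw [dist_eq_norm, cutoffMul_apply]
  by_cases ht : |t| ≤ n
  · simpa [cutoff_eq_one ht] using hε
  · have h1 : ‖F t‖ < ε := hR _ ((Nat.ceil_le.1 hn).trans (not_le.1 ht).le) t rfl
    have h2 : F t - cutoff n t • F t = (1 - cutoff n t) • F t := by rw [sub_smul, one_smul]
    rw [h2, norm_smul, Real.norm_of_nonneg (by linarith [cutoff_le_one n t])]
    exact (mul_le_of_le_one_left (norm_nonneg _) (by linarith [cutoff_nonneg n t])).trans_lt h1

end ZeroAtInfty

/-! ### Functionals given by vector measures -/

section Duality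

variable {X : Type*} [NormedAddCommGroup X] [NormedSpace ℂ X]

/-- The real structure on the dual is the one underlying its complex structure. The priority makes
the vector integrals against `X*`-valued measures use this structure throughout. -/
instance (priority := 2000) dualNormedSpaceReal : NormedSpace ℝ (StrongDual ℂ X) :=
  NormedSpace.complexToReal

/-- Real bilinear pairings of complex normed spaces; the integral against a vector measure takes its
pairing in this form. -/
abbrev RealPairing (X Y W : Type*) [NormedAddCommGroup X] [NormedSpace ℂ X] [NormedAddCommGroup Y]
    [NormedSpace ℂ Y] [NormedAddCommGroup W] [NormedSpace ℂ W] : Type _ := X →L[ℝ] Y →L[ℝ] W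

/-- A complex bilinear pairing, regarded as a real one. -/
def realPairing {X Y W : Type*} [NormedAddCommGroup X] [NormedSpace ℂ X] [NormedAddCommGroup Y]
    [NormedSpace ℂ Y] [NormedAddCommGroup W] [NormedSpace ℂ W] (T : X →L[ℂ] Y →L[ℂ] W) :
    RealPairing X Y W :=
  LinearMap.mkContinuous₂ (LinearMap.mk₂ ℝ (fun (x : X) (y : Y) => T x y)
    (fun x y φ => by simp) (fun c x φ => by
      rw [← Complex.coe_smul, map_smul, smul_apply, Complex.coe_smul])
    (fun x φ ψ => by simp) (fun c x φ => by
      rw [← Complex.coe_smul, map_smul, Complex.coe_smul])) ‖T‖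
    fun x y => T.le_opNorm₂ x y

theorem norm_realPairing_le {X Y W : Type*} [NormedAddCommGroup X] [NormedSpace ℂ X]
    [NormedAddCommGroup Y] [NormedSpace ℂ Y] [NormedAddCommGroup W] [NormedSpace ℂ W]
    (T : X →L[ℂ] Y →L[ℂ] W) : ‖realPairing T‖ ≤ ‖T‖ :=
  LinearMap.mkContinuous₂_norm_le _ (norm_nonneg T) _

variable (X) in
/-- The evaluation pairing between `X` and its dual. -/
def evPairing : RealPairing X (StrongDual ℂ X) ℂ :=
  realPairing (ContinuousLinearMap.apply ℂ ℂ)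

@[simp] theorem evPairing_apply (x : X) (φ : StrongDual ℂ X) : evPairing X x φ = φ x := rfl

theorem norm_evPairing_le : ‖evPairing X‖ ≤ 1 :=
  (norm_realPairing_le _).trans (ContinuousLinearMap.opNorm_le_bound _ zero_le_one fun x =>
    ContinuousLinearMap.opNorm_le_bound _ (by positivity) fun φ => by
      simpa [mul_comm] using φ.le_opNorm x)

instance (Z : Type*) [NormedAddCommGroup Z] [NormedSpace ℂ Z] (μ : BddMeasure Z) :
    IsFiniteMeasure μ.toVM.variation := ⟨lt_top_iff_ne_top.2 μ.2⟩

/-- The functional `F ↦ ∫ ⟨F(t), dμ(t)⟩` on `C₀(ℝ; X)`, for `μ ∈ M(ℝ; X*)`. -/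
def integralFunctional (μ : BddMeasure (StrongDual ℂ X)) : StrongDual ℂ C₀(ℝ, X) :=
  LinearMap.mkContinuous
    { toFun := fun F => ∫ᵛ t, F t ∂[evPairing X; μ.toVM]
      map_add' := fun F G => VectorMeasure.integral_fun_add (integrable_zeroAtInfty _ F)
        (integrable_zeroAtInfty _ G)
      map_smul' := fun c F => by
        refine (map_integral (μ := μ.toVM) (ν := μ.toVM) (B := evPairing X) (B' := evPairing X)
          (ℓ := (c • ContinuousLinearMap.id ℂ X).restrictScalars ℝ)
          (M := (c • ContinuousLinearMap.id ℂ ℂ).restrictScalars ℝ) ENNReal.one_ne_top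
          (by simp) (fun x s _ => ?_) (integrable_zeroAtInfty _ F)).symm
        simp }
    ‖μ‖ fun F => by
      have := VectorMeasure.norm_integral_le_of_norm_le_const (B := evPairing X)
        (μ := μ.toVM) (f := F) (C := ‖F‖) (Eventually.of_forall (norm_apply_le F))
      refine this.trans ?_
      rw [mul_comm ‖μ‖]
      exact mul_le_mul_of_nonneg_right (mul_le_of_le_one_right (norm_nonneg _) norm_evPairing_le)
        (norm_nonneg μ)

theorem integralFunctional_apply (μ : BddMeasure (StrongDual ℂ X)) (F : C₀(ℝ, X)) :
    integralFunctional μ F = ∫ᵛ t, F t ∂[evPairing X; μ.toVM] := rfl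

theorem norm_integralFunctional_le (μ : BddMeasure (StrongDual ℂ X)) :
    ‖integralFunctional μ‖ ≤ ‖μ‖ := LinearMap.mkContinuous_norm_le _ (norm_nonneg _) _

theorem integralFunctional_add (μ ν : BddMeasure (StrongDual ℂ X)) :
    integralFunctional (μ + ν) = integralFunctional μ + integralFunctional ν := by
  ext F
  exact VectorMeasure.integral_add_vectorMeasure (integrable_zeroAtInfty μ.toVM.variation F)
    (integrable_zeroAtInfty ν.toVM.variation F)

theorem integralFunctional_smul (c : ℂ) (μ : BddMeasure (StrongDual ℂ X)) :
    integralFunctional (c • μ) = c • integralFunctional μ := by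
  ext F
  refine (map_integral (μ := μ.toVM) (ν := (c • μ).toVM) (B := evPairing X) (B' := evPairing X)
    (ℓ := ContinuousLinearMap.id ℝ X) (M := (c • ContinuousLinearMap.id ℂ ℂ).restrictScalars ℝ)
    (C := ‖c‖₊) ENNReal.coe_ne_top ?_ (fun x s _ => ?_) (integrable_zeroAtInfty _ F)).symm
  · have : (c • μ).toVM = c • μ.toVM := rfl
    rw [this, VectorMeasure.variation_smul]
    rfl
  · have : (c • μ).toVM = c • μ.toVM := rfl
    simp [this]

/-- A bounded measure is determined by the functional it induces, as `C₀(ℝ; X)` is dense in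
`L¹(|μ|; X)`. -/
theorem eq_zero_of_integralFunctional_eq_zero {μ : BddMeasure (StrongDual ℂ X)}
    (h : integralFunctional μ = 0) : μ = 0 := by
  have h0 : ∀ f : Lp X 1 μ.toVM.variation, ∫ᵛ t, f t ∂[evPairing X; μ.toVM] = 0 := by
    refine fun f => (denseRange_toL1 μ.toVM.variation).induction_on f
      (isClosed_eq VectorMeasure.continuous_integral continuous_const) fun F => ?_
    rw [VectorMeasure.integral_congr_ae (coeFn_toL1 _ F)]
    exact congrArg (fun ξ : StrongDual ℂ C₀(ℝ, X) => ξ F) h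
  refine Subtype.ext (VectorMeasure.ext fun s hs => ContinuousLinearMap.ext fun x => ?_)
  have h1 := h0 (indicatorConstLp 1 hs (measure_ne_top _ s) x)
  rw [VectorMeasure.integral_congr_ae indicatorConstLp_coeFn,
    VectorMeasure.integral_indicator_const _ hs] at h1
  exact h1

end Duality


/-! ### Singer's representation theorem -/

section Singer

variable {X : Type*} [NormedAddCommGroup X] [NormedSpace ℂ X]

/-- The values `|η F|` over the `F ∈ C₀(ℝ; X)` with `‖F‖ ≤ f` pointwise. -/
def dominatedValues (η : StrongDual ℂ C₀(ℝ, X)) (f : C_c(ℝ, ℝ≥0)) : Set ℝ≥0 :=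
  {r | ∃ F : C₀(ℝ, X), (∀ t, ‖F t‖ ≤ f t) ∧ r = ‖η F‖₊}

theorem dominatedValues_nonempty (η : StrongDual ℂ C₀(ℝ, X)) (f : C_c(ℝ, ℝ≥0)) :
    (dominatedValues η f).Nonempty := ⟨0, 0, fun t => by simp, by simp⟩

theorem dominatedValues_le (η : StrongDual ℂ C₀(ℝ, X)) {f : C_c(ℝ, ℝ≥0)} {C : ℝ≥0}
    (hC : ∀ t, f t ≤ C) {r : ℝ≥0} (hr : r ∈ dominatedValues η f) : r ≤ ‖η‖₊ * C := by
  obtain ⟨F, hF, rfl⟩ := hr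
  refine (η.le_opNNNorm F).trans ?_
  gcongr
  exact zeroAtInfty_norm_le C.2 fun t => (hF t).trans (NNReal.coe_le_coe.2 (hC t))

theorem bddAbove_dominatedValues (η : StrongDual ℂ C₀(ℝ, X)) (f : C_c(ℝ, ℝ≥0)) :
    BddAbove (dominatedValues η f) := by
  obtain ⟨C, hC⟩ := (map_continuous f).bddAbove_range_of_hasCompactSupport f.hasCompactSupport
  exact ⟨‖η‖₊ * C, fun r hr => dominatedValues_le η (fun t => hC ⟨t, rfl⟩) hr⟩

/-- The absolute value `|η|(f) = sup {|η F| : ‖F‖ ≤ f}` of `η`, on nonnegative scalar functions. -/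
def absFunctional (η : StrongDual ℂ C₀(ℝ, X)) (f : C_c(ℝ, ℝ≥0)) : ℝ≥0 := sSup (dominatedValues η f)

theorem le_absFunctional (η : StrongDual ℂ C₀(ℝ, X)) {f : C_c(ℝ, ℝ≥0)} {F : C₀(ℝ, X)}
    (hF : ∀ t, ‖F t‖ ≤ f t) : ‖η F‖₊ ≤ absFunctional η f :=
  le_csSup (bddAbove_dominatedValues η f) ⟨F, hF, rfl⟩

theorem absFunctional_le (η : StrongDual ℂ C₀(ℝ, X)) {f : C_c(ℝ, ℝ≥0)} {C : ℝ≥0}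
    (h : ∀ F : C₀(ℝ, X), (∀ t, ‖F t‖ ≤ f t) → ‖η F‖₊ ≤ C) : absFunctional η f ≤ C :=
  csSup_le (dominatedValues_nonempty η f) (by rintro _ ⟨F, hF, rfl⟩; exact h F hF)

theorem exists_unit_mul_eq_norm (z : ℂ) : ∃ c : ℂ, ‖c‖ = 1 ∧ c * z = ‖z‖ := by
  by_cases hz : z = 0
  · exact ⟨1, by simp, by simp [hz]⟩
  · have : (‖z‖ : ℂ) ≠ 0 := by simpa using hz
    refine ⟨‖z‖ / z, by simp [hz], by field_simp⟩

/-- The absolute value is superadditive; `exists_split` gives the converse inequality. -/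
theorem absFunctional_add_ge (η : StrongDual ℂ C₀(ℝ, X)) (f g : C_c(ℝ, ℝ≥0)) :
    absFunctional η f + absFunctional η g ≤ absFunctional η (f + g) := by
  have key : ∀ F : C₀(ℝ, X), (∀ t, ‖F t‖ ≤ f t) → ∀ G : C₀(ℝ, X), (∀ t, ‖G t‖ ≤ g t) →
      ‖η F‖₊ + ‖η G‖₊ ≤ absFunctional η (f + g) := by
    intro F hF G hG
    -- rotate `F` and `G` so that `η F` and `η G` become nonnegative
    obtain ⟨a, ha, ha'⟩ := exists_unit_mul_eq_norm (η F)
    obtain ⟨b, hb, hb'⟩ := exists_unit_mul_eq_norm (η G)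
    refine le_trans (le_of_eq ?_) (le_absFunctional η (F := a • F + b • G) fun t => ?_)
    · rw [map_add, map_smul, map_smul, smul_eq_mul, smul_eq_mul, ha', hb', ← Complex.ofReal_add]
      ext
      rw [coe_nnnorm, Complex.norm_real, Real.norm_of_nonneg (by positivity)]
      rfl
    · refine (norm_add_le _ _).trans ?_
      change ‖a • F t‖ + ‖b • G t‖ ≤ _
      rw [norm_smul, norm_smul, ha, hb, one_mul, one_mul]
      exact add_le_add (hF t) (hG t)
  have h1 : ∀ F : C₀(ℝ, X), (∀ t, ‖F t‖ ≤ f t) → 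
      absFunctional η g ≤ absFunctional η (f + g) - ‖η F‖₊ := fun F hF =>
    absFunctional_le η fun G hG => le_tsub_of_add_le_left (key F hF G hG)
  have h2 : absFunctional η g ≤ absFunctional η (f + g) :=
    (h1 0 (by simp)).trans tsub_le_self
  have h3 : absFunctional η f ≤ absFunctional η (f + g) - absFunctional η g := by
    refine absFunctional_le η fun F hF => le_tsub_of_add_le_left ?_
    have h4 : ‖η F‖₊ ≤ absFunctional η (f + g) := by simpa using key F hF 0 (by simp)
    exact (add_le_of_le_tsub_right_of_le h4 (h1 F hF))
  exact (add_le_of_le_tsub_right_of_le h2 h3)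

/-- A function dominated by `f + g` splits as a sum of functions dominated by `f` and by `g`. -/
theorem exists_split {f g : C_c(ℝ, ℝ≥0)} {H : C₀(ℝ, X)} (hH : ∀ t, ‖H t‖ ≤ (f + g) t) :
    ∃ F : C₀(ℝ, X), (∀ t, ‖F t‖ ≤ f t) ∧ ∀ t, ‖(H - F) t‖ ≤ g t := by
  have hH' : ∀ t, ‖H t‖ ≤ f t + g t := hH
  have hf0 : ∀ t, (0 : ℝ) ≤ f t := fun t => (f t).2
  have hg0 : ∀ t, (0 : ℝ) ≤ g t := fun t => (g t).2
  have hq : ∀ t, (0 : ℝ) ≤ f t / (f t + g t) ∧ (f t / (f t + g t) : ℝ) ≤ 1 := fun t =>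
    ⟨div_nonneg (hf0 t) (add_nonneg (hf0 t) (hg0 t)),
      div_le_one_of_le₀ (le_add_of_nonneg_right (hg0 t)) (add_nonneg (hf0 t) (hg0 t))⟩
  have hle : ∀ t, ‖(f t / (f t + g t) : ℝ) • H t‖ ≤ ‖H t‖ := fun t => by
    rw [norm_smul, Real.norm_of_nonneg (hq t).1]
    exact mul_le_of_le_one_left (norm_nonneg _) (hq t).2
  -- `F = f / (f + g) H`, where `0 / 0 = 0` is harmless because `H` vanishes with `f + g`
  refine ⟨⟨⟨fun t => (f t / (f t + g t) : ℝ) • H t, ?_⟩, ?_⟩, fun t => ?_, fun t => ?_⟩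
  · refine continuous_iff_continuousAt.2 fun t => ?_
    by_cases ht : (f t + g t : ℝ) = 0
    · have h0 : H t = 0 := by simpa using (hH' t).trans ht.le
      have : Tendsto (fun s => ‖H s‖) (𝓝 t) (𝓝 0) := by
        simpa [h0] using (map_continuous H).norm.tendsto t
      rw [ContinuousAt, h0, smul_zero]
      exact squeeze_zero_norm hle this
    · exact (((NNReal.continuous_coe.comp (map_continuous f)).continuousAt).div
        ((NNReal.continuous_coe.comp (map_continuous f)).add
          (NNReal.continuous_coe.comp (map_continuous g))).continuousAt ht).smul
        (map_continuous H).continuousAt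
  · exact squeeze_zero_norm hle (by simpa using (zero_at_infty H).norm)
  · change ‖(f t / (f t + g t) : ℝ) • H t‖ ≤ f t
    rw [norm_smul, Real.norm_of_nonneg (hq t).1]
    by_cases ht : (f t + g t : ℝ) = 0
    · simp [ht]
    · have : 0 < (f t + g t : ℝ) := lt_of_le_of_ne (add_nonneg (hf0 t) (hg0 t)) (Ne.symm ht)
      calc _ ≤ (f t / (f t + g t) : ℝ) * (f t + g t) :=
            mul_le_mul_of_nonneg_left (hH' t) (hq t).1
        _ = f t := by field_simp
  · change ‖H t - (f t / (f t + g t) : ℝ) • H t‖ ≤ g t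
    by_cases ht : (f t + g t : ℝ) = 0
    · have h0 : H t = 0 := by simpa using (hH' t).trans ht.le
      simp [h0]
    · have hp : 0 < (f t + g t : ℝ) := lt_of_le_of_ne (add_nonneg (hf0 t) (hg0 t)) (Ne.symm ht)
      have h1 : H t - (f t / (f t + g t) : ℝ) • H t = (1 - f t / (f t + g t) : ℝ) • H t := by
        rw [sub_smul, one_smul]
      rw [h1, norm_smul, Real.norm_of_nonneg (by linarith [(hq t).2])]
      calc _ ≤ (1 - f t / (f t + g t) : ℝ) * (f t + g t) :=
            mul_le_mul_of_nonneg_left (hH' t) (by linarith [(hq t).2])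
        _ = g t := by field_simp; ring

theorem absFunctional_add (η : StrongDual ℂ C₀(ℝ, X)) (f g : C_c(ℝ, ℝ≥0)) :
    absFunctional η (f + g) = absFunctional η f + absFunctional η g := by
  refine le_antisymm (absFunctional_le η fun H hH => ?_) (absFunctional_add_ge η f g)
  obtain ⟨F, hF, hG⟩ := exists_split hH
  have : η H = η F + η (H - F) := by rw [← map_add, add_sub_cancel]
  rw [this]
  exact (nnnorm_add_le _ _).trans (add_le_add (le_absFunctional η hF) (le_absFunctional η hG))

theorem absFunctional_smul (η : StrongDual ℂ C₀(ℝ, X)) (c : ℝ≥0) (f : C_c(ℝ, ℝ≥0)) :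
    absFunctional η (c • f) = c * absFunctional η f := by
  have key : ∀ (c : ℝ≥0) (f : C_c(ℝ, ℝ≥0)), c ≠ 0 →
      c * absFunctional η f ≤ absFunctional η (c • f) := by
    intro c f hc
    rw [← le_inv_mul_iff₀ (pos_iff_ne_zero.2 hc)]
    refine absFunctional_le η fun F hF => ?_
    rw [le_inv_mul_iff₀ (pos_iff_ne_zero.2 hc)]
    refine le_trans (le_of_eq ?_) (le_absFunctional η (F := ((c : ℝ) : ℂ) • F) fun t => ?_)
    · rw [map_smul]
      ext
      simp
    · have hc' : ‖((c : ℝ) : ℂ)‖ = c := by simp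
      rw [ZeroAtInftyContinuousMap.smul_apply, norm_smul, hc']
      exact mul_le_mul_of_nonneg_left (hF t) c.2
  rcases eq_or_ne c 0 with rfl | hc
  · rw [zero_mul, zero_smul]
    refine le_antisymm (absFunctional_le η fun F hF => ?_) zero_le
    have : F = 0 := by
      ext t
      simpa using hF t
    simp [this]
  · refine le_antisymm ?_ (key c f hc)
    have := key c⁻¹ (c • f) (inv_ne_zero hc)
    rwa [smul_smul, inv_mul_cancel₀ hc, one_smul, inv_mul_le_iff₀ (pos_iff_ne_zero.2 hc)] at this

/-- The absolute value of `η` as a linear functional. -/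
def absFunctionalₗ (η : StrongDual ℂ C₀(ℝ, X)) : C_c(ℝ, ℝ≥0) →ₗ[ℝ≥0] ℝ≥0 where
  toFun := absFunctional η
  map_add' := absFunctional_add η
  map_smul' := absFunctional_smul η

/-- The measure `|η|`, which satisfies `|η F| ≤ ∫ ‖F‖ d|η|`. -/
def absMeasure (η : StrongDual ℂ C₀(ℝ, X)) : Measure ℝ := NNRealRMK.rieszMeasure (absFunctionalₗ η)

theorem absMeasure_univ_le (η : StrongDual ℂ C₀(ℝ, X)) : absMeasure η Set.univ ≤ ‖η‖ₑ := by
  have hU : ⋃ n : ℕ, Set.Icc (-(n : ℝ)) n = Set.univ := by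
    refine Set.eq_univ_of_forall fun t => Set.mem_iUnion.2 ⟨⌈|t|⌉₊, ?_⟩
    exact abs_le.1 (Nat.le_ceil _)
  have hm : Monotone fun n : ℕ => Set.Icc (-(n : ℝ)) n := fun n k h =>
    Set.Icc_subset_Icc (by simpa using h) (by simpa using h)
  rw [← hU, hm.measure_iUnion]
  refine iSup_le fun n => ?_
  let f : C_c(ℝ, ℝ≥0) :=
    ⟨⟨fun t => (cutoff n t).toNNReal, continuous_real_toNNReal.comp (continuous_cutoff n)⟩,
      (hasCompactSupport_cutoff n).comp_left Real.toNNReal_zero⟩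
  have hf : ∀ t, f t ≤ 1 := fun t => Real.toNNReal_le_one.2 (cutoff_le_one n t)
  calc absMeasure η (Set.Icc (-(n : ℝ)) n)
      = ∫⁻ t in Set.Icc (-(n : ℝ)) n, 1 ∂(absMeasure η) := by simp
    _ ≤ ∫⁻ t in Set.Icc (-(n : ℝ)) n, f t ∂(absMeasure η) := by
        refine setLIntegral_mono' measurableSet_Icc fun t ht => ?_
        have : f t = 1 := by
          change (cutoff n t).toNNReal = 1
          rw [cutoff_eq_one (abs_le.2 ht), Real.toNNReal_one]
        simp [this]
    _ ≤ ∫⁻ t, f t ∂(absMeasure η) := setLIntegral_le_lintegral _ _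
    _ = absFunctional η f := NNRealRMK.lintegral_rieszMeasure _ f
    _ ≤ ‖η‖ₑ := by
        rw [enorm_eq_nnnorm, ENNReal.coe_le_coe]
        refine absFunctional_le η fun F hF => ?_
        simpa using dominatedValues_le η hf ⟨F, hF, rfl⟩

instance (η : StrongDual ℂ C₀(ℝ, X)) : IsFiniteMeasure (absMeasure η) :=
  ⟨(absMeasure_univ_le η).trans_lt enorm_lt_top⟩

/-- The functional `η` is bounded by the `L¹(|η|; X)` seminorm; for compactly supported functions this
is the definition of `|η|`, and the cutoffs give the general case. -/
theorem norm_le_integral_absMeasure (η : StrongDual ℂ C₀(ℝ, X)) (F : C₀(ℝ, X)) :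
    ‖η F‖ ≤ ∫ t, ‖F t‖ ∂(absMeasure η) := by
  refine le_of_tendsto ((η.continuous.norm.tendsto F).comp (tendsto_cutoffMul F))
    (Eventually.of_forall fun n => ?_)
  let f : C_c(ℝ, ℝ≥0) :=
    ⟨⟨fun t => ‖cutoffMul n F t‖₊, (map_continuous (cutoffMul n F)).nnnorm⟩,
      HasCompactSupport.comp_left (g := fun x : X => ‖x‖₊)
        (hasCompactSupport_cutoff n).smul_right nnnorm_zero⟩
  have h1 : ‖η (cutoffMul n F)‖₊ ≤ absFunctional η f := le_absFunctional η fun t => le_rfl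
  have h2 : ∫ t, (f t : ℝ) ∂(absMeasure η) = absFunctional η f :=
    NNRealRMK.integral_rieszMeasure _ f
  calc ‖η (cutoffMul n F)‖ ≤ absFunctional η f := h1
    _ = ∫ t, ‖cutoffMul n F t‖ ∂(absMeasure η) := h2.symm
    _ ≤ ∫ t, ‖F t‖ ∂(absMeasure η) := integral_mono (integrable_zeroAtInfty _ _).norm
        (integrable_zeroAtInfty _ F).norm (norm_cutoffMul_apply_le n F)

theorem exists_extension_of_norm_le {E L : Type*} [NormedAddCommGroup E] [NormedSpace ℂ E]
    [NormedAddCommGroup L] [NormedSpace ℂ L] (f : StrongDual ℂ E) (e : E →ₗ[ℂ] L)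
    (hd : DenseRange e) (h : ∀ x, ‖f x‖ ≤ ‖e x‖) :
    ∃ g : StrongDual ℂ L, (∀ x, g (e x) = f x) ∧ ∀ y, ‖g y‖ ≤ ‖y‖ := by
  have h' : ∀ x, ‖(f : E →ₗ[ℂ] ℂ) x‖ ≤ 1 * ‖e x‖ := fun x => by rw [one_mul]; exact h x
  refine ⟨(f : E →ₗ[ℂ] ℂ).extendOfNorm e, LinearMap.extendOfNorm_eq hd ⟨1, h'⟩, fun y => ?_⟩
  simpa using LinearMap.norm_extendOfNorm_apply_le hd 1 h' y

/-- A continuous additive map on `L¹(m; E)` with the right values on the functions `1_s ⊗ e` is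
the integral against `μ`, as soon as `|μ| ≤ m`. -/
theorem integral_eq_of_indicator {α E F G : Type*} [MeasurableSpace α] [NormedAddCommGroup E]
    [NormedSpace ℝ E] [NormedAddCommGroup F] [NormedSpace ℝ F] [NormedAddCommGroup G]
    [NormedSpace ℝ G] [CompleteSpace G] {μ : VectorMeasure α F} {m : Measure α} [IsFiniteMeasure m]
    {B : E →L[ℝ] F →L[ℝ] G} (hμm : μ.variation ≤ m) (g : Lp E 1 m → G) (hgc : Continuous g)
    (hga : ∀ f f', g (f + f') = g f + g f')
    (hg : ∀ e s (hs : MeasurableSet s), g (indicatorConstLp 1 hs (measure_ne_top m s) e) = B e (μ s))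
    {f : α → E} (hf : Integrable f m) : ∫ᵛ t, f t ∂[B; μ] = g (hf.toL1 f) := by
  have : IsFiniteMeasure μ.variation := ⟨(hμm _).trans_lt (measure_lt_top m _)⟩
  have hint : ∀ {f : α → E}, Integrable f m → μ.Integrable f := fun h => h.mono_measure hμm
  suffices h : ∀ hf : Integrable f m, ∫ᵛ t, f t ∂[B; μ] = g (hf.toL1 f) from h hf
  refine Integrable.induction
    (P := fun f : α → E => ∀ hf : Integrable f m, ∫ᵛ t, f t ∂[B; μ] = g (hf.toL1 f))
    ?_ ?_ ?_ ?_ hf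
  · intro e s hs _ hf
    rw [VectorMeasure.integral_indicator_const _ hs, ← hg e s hs]
    congr 1
  · intro f f' _ hf hf' e1 e2 h
    have h3 : h.toL1 (f + f') = hf.toL1 f + hf'.toL1 f' := rfl
    rw [h3, hga, ← e1 hf, ← e2 hf']
    exact VectorMeasure.integral_fun_add (hint hf) (hint hf')
  · have h1 : {f : Lp E 1 m | ∀ hf : Integrable f m, ∫ᵛ t, f t ∂[B; μ] = g (hf.toL1 f)} =
        {f | ∫ᵛ t, f t ∂[B; μ] = g f} := by
      ext f
      refine ⟨fun h => ?_, fun h hf => ?_⟩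
      · have := h (L1.integrable_coeFn f)
        rwa [Integrable.toL1_coeFn] at this
      · rwa [Integrable.toL1_coeFn]
    rw [h1]
    refine isClosed_eq (continuous_iff_continuousAt.2 fun f => ?_) hgc
    refine VectorMeasure.tendsto_integral_of_L1 _ (hint (L1.integrable_coeFn f)).1
      (Eventually.of_forall fun f' => hint (L1.integrable_coeFn f')) ?_
    refine tendsto_of_tendsto_of_tendsto_of_le_of_le tendsto_const_nhds
      (tendsto_iff_edist_tendsto_0.1 (tendsto_id (x := 𝓝 f)))
      (fun _ => zero_le) fun f' => ?_
    refine (lintegral_mono' hμm le_rfl).trans (le_of_eq ?_)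
    rw [id, L1.edist_def]
    simp only [edist_eq_enorm_sub]
  · intro f f' hff' _ e hf'
    have hf : Integrable f m := hf'.congr hff'.symm
    have h1 := VectorMeasure.integral_congr_ae (B := B) ((Measure.absolutelyContinuous_of_le hμm).ae_le hff')
    rw [← h1, e hf]
    congr 1
    exact (Integrable.toL1_eq_toL1_iff _ _ _ _).2 hff'

theorem indicatorConstLp_smul {m : Measure ℝ} [IsFiniteMeasure m] {s : Set ℝ}
    (hs : MeasurableSet s) (c : ℂ) (x : X) :
    indicatorConstLp 1 hs (measure_ne_top m s) (c • x) =
      c • indicatorConstLp 1 hs (measure_ne_top m s) x := by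
  refine Lp.ext ?_
  filter_upwards [indicatorConstLp_coeFn (p := 1) (hs := hs)
    (hμs := measure_ne_top m s) (c := c • x), indicatorConstLp_coeFn (p := 1) (hs := hs)
    (hμs := measure_ne_top m s) (c := x), Lp.coeFn_smul c
    (indicatorConstLp 1 hs (measure_ne_top m s) x)] with t h1 h2 h3
  rw [h1, h3, Pi.smul_apply, h2]
  by_cases ht : t ∈ s <;> simp [ht]

open Classical in
/-- The functional `x ↦ g (1_s ⊗ x)`, for a contractive functional `g` on `L¹(m; X)`. -/
def indicatorFunctional {m : Measure ℝ} [IsFiniteMeasure m] (g : StrongDual ℂ (Lp X 1 m))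
    (hg : ∀ y, ‖g y‖ ≤ ‖y‖) (s : Set ℝ) : StrongDual ℂ X :=
  if hs : MeasurableSet s then
    LinearMap.mkContinuous
      { toFun := fun x => g (indicatorConstLp 1 hs (measure_ne_top m s) x)
        map_add' := fun x y => by rw [← indicatorConstLp_add, map_add]
        map_smul' := fun c x => by rw [indicatorConstLp_smul, map_smul, RingHom.id_apply] }
      (m.real s) fun x => by
        refine (hg _).trans (le_of_eq ?_)
        rw [norm_indicatorConstLp one_ne_zero ENNReal.one_ne_top]
        simp [mul_comm]
  else 0

/-- A finitely additive set function dominated by a finite measure `m` is a bounded measure. -/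
def BddMeasure.ofNormLe {Z : Type*} [NormedAddCommGroup Z] [NormedSpace ℂ Z] (m : Measure ℝ)
    [IsFiniteMeasure m] (r : Set ℝ → Z) (hr : ∀ s, ‖r s‖ ≤ m.real s)
    (hadd : ∀ s t, MeasurableSet s → MeasurableSet t → Disjoint s t → r (s ∪ t) = r s + r t)
    (h0 : ∀ s, ¬ MeasurableSet s → r s = 0) : BddMeasure Z :=
  have hr' : ∀ s, ‖r s‖ₑ ≤ m s := fun s => by
    rw [← ofReal_norm, ENNReal.ofReal_le_iff_le_toReal (measure_ne_top m s)]
    exact hr s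
  ⟨VectorMeasure.of_additive_of_le_measure (μ := m) r hr' hadd h0,
    ne_top_of_le_ne_top (measure_ne_top m Set.univ)
      (VectorMeasure.variation_le_of_forall_enorm_le (fun s _ => hr' s) _)⟩

section OfNormLe

variable {Z : Type*} [NormedAddCommGroup Z] [NormedSpace ℂ Z] {m : Measure ℝ}
    [IsFiniteMeasure m] {r : Set ℝ → Z} (hr : ∀ s, ‖r s‖ ≤ m.real s)
    (hadd : ∀ s t, MeasurableSet s → MeasurableSet t → Disjoint s t → r (s ∪ t) = r s + r t)
    (h0 : ∀ s, ¬ MeasurableSet s → r s = 0)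

theorem BddMeasure.variation_ofNormLe_le : (ofNormLe m r hr hadd h0).toVM.variation ≤ m :=
  VectorMeasure.variation_le_of_forall_enorm_le fun s _ => by
    rw [← ofReal_norm, ENNReal.ofReal_le_iff_le_toReal (measure_ne_top m s)]
    exact hr s

end OfNormLe

section IndicatorFunctional

variable {m : Measure ℝ} [IsFiniteMeasure m] {g : StrongDual ℂ (Lp X 1 m)}
    (hg : ∀ y, ‖g y‖ ≤ ‖y‖)

theorem indicatorFunctional_apply {s : Set ℝ} (hs : MeasurableSet s) (x : X) :
    indicatorFunctional g hg s x = g (indicatorConstLp 1 hs (measure_ne_top m s) x) := by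
  simp only [indicatorFunctional, hs, dite_true]
  rfl

theorem indicatorFunctional_of_not_measurable {s : Set ℝ} (hs : ¬ MeasurableSet s) :
    indicatorFunctional g hg s = 0 := by
  simp [indicatorFunctional, hs]

theorem norm_indicatorFunctional_le (s : Set ℝ) : ‖indicatorFunctional g hg s‖ ≤ m.real s := by
  by_cases hs : MeasurableSet s
  · simp only [indicatorFunctional, hs, dite_true]
    exact LinearMap.mkContinuous_norm_le _ measureReal_nonneg _
  · rw [indicatorFunctional_of_not_measurable hg hs, norm_zero]
    exact measureReal_nonneg

/-- The vector measure `E ↦ g (1_E ⊗ ·)`. -/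
def indicatorMeasure : BddMeasure (StrongDual ℂ X) :=
  BddMeasure.ofNormLe m (indicatorFunctional g hg) (norm_indicatorFunctional_le hg)
    (fun s t hs ht hst => by
      ext x
      rw [add_apply, indicatorFunctional_apply hg hs, indicatorFunctional_apply hg ht,
        indicatorFunctional_apply hg (hs.union ht), ← map_add]
      congr 1
      exact indicatorConstLp_disjoint_union hs ht _ _ hst x)
    (fun s hs => indicatorFunctional_of_not_measurable hg hs)

end IndicatorFunctional

/-- Every functional on `C₀(ℝ; X)` is the integral against an `X*`-valued measure, whose variation
is dominated by `|η|`: the extension of `η` to `L¹(|η|; X)` is evaluated on `1_E ⊗ x`. -/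
theorem exists_integralFunctional_eq (η : StrongDual ℂ C₀(ℝ, X)) :
    ∃ μ : BddMeasure (StrongDual ℂ X), ‖μ‖ ≤ ‖η‖ ∧ integralFunctional μ = η := by
  set m := absMeasure η with hm
  obtain ⟨g, hg, hg'⟩ := exists_extension_of_norm_le η (toL1 m) (denseRange_toL1 m) fun F => by
    rw [norm_toL1]
    exact norm_le_integral_absMeasure η F
  have hμ : (indicatorMeasure hg').toVM.variation ≤ m := BddMeasure.variation_ofNormLe_le _ _ _
  refine ⟨indicatorMeasure hg', ?_, ?_⟩
  · have := ENNReal.toReal_mono enorm_ne_top ((hμ Set.univ).trans (absMeasure_univ_le η))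
    rwa [toReal_enorm] at this
  · ext F
    rw [integralFunctional_apply, ← hg F]
    exact integral_eq_of_indicator hμ (fun f => g f) g.continuous
      (fun f f' => map_add g f f') (fun x s hs => (indicatorFunctional_apply hg' hs x).symm)
      (integrable_zeroAtInfty m F)

variable (X) in
/-- The identification of `M(ℝ; X*)` with `C₀(ℝ; X)*`, by integration. -/
def integralEquiv : BddMeasure (StrongDual ℂ X) ≃ₗᵢ[ℂ] StrongDual ℂ C₀(ℝ, X) :=
  LinearIsometryEquiv.ofSurjective
    { toFun := integralFunctional
      map_add' := integralFunctional_add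
      map_smul' := integralFunctional_smul
      norm_map' := fun μ => by
        obtain ⟨ν, hν, h⟩ := exists_integralFunctional_eq (integralFunctional μ)
        have : ν - μ = 0 := eq_zero_of_integralFunctional_eq_zero (by
          have e : ν - μ = ν + (-1 : ℂ) • μ := by module
          rw [e, integralFunctional_add, integralFunctional_smul, h]
          module)
        rw [sub_eq_zero.1 this] at hν
        exact le_antisymm (norm_integralFunctional_le μ) hν }
    fun η => by
      obtain ⟨μ, -, h⟩ := exists_integralFunctional_eq η
      exact ⟨μ, h⟩

/-- The identification `J` of `M(ℝ; X*)` with `C₀(ℝ; X)*`, given by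
`⟨J μ, F⟩ = ∫ ⟨F(-t), dμ(t)⟩`. -/
def dualEquiv (X : Type*) [NormedAddCommGroup X] [NormedSpace ℂ X] :
    BddMeasure (StrongDual ℂ X) ≃ₗᵢ[ℂ] StrongDual ℂ C₀(ℝ, X) :=
  LinearIsometryEquiv.ofSurjective
    { toFun := fun μ => (integralFunctional μ).comp
        (reflect (X := X)).toContinuousLinearEquiv.toContinuousLinearMap
      map_add' := fun μ ν => by rw [integralFunctional_add]; rfl
      map_smul' := fun c μ => by rw [integralFunctional_smul]; rfl
      norm_map' := fun μ => by
        rw [← (integralEquiv X).norm_map μ]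
        exact ContinuousLinearMap.opNorm_comp_linearIsometryEquiv _ _ }
    fun η => by
      obtain ⟨μ, -, h⟩ := exists_integralFunctional_eq (η.comp
        (reflect (X := X)).toContinuousLinearEquiv.toContinuousLinearMap)
      refine ⟨μ, ?_⟩
      ext F
      change integralFunctional μ (reflect F) = η F
      rw [h]
      change η (reflect (reflect F)) = η F
      rw [reflect_reflect]

theorem dualEquiv_apply (μ : BddMeasure (StrongDual ℂ X)) (F : C₀(ℝ, X)) :
    dualEquiv X μ F = integralFunctional μ (reflect F) := rfl

theorem variation_evalMeasure_le (μ : BddMeasure (StrongDual ℂ X)) (x : X) :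
    (evalMeasure μ x).variation ≤ ‖x‖ₑ • μ.toVM.variation := by
  refine VectorMeasure.variation_le_of_forall_enorm_le fun s hs => ?_
  calc ‖evalMeasure μ x s‖ₑ ≤ ‖x‖ₑ * ‖μ.toVM s‖ₑ := by
        rw [mul_comm]
        exact (μ.toVM s).le_opENorm x
    _ ≤ ‖x‖ₑ * μ.toVM.variation s := by
        gcongr
        exact VectorMeasure.enorm_measure_le_variation _ _

instance (μ : BddMeasure (StrongDual ℂ X)) (x : X) :
    IsFiniteMeasure (evalMeasure μ x).variation :=
  ⟨(variation_evalMeasure_le μ x _).trans_lt (by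
    rw [Measure.smul_apply, smul_eq_mul]
    exact ENNReal.mul_lt_top enorm_lt_top (measure_lt_top _ _))⟩

theorem integralFunctional_tensor (μ : BddMeasure (StrongDual ℂ X)) (f : C₀(ℝ, ℂ)) (x : X) :
    integralFunctional μ (tensor f x) =
      ∫ᵛ t, f t ∂[ContinuousLinearMap.mul ℝ ℂ; evalMeasure μ x] := by
  let τ : ℂ →L[ℝ] X := ((ContinuousLinearMap.id ℂ ℂ).smulRight x).restrictScalars ℝ
  have h1 := map_integral (μ := μ.toVM) (ν := μ.toVM) (B := (evPairing X).comp τ)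
    (B' := evPairing X) (ℓ := τ) (M := ContinuousLinearMap.id ℝ ℂ) ENNReal.one_ne_top
    (by simp) (fun e s _ => rfl) (integrable_zeroAtInfty μ.toVM.variation f)
  have h2 := map_integral (μ := μ.toVM) (ν := evalMeasure μ x) (B := (evPairing X).comp τ)
    (B' := ContinuousLinearMap.mul ℝ ℂ) (ℓ := ContinuousLinearMap.id ℝ ℂ)
    (M := ContinuousLinearMap.id ℝ ℂ) enorm_ne_top (variation_evalMeasure_le μ x)
    (fun e s _ => (μ.toVM s).map_smul e x) (integrable_zeroAtInfty μ.toVM.variation f)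
  exact h1.symm.trans h2

theorem dualEquiv_tensor (μ : BddMeasure (StrongDual ℂ X)) (f : C₀(ℝ, ℂ)) (x : X) :
    dualEquiv X μ (tensor f x) =
      ∫ᵛ t, f (-t) ∂[ContinuousLinearMap.mul ℝ ℂ; evalMeasure μ x] := by
  rw [dualEquiv_apply, reflect_tensor, integralFunctional_tensor]
  rfl

end Singer


/-! ### Cauchy and Poisson kernels -/

section Kernels

open Complex hiding I
open InnerProductSpace

theorem ofReal_sub_ne_zero {c : ℂ} (hc : c.im ≠ 0) (t : ℝ) : (t : ℂ) - c ≠ 0 := fun h =>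
  hc (by rw [← sub_eq_zero.1 h, ofReal_im])

open Classical in
/-- The function `t ↦ (t - c)⁻¹`, for a non-real `c` (and zero for a real `c`). -/
def cauchyKernel (c : ℂ) : C₀(ℝ, ℂ) :=
  if hc : c.im ≠ 0 then
    { toFun := fun t => ((t : ℂ) - c)⁻¹
      continuous_toFun := (by fun_prop : Continuous fun t : ℝ => (t : ℂ) - c).inv₀
        (ofReal_sub_ne_zero hc)
      zero_at_infty' := by
        refine tendsto_inv₀_cobounded.comp ?_
        rw [← Metric.cobounded_eq_cocompact]
        refine tendsto_norm_atTop_iff_cobounded.1 (tendsto_atTop_mono (f := fun t : ℝ => ‖t‖ - ‖c‖)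
          (fun t => ?_) (tendsto_atTop_add_const_right _ _ tendsto_norm_cobounded_atTop))
        simpa using norm_sub_norm_le (t : ℂ) c }
  else 0

theorem cauchyKernel_apply {c : ℂ} (hc : c.im ≠ 0) (t : ℝ) :
    cauchyKernel c t = ((t : ℂ) - c)⁻¹ := by
  simp only [cauchyKernel, hc, ne_eq, not_false_eq_true, dite_true]
  rfl

theorem norm_cauchyKernel_le {c : ℂ} (hc : c.im ≠ 0) : ‖cauchyKernel c‖ ≤ |c.im|⁻¹ := by
  refine zeroAtInfty_norm_le (by positivity) fun t => ?_
  rw [cauchyKernel_apply hc, norm_inv]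
  refine inv_anti₀ (abs_pos.2 hc) ?_
  simpa using abs_im_le_norm ((t : ℂ) - c)

theorem star_cauchyKernel {c : ℂ} (hc : c.im ≠ 0) :
    star (cauchyKernel c) = cauchyKernel (starRingEnd ℂ c) := by
  ext t
  rw [ZeroAtInftyContinuousMap.star_apply, cauchyKernel_apply hc,
    cauchyKernel_apply (by simpa using hc)]
  simp

/-- The resolvent identity. -/
theorem cauchyKernel_sub {c d : ℂ} (hc : c.im ≠ 0) (hd : d.im ≠ 0) :
    cauchyKernel c - cauchyKernel d = (c - d) • (cauchyKernel c * cauchyKernel d) := by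
  ext t
  change cauchyKernel c t - cauchyKernel d t = (c - d) * (cauchyKernel c t * cauchyKernel d t)
  rw [cauchyKernel_apply hc, cauchyKernel_apply hd]
  have h1 := ofReal_sub_ne_zero hc t
  have h2 := ofReal_sub_ne_zero hd t
  field_simp
  ring

theorem isOpen_im_ne_zero : IsOpen {c : ℂ | c.im ≠ 0} :=
  isOpen_ne_fun continuous_im continuous_const

theorem continuousAt_cauchyKernel {c : ℂ} (hc : c.im ≠ 0) : ContinuousAt cauchyKernel c := by
  rw [ContinuousAt, tendsto_iff_norm_sub_tendsto_zero]
  have h1 : Tendsto (fun d : ℂ => ‖d - c‖ * (|d.im|⁻¹ * |c.im|⁻¹)) (𝓝 c)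
      (𝓝 (‖c - c‖ * (|c.im|⁻¹ * |c.im|⁻¹))) := by
    refine Tendsto.mul (by fun_prop : Continuous fun d : ℂ => ‖d - c‖).continuousAt
      (Tendsto.mul_const _ (Tendsto.inv₀ ?_ (abs_ne_zero.2 hc)))
    exact (by fun_prop : Continuous fun d : ℂ => |d.im|).continuousAt
  rw [sub_self, norm_zero, zero_mul] at h1
  refine squeeze_zero' (Eventually.of_forall fun d => norm_nonneg _) ?_ h1
  filter_upwards [isOpen_im_ne_zero.mem_nhds hc] with d hd
  rw [cauchyKernel_sub hd hc, norm_smul]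
  refine mul_le_mul_of_nonneg_left ((norm_mul_le _ _).trans ?_) (norm_nonneg _)
  exact mul_le_mul (norm_cauchyKernel_le hd) (norm_cauchyKernel_le hc) (norm_nonneg _)
    (by positivity)

theorem hasDerivAt_cauchyKernel {c : ℂ} (hc : c.im ≠ 0) :
    HasDerivAt cauchyKernel (cauchyKernel c * cauchyKernel c) c := by
  rw [hasDerivAt_iff_tendsto_slope]
  have h1 : Tendsto (fun d => cauchyKernel d * cauchyKernel c) (𝓝[≠] c)
      (𝓝 (cauchyKernel c * cauchyKernel c)) :=
    ((continuousAt_cauchyKernel hc).mul continuousAt_const).tendsto.mono_left nhdsWithin_le_nhds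
  refine h1.congr' ?_
  filter_upwards [self_mem_nhdsWithin, mem_nhdsWithin_of_mem_nhds
    (isOpen_im_ne_zero.mem_nhds hc)] with d hdc hd
  rw [slope_def_module, cauchyKernel_sub hd hc, inv_smul_smul₀ (sub_ne_zero.2 hdc)]

theorem differentiableOn_cauchyKernel : DifferentiableOn ℂ cauchyKernel {c : ℂ | c.im ≠ 0} :=
  fun _ hc => (hasDerivAt_cauchyKernel hc).differentiableAt.differentiableWithinAt

theorem harmonicAt_cauchyKernel {c : ℂ} (hc : c.im ≠ 0) : HarmonicAt cauchyKernel c :=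
  (differentiableOn_cauchyKernel.analyticAt (isOpen_im_ne_zero.mem_nhds hc)).harmonicAt

/-- The Poisson kernel `t ↦ Im z / (π |z - t|²)`, as an element of `C₀(ℝ)`: the jump
`(k_z - k_{z̄}) / 2πi` of the Cauchy kernel `k` across the real line. -/
def poissonKer (z : ℂ) : C₀(ℝ, ℂ) :=
  (2 * Real.pi * Complex.I)⁻¹ • (cauchyKernel z - cauchyKernel (starRingEnd ℂ z))

theorem poissonKer_apply {z : ℂ} (hz : z.im ≠ 0) (t : ℝ) :
    poissonKer z t = ((1 / Real.pi) * (z.im / ((z.re - t) ^ 2 + z.im ^ 2)) : ℝ) := by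
  change (2 * Real.pi * Complex.I)⁻¹ * (cauchyKernel z t - cauchyKernel (starRingEnd ℂ z) t) = _
  rw [cauchyKernel_apply hz, cauchyKernel_apply (by simpa using hz)]
  have h1 := ofReal_sub_ne_zero hz t
  have h2 : (t : ℂ) - starRingEnd ℂ z ≠ 0 := ofReal_sub_ne_zero (by simpa using hz) t
  have h3 : (z.re - t) ^ 2 + z.im ^ 2 ≠ 0 := by positivity
  have h4 : (((z.re - t) ^ 2 + z.im ^ 2 : ℝ) : ℂ) = (t - z) * (t - starRingEnd ℂ z) := by
    rw [show ((t : ℂ) - z) * (t - starRingEnd ℂ z) = ((t : ℂ) - z) * starRingEnd ℂ ((t : ℂ) - z) by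
      simp, mul_conj, normSq_apply]
    congr 1
    simp
    ring
  have h5 : z - starRingEnd ℂ z = 2 * z.im * Complex.I := by
    rw [sub_conj]; push_cast; ring
  have hpi : (Real.pi : ℂ) ≠ 0 := by exact_mod_cast Real.pi_ne_zero
  rw [ofReal_mul, ofReal_div (z.im), h4, inv_sub_inv h1 h2]
  have h6 : (t : ℂ) - starRingEnd ℂ z - (t - z) = 2 * z.im * Complex.I := by rw [← h5]; ring
  rw [h6]
  have hI := Complex.I_ne_zero
  push_cast
  field_simp

theorem poissonKer_apply_coe (z : ℍ) (t : ℝ) : poissonKer z t = halfPlanePoisson z t :=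
  poissonKer_apply z.im_pos.ne' t

theorem harmonicAt_poissonKer {z : ℂ} (hz : z.im ≠ 0) : HarmonicAt poissonKer z := by
  have h1 : HarmonicAt (fun z => cauchyKernel (starRingEnd ℂ z)) z := by
    have h2 : (fun z => (starL' ℝ : C₀(ℝ, ℂ) ≃L[ℝ] C₀(ℝ, ℂ)) (cauchyKernel z)) =ᶠ[𝓝 z]
        fun z => cauchyKernel (starRingEnd ℂ z) := by
      filter_upwards [isOpen_im_ne_zero.mem_nhds hz] with w hw
      exact star_cauchyKernel hw
    rw [← harmonicAt_congr_nhds h2]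
    exact (harmonicAt_cauchyKernel hz).comp_CLM
      ((starL' ℝ : C₀(ℝ, ℂ) ≃L[ℝ] C₀(ℝ, ℂ)) : C₀(ℝ, ℂ) →L[ℝ] C₀(ℝ, ℂ))
  exact ((harmonicAt_cauchyKernel hz).sub h1).comp_CLM
    (((2 * Real.pi * Complex.I)⁻¹ • ContinuousLinearMap.id ℂ C₀(ℝ, ℂ)).restrictScalars ℝ)

theorem continuousAt_poissonKer {z : ℂ} (hz : z.im ≠ 0) : ContinuousAt poissonKer z :=
  (harmonicAt_poissonKer hz).1.continuousAt

end Kernels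

/-! ### Approximation by Poisson integrals -/

section PoissonConv

/-- Translation in `C₀(ℝ)`. -/
def translate (δ : ℝ) (f : C₀(ℝ, ℂ)) : C₀(ℝ, ℂ) where
  toFun t := f (t - δ)
  continuous_toFun := (map_continuous f).comp (continuous_id.sub continuous_const)
  zero_at_infty' := (zero_at_infty f).comp
    (Homeomorph.subRight δ).isClosedEmbedding.tendsto_cocompact

@[simp] theorem translate_apply (δ : ℝ) (f : C₀(ℝ, ℂ)) (t : ℝ) : translate δ f t = f (t - δ) := rfl

theorem norm_translate_le (δ : ℝ) (f : C₀(ℝ, ℂ)) : ‖translate δ f‖ ≤ ‖f‖ :=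
  zeroAtInfty_norm_le (norm_nonneg _) fun _ => norm_apply_le f _

theorem translate_zero (f : C₀(ℝ, ℂ)) : translate 0 f = f := by ext t; simp

theorem continuous_translate (f : C₀(ℝ, ℂ)) : Continuous fun δ => translate δ f := by
  have hu := ZeroAtInftyContinuousMap.uniformContinuous f
  rw [Metric.uniformContinuous_iff] at hu
  rw [Metric.continuous_iff]
  intro a ε hε
  obtain ⟨δ, hδ, h⟩ := hu (ε / 2) (half_pos hε)
  refine ⟨δ, hδ, fun b hb => ?_⟩
  rw [dist_eq_norm]
  refine (zeroAtInfty_norm_le (half_pos hε).le fun t => ?_).trans_lt (half_lt_self hε)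
  change ‖f (t - b) - f (t - a)‖ ≤ ε / 2
  rw [← dist_eq_norm]
  refine (h ?_).le
  rwa [dist_sub_left, dist_comm] at *

/-- The Cauchy density `1 / (π (1 + r²))`. -/
def cauchyDensity (r : ℝ) : ℝ := Real.pi⁻¹ * (1 + r ^ 2)⁻¹

theorem cauchyDensity_nonneg (r : ℝ) : 0 ≤ cauchyDensity r := by
  have := Real.pi_pos
  unfold cauchyDensity; positivity

theorem integrable_cauchyDensity : Integrable cauchyDensity :=
  integrable_inv_one_add_sq.const_mul _

theorem integral_cauchyDensity : ∫ r, cauchyDensity r = 1 := by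
  unfold cauchyDensity
  rw [integral_const_mul, integral_univ_inv_one_add_sq, inv_mul_cancel₀ Real.pi_ne_zero]

theorem halfPlane_poisson_eq_cauchyDensity {v : ℝ} (hv : 0 < v) (u t : ℝ) :
    (1 / Real.pi) * (v / ((u - t) ^ 2 + v ^ 2)) = v⁻¹ * cauchyDensity (v⁻¹ * (u - t)) := by
  have := Real.pi_pos
  have h1 : (u - t) ^ 2 + v ^ 2 ≠ 0 := by positivity
  have h2 : 1 + (v⁻¹ * (u - t)) ^ 2 ≠ 0 := by positivity
  unfold cauchyDensity
  field_simp
  ring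

theorem poissonKer_eq_cauchyDensity {v : ℝ} (hv : 0 < v) (u t : ℝ) :
    poissonKer (u + v * Complex.I) t = ((v⁻¹ * cauchyDensity (v⁻¹ * (u - t)) : ℝ) : ℂ) := by
  rw [poissonKer_apply (by simpa using hv.ne'), ← halfPlane_poisson_eq_cauchyDensity hv]
  simp

/-- The Poisson extension of `f` to the height `v ≥ 0`, as an average of translates. -/
def poissonConv (f : C₀(ℝ, ℂ)) (v : ℝ) : C₀(ℝ, ℂ) :=
  ∫ r, cauchyDensity r • translate (v * r) f

theorem integrable_poissonConv (f : C₀(ℝ, ℂ)) (v : ℝ) :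
    Integrable fun r => cauchyDensity r • translate (v * r) f := by
  refine (integrable_cauchyDensity.smul_const ‖f‖).mono' ?_ (Eventually.of_forall fun r => ?_)
  · have h : Continuous fun r => translate (v * r) f :=
      (continuous_translate f).comp (continuous_const.mul continuous_id)
    exact integrable_cauchyDensity.1.smul h.aestronglyMeasurable
  · rw [norm_smul, Real.norm_of_nonneg (cauchyDensity_nonneg r)]
    exact mul_le_mul_of_nonneg_left (norm_translate_le _ f) (cauchyDensity_nonneg r)

theorem continuous_poissonConv (f : C₀(ℝ, ℂ)) : Continuous (poissonConv f) := by
  refine continuous_of_dominated (bound := fun r => cauchyDensity r • ‖f‖)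
    (fun v => (integrable_poissonConv f v).1) (fun v => Eventually.of_forall fun r => ?_)
    (integrable_cauchyDensity.smul_const ‖f‖) (Eventually.of_forall fun r => ?_)
  · rw [norm_smul, Real.norm_of_nonneg (cauchyDensity_nonneg r)]
    exact mul_le_mul_of_nonneg_left (norm_translate_le _ f) (cauchyDensity_nonneg r)
  · have h : Continuous fun v => translate (v * r) f :=
      (continuous_translate f).comp (continuous_id.mul continuous_const)
    exact h.const_smul (cauchyDensity r)

theorem poissonConv_zero (f : C₀(ℝ, ℂ)) : poissonConv f 0 = f := by
  simp only [poissonConv, zero_mul, translate_zero]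
  rw [integral_smul_const, integral_cauchyDensity, one_smul]

/-- Evaluation at a point. -/
def evalAt (t : ℝ) : C₀(ℝ, ℂ) →L[ℂ] ℂ :=
  LinearMap.mkContinuous
    { toFun := fun f => f t
      map_add' := fun _ _ => rfl
      map_smul' := fun _ _ => rfl } 1 fun f => by rw [one_mul]; exact norm_apply_le f t

@[simp] theorem evalAt_apply (t : ℝ) (f : C₀(ℝ, ℂ)) : evalAt t f = f t := rfl

theorem poissonConv_apply (f : C₀(ℝ, ℂ)) (v u : ℝ) :
    poissonConv f v u = ∫ r, cauchyDensity r • f (u - v * r) := by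
  rw [← evalAt_apply, poissonConv, ← (evalAt u).integral_comp_comm (integrable_poissonConv f v)]
  refine integral_congr_ae (Eventually.of_forall fun r => ?_)
  rfl

theorem poissonConv_apply_eq_integral {v : ℝ} (hv : 0 < v) (f : C₀(ℝ, ℂ)) (u : ℝ) :
    poissonConv f v u = ∫ s, poissonKer (u + v * Complex.I) s * f s := by
  rw [poissonConv_apply]
  have h := Measure.integral_comp_mul_left (fun r => cauchyDensity r • f (u - v * r)) v⁻¹
  rw [inv_inv, abs_of_pos hv] at h
  rw [← integral_sub_left_eq_self (fun s => poissonKer (u + v * Complex.I) s * f s) volume u]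
  have h2 : ∀ s, poissonKer (u + v * Complex.I) (u - s) * f (u - s) =
      v⁻¹ • (cauchyDensity (v⁻¹ * s) • f (u - v * (v⁻¹ * s))) := fun s => by
    rw [poissonKer_eq_cauchyDensity hv, mul_inv_cancel_left₀ hv.ne', sub_sub_cancel, smul_smul,
      Complex.real_smul]
  rw [integral_congr_ae (Eventually.of_forall h2), integral_smul, h, inv_smul_smul₀ hv.ne']

theorem continuous_poissonKer_line {v : ℝ} (hv : 0 < v) :
    Continuous fun s : ℝ => poissonKer (s + v * Complex.I) :=
  continuous_iff_continuousAt.2 fun s =>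
    ContinuousAt.comp (f := fun s : ℝ => (s : ℂ) + v * Complex.I)
      (continuousAt_poissonKer (by simpa using hv.ne'))
      (by fun_prop : Continuous fun s : ℝ => (s : ℂ) + v * Complex.I).continuousAt

theorem norm_poissonKer_le {v : ℝ} (hv : 0 < v) (u : ℝ) :
    ‖poissonKer (u + v * Complex.I)‖ ≤ (Real.pi * v)⁻¹ := by
  have := Real.pi_pos
  refine zeroAtInfty_norm_le (by positivity) fun t => ?_
  rw [poissonKer_eq_cauchyDensity hv, Complex.norm_real, cauchyDensity,
    Real.norm_of_nonneg (by positivity), mul_inv, mul_left_comm]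
  refine mul_le_mul_of_nonneg_left (mul_le_of_le_one_right (by positivity) ?_) (by positivity)
  exact inv_le_one_of_one_le₀ (by nlinarith [sq_nonneg (v⁻¹ * (u - t))])

theorem integrable_smul_poissonKer {v : ℝ} (hv : 0 < v) {f : ℝ → ℂ} (hf : Integrable f) :
    Integrable fun s : ℝ => f s • poissonKer (s + v * Complex.I) := by
  refine (hf.norm.mul_const (Real.pi * v)⁻¹).mono'
    (hf.1.smul (continuous_poissonKer_line hv).aestronglyMeasurable)
    (Eventually.of_forall fun s => ?_)
  rw [norm_smul]
  exact mul_le_mul_of_nonneg_left (norm_poissonKer_le hv s) (norm_nonneg _)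

/-- The Poisson extension of an integrable `f` lies in the closed span of Poisson kernels. -/
theorem poissonConv_eq_integral {v : ℝ} (hv : 0 < v) {f : C₀(ℝ, ℂ)} (hf : Integrable f) :
    poissonConv f v = ∫ s, f s • poissonKer (s + v * Complex.I) := by
  ext u
  rw [poissonConv_apply_eq_integral hv, ← evalAt_apply,
    ← (evalAt u).integral_comp_comm (integrable_smul_poissonKer hv hf)]
  refine integral_congr_ae (Eventually.of_forall fun s => ?_)
  change poissonKer (u + v * Complex.I) s * f s = f s * poissonKer (s + v * Complex.I) u
  rw [mul_comm, poissonKer_eq_cauchyDensity hv, poissonKer_eq_cauchyDensity hv]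
  unfold cauchyDensity
  ring_nf

end PoissonConv


/-! ### Harmonic functions with bounded horizontal `L¹` norms -/

section HarmonicBounds

open InnerProductSpace Metric

variable {h : ℂ → ℂ}

/-- The mean value property bounds `|h z|` by an average over a circle. -/
theorem enorm_le_lintegral_circle {z : ℂ} {r : ℝ} (hr : 0 < r)
    (hh : HarmonicOnNhd h (closedBall z r)) :
    ENNReal.ofReal (2 * Real.pi) * ‖h z‖ₑ ≤
      ∫⁻ θ in Set.Ioo (-Real.pi) Real.pi, ‖h (circleMap z r θ)‖ₑ := by
  have hpi := Real.pi_pos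
  rw [← abs_of_pos hr] at hh
  have h1 := hh.circleAverage_eq
  have h2 : ∫ θ in (0 : ℝ)..2 * Real.pi, h (circleMap z r (θ + -Real.pi)) =
      (2 * Real.pi) • h z := by
    rw [← h1, Real.circleAverage_eq_integral_add (-Real.pi), smul_inv_smul₀ (by positivity)]
  rw [intervalIntegral.integral_comp_add_right (fun θ => h (circleMap z r θ)), zero_add,
    show 2 * Real.pi + -Real.pi = Real.pi by ring,
    intervalIntegral.integral_of_le (by linarith), integral_Ioc_eq_integral_Ioo] at h2
  calc ENNReal.ofReal (2 * Real.pi) * ‖h z‖ₑ = ‖(2 * Real.pi) • h z‖ₑ := by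
        rw [enorm_smul, Real.enorm_of_nonneg (by positivity)]
    _ ≤ _ := by
        rw [← h2]
        exact enorm_integral_le_lintegral_enorm _

/-- `|h|` on the upper half-plane, extended by zero. -/
def enormExt (h : ℂ → ℂ) : ℂ → ℝ≥0∞ := {z : ℂ | 0 < z.im}.indicator fun z => ‖h z‖ₑ

theorem isOpen_upper : IsOpen {z : ℂ | 0 < z.im} := isOpen_lt continuous_const Complex.continuous_im

theorem measurable_enormExt (hh : HarmonicOnNhd h {z : ℂ | 0 < z.im}) :
    Measurable (enormExt h) := by
  classical
  unfold enormExt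
  rw [← Set.piecewise_eq_indicator]
  exact ContinuousOn.measurable_piecewise hh.continuousOn.enorm continuousOn_const
    isOpen_upper.measurableSet

theorem im_pos_of_mem_ball {z w : ℂ} {R : ℝ} (hR : R ≤ z.im) (hw : w ∈ ball z R) : 0 < w.im := by
  have h1 : |w.im - z.im| < R := by
    rw [← Complex.sub_im]
    exact (Complex.abs_im_le_norm _).trans_lt (mem_ball_iff_norm.1 hw)
  linarith [(abs_lt.1 h1).1]

/-- Sub-mean value property over discs, with a non-optimal constant: only the radii in `(R/2, R)`
are used. -/
theorem enorm_le_lintegral_ball (hh : HarmonicOnNhd h {z : ℂ | 0 < z.im}) {z : ℂ} {R : ℝ}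
    (hR0 : 0 < R) (hR : R ≤ z.im) :
    ENNReal.ofReal (R / 2) * (ENNReal.ofReal (R / 2) * (ENNReal.ofReal (2 * Real.pi) * ‖h z‖ₑ)) ≤
      ∫⁻ w in ball z R, enormExt h w := by
  have hm := measurable_enormExt hh
  have hm2 : Measurable ((ball z R).indicator (enormExt h)) := hm.indicator measurableSet_ball
  have hcm : Measurable fun p : ℝ × ℝ => z + Complex.polarCoord.symm p := by
    simp only [Complex.polarCoord_symm_apply]
    fun_prop
  have hm3 : Measurable fun p : ℝ × ℝ => ENNReal.ofReal p.1 •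
      (ball z R).indicator (enormExt h) (z + Complex.polarCoord.symm p) := by
    simp only [smul_eq_mul]
    exact (by fun_prop : Measurable fun p : ℝ × ℝ => ENNReal.ofReal p.1).mul (hm2.comp hcm)
  have key : ∀ r ∈ Set.Ioo (R / 2) R,
      ENNReal.ofReal (R / 2) * (ENNReal.ofReal (2 * Real.pi) * ‖h z‖ₑ) ≤
      ∫⁻ θ in Set.Ioo (-Real.pi) Real.pi, ENNReal.ofReal r •
        (ball z R).indicator (enormExt h) (z + Complex.polarCoord.symm (r, θ)) := by
    intro r hr
    have hr0 : 0 < r := (half_pos hR0).trans hr.1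
    have hb : ∀ w ∈ closedBall z r, w ∈ ball z R := fun w hw => closedBall_subset_ball hr.2 hw
    have h1 := enorm_le_lintegral_circle hr0 fun w hw => hh w (im_pos_of_mem_ball hR (hb w hw))
    calc _ ≤ ENNReal.ofReal r * ∫⁻ θ in Set.Ioo (-Real.pi) Real.pi, ‖h (circleMap z r θ)‖ₑ :=
          mul_le_mul' (ENNReal.ofReal_le_ofReal hr.1.le) h1
      _ = ∫⁻ θ in Set.Ioo (-Real.pi) Real.pi, ENNReal.ofReal r * ‖h (circleMap z r θ)‖ₑ :=
          (lintegral_const_mul' _ _ ENNReal.ofReal_ne_top).symm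
      _ = _ := by
          refine lintegral_congr fun θ => ?_
          have e : z + Complex.polarCoord.symm (r, θ) = circleMap z r θ := by
            rw [Complex.polarCoord_symm_apply, circleMap, Complex.exp_mul_I]
            push_cast
            rfl
          have hw := hb _ (circleMap_mem_closedBall z hr0.le θ)
          rw [e, smul_eq_mul, Set.indicator_of_mem hw, enormExt,
            Set.indicator_of_mem (show _ ∈ {z : ℂ | 0 < z.im} from im_pos_of_mem_ball hR hw)]
  calc ENNReal.ofReal (R / 2) * (ENNReal.ofReal (R / 2) * (ENNReal.ofReal (2 * Real.pi) * ‖h z‖ₑ))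
      = ∫⁻ _ in Set.Ioo (R / 2) R,
          ENNReal.ofReal (R / 2) * (ENNReal.ofReal (2 * Real.pi) * ‖h z‖ₑ) := by
        rw [setLIntegral_const, Real.volume_Ioo, mul_comm, sub_half]
    _ ≤ ∫⁻ r in Set.Ioo (R / 2) R, ∫⁻ θ in Set.Ioo (-Real.pi) Real.pi, ENNReal.ofReal r •
        (ball z R).indicator (enormExt h) (z + Complex.polarCoord.symm (r, θ)) :=
        setLIntegral_mono' measurableSet_Ioo key
    _ ≤ ∫⁻ r in Set.Ioi 0, ∫⁻ θ in Set.Ioo (-Real.pi) Real.pi, ENNReal.ofReal r •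
        (ball z R).indicator (enormExt h) (z + Complex.polarCoord.symm (r, θ)) :=
        lintegral_mono_set fun r hr => (half_pos hR0).trans hr.1
    _ = ∫⁻ p in polarCoord.target, ENNReal.ofReal p.1 •
        (ball z R).indicator (enormExt h) (z + Complex.polarCoord.symm p) := by
        rw [show polarCoord.target = Set.Ioi (0 : ℝ) ×ˢ Set.Ioo (-Real.pi) Real.pi from rfl,
          Measure.volume_eq_prod, ← Measure.prod_restrict, lintegral_prod _ hm3.aemeasurable]
    _ = ∫⁻ w, (ball z R).indicator (enormExt h) (z + w) :=
        Complex.lintegral_comp_polarCoord_symm fun w => (ball z R).indicator (enormExt h) (z + w)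
    _ = ∫⁻ w in ball z R, enormExt h w := by
        rw [lintegral_add_left_eq_self (fun w => (ball z R).indicator (enormExt h) w),
          lintegral_indicator measurableSet_ball]

/-- Integrating the horizontal `L¹` bound over a strip. -/
theorem lintegral_strip_le (hh : HarmonicOnNhd h {z : ℂ | 0 < z.im}) {C : ℝ≥0∞}
    (hC : ∀ v : ℝ, 0 < v → ∫⁻ u : ℝ, ‖h (u + v * Complex.I)‖ₑ ≤ C) (a b : ℝ) :
    ∫⁻ w in {w : ℂ | a < w.im ∧ w.im < b}, enormExt h w ≤ ENNReal.ofReal (b - a) * C := by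
  have hS : MeasurableSet {w : ℂ | a < w.im ∧ w.im < b} :=
    (measurableSet_lt measurable_const Complex.measurable_im).inter
      (measurableSet_lt Complex.measurable_im measurable_const)
  have hm := (measurable_enormExt hh).indicator hS
  rw [← lintegral_indicator hS, ← (Complex.volume_preserving_equiv_real_prod.symm).lintegral_comp hm,
    Measure.volume_eq_prod, lintegral_prod_symm]
  · calc _ ≤ ∫⁻ y, (Set.Ioo a b).indicator (fun _ => C) y := by
          refine lintegral_mono fun y => ?_
          have e : ∀ x, Complex.measurableEquivRealProd.symm (x, y) = (x : ℂ) + y * Complex.I :=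
            fun x => by apply Complex.ext <;> simp
          by_cases hy : y ∈ Set.Ioo a b
          · rw [Set.indicator_of_mem hy]
            by_cases hy0 : 0 < y
            · refine (lintegral_mono fun x => ?_).trans (hC y hy0)
              refine (Set.indicator_le_self _ _ _).trans ((Set.indicator_le_self _ _ _).trans ?_)
              rw [e]
            · refine (le_of_eq ?_).trans zero_le
              rw [← lintegral_zero (μ := (volume : Measure ℝ))]
              refine lintegral_congr fun x => ?_
              refine Set.indicator_apply_eq_zero.2 fun _ => Set.indicator_of_notMem ?_ _
              rw [e]
              simpa using not_lt.1 hy0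
          · rw [Set.indicator_of_notMem hy]
            refine le_of_eq ?_
            rw [← lintegral_zero (μ := (volume : Measure ℝ))]
            refine lintegral_congr fun x => Set.indicator_of_notMem ?_ _
            rw [e]
            simpa using hy
      _ = ENNReal.ofReal (b - a) * C := by
          rw [lintegral_indicator measurableSet_Ioo, setLIntegral_const, Real.volume_Ioo, mul_comm]
  · exact (hm.comp Complex.measurableEquivRealProd.symm.measurable).aemeasurable

theorem ball_subset_strip (z : ℂ) (R : ℝ) :
    ball z R ⊆ {w : ℂ | z.im - R < w.im ∧ w.im < z.im + R} := fun w hw => by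
  have h1 : |w.im - z.im| < R := by
    rw [← Complex.sub_im]
    exact (Complex.abs_im_le_norm _).trans_lt (mem_ball_iff_norm.1 hw)
  constructor <;> linarith [abs_lt.1 h1]

/-- The disc of radius `Im z` about `z` lies in the strip `0 < Im w < 2 Im z`, over which the integral
of `|h|` is at most `2 C Im z`. -/
theorem norm_le_div_im (hh : HarmonicOnNhd h {z : ℂ | 0 < z.im}) {C : ℝ} (hC0 : 0 ≤ C)
    (hC : ∀ v : ℝ, 0 < v → ∫⁻ u : ℝ, ‖h (u + v * Complex.I)‖ₑ ≤ ENNReal.ofReal C) {z : ℂ} (hz : 0 < z.im) :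
    ‖h z‖ ≤ 4 * C / (Real.pi * z.im) := by
  have hpi := Real.pi_pos
  have h1 := (enorm_le_lintegral_ball hh hz le_rfl).trans
    ((lintegral_mono_set (ball_subset_strip z z.im)).trans (lintegral_strip_le hh hC _ _))
  rw [← ofReal_norm, ← ENNReal.ofReal_mul (by positivity), ← ENNReal.ofReal_mul (by positivity),
    ← ENNReal.ofReal_mul (by positivity), ← ENNReal.ofReal_mul (by linarith),
    ENNReal.ofReal_le_ofReal_iff (mul_nonneg (by linarith) hC0)] at h1
  rw [le_div_iff₀ (by positivity)]
  have h2 : z.im * (z.im * (Real.pi * ‖h z‖)) ≤ z.im * (4 * C) := by nlinarith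
  have := le_of_mul_le_mul_left h2 hz
  linarith

/-- On a strip away from the real line, `h` vanishes at infinity. -/
theorem exists_norm_lt_of_strip (hh : HarmonicOnNhd h {z : ℂ | 0 < z.im}) {C : ℝ}
    (hC : ∀ v : ℝ, 0 < v → ∫⁻ u : ℝ, ‖h (u + v * Complex.I)‖ₑ ≤ ENNReal.ofReal C) {δ b ε : ℝ}
    (hδ : 0 < δ) (hε : 0 < ε) :
    ∃ N : ℝ, ∀ z : ℂ, N ≤ |z.re| → δ ≤ z.im → z.im ≤ b → ‖h z‖ < ε := by
  have hpi := Real.pi_pos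
  let ν := (volume.restrict {w : ℂ | 0 < w.im ∧ w.im < b + δ}).withDensity (enormExt h)
  have hν : ν Set.univ ≠ ∞ := by
    rw [withDensity_apply _ MeasurableSet.univ, Measure.restrict_univ]
    exact ((lintegral_strip_le hh hC 0 (b + δ)).trans_lt
      (ENNReal.mul_lt_top ENNReal.ofReal_lt_top ENNReal.ofReal_lt_top)).ne
  have hfin : IsFiniteMeasure ν := ⟨lt_top_iff_ne_top.2 hν⟩
  let S : ℕ → Set ℂ := fun n => {w | (n : ℝ) ≤ |w.re|}
  have hS : ∀ n, MeasurableSet (S n) := fun n =>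
    measurableSet_le measurable_const (by fun_prop)
  have hlim : Tendsto (fun n => ν (S n)) atTop (𝓝 0) := by
    have h1 := tendsto_measure_iInter_atTop (μ := ν) (s := S) (fun n => (hS n).nullMeasurableSet)
      (fun n k hnk w hw => (Nat.cast_le.2 hnk).trans (show (k : ℝ) ≤ |w.re| from hw)) ⟨0, measure_ne_top _ _⟩
    have h2 : ⋂ n, S n = ∅ := by
      refine Set.eq_empty_of_forall_notMem fun w hw => ?_
      obtain ⟨n, hn⟩ := exists_nat_gt |w.re|
      exact absurd (Set.mem_iInter.1 hw n) (not_le.2 hn)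
    rwa [h2, measure_empty] at h1
  obtain ⟨n, hn⟩ := (hlim.eventually_lt_const (u := ENNReal.ofReal (δ / 2 * (δ / 2 *
    (2 * Real.pi * ε)))) (by rw [ENNReal.ofReal_pos]; positivity)).exists
  refine ⟨n + δ, fun z hN hz hzb => ?_⟩
  have h1 := enorm_le_lintegral_ball hh hδ hz
  have h2 : ∫⁻ w in ball z δ, enormExt h w ≤ ν (S n) := by
    rw [withDensity_apply _ (hS n), Measure.restrict_restrict (hS n)]
    refine lintegral_mono_set fun w hw => ⟨?_, im_pos_of_mem_ball hz hw, ?_⟩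
    · have h3 : |w.re - z.re| < δ := by
        rw [← Complex.sub_re]
        exact (Complex.abs_re_le_norm _).trans_lt (mem_ball_iff_norm.1 hw)
      have h4 : |z.re| ≤ |w.re| + |w.re - z.re| := by
        rw [abs_sub_comm]
        simpa using abs_add_le w.re (z.re - w.re)
      change (n : ℝ) ≤ |w.re|
      linarith
    · linarith [(ball_subset_strip z δ hw).2]
  have h3 := (h1.trans h2).trans_lt hn
  rw [← ofReal_norm, ← ENNReal.ofReal_mul (by positivity), ← ENNReal.ofReal_mul (by positivity),
    ← ENNReal.ofReal_mul (by positivity), ENNReal.ofReal_lt_ofReal_iff (by positivity)] at h3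
  by_contra hcon
  refine absurd h3 (not_lt.2 ?_)
  have := not_lt.1 hcon
  gcongr

end HarmonicBounds


/-! ### The Poisson representation -/

section PoissonRepresentation

open InnerProductSpace Metric

/-- A maximum principle: a harmonic function on the upper half-plane which vanishes on the real
line and at infinity is zero. A maximum point `w` of `|D|` is impossible, as the mean value
property applies to the disc around `w` which touches the real line. -/
theorem eq_zero_of_harmonic {D : ℂ → ℂ} (hD : HarmonicOnNhd D {z : ℂ | 0 < z.im})
    (hc : ContinuousOn D {z : ℂ | 0 ≤ z.im}) (h0 : ∀ z : ℂ, z.im = 0 → D z = 0) {K : ℝ}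
    (hK : ∀ z : ℂ, 0 < z.im → ‖D z‖ ≤ K / z.im)
    (hdecay : ∀ b ε : ℝ, 0 < ε → ∃ N : ℝ, ∀ z : ℂ, N ≤ |z.re| → 0 ≤ z.im → z.im ≤ b → ‖D z‖ < ε)
    {z : ℂ} (hz : 0 < z.im) : D z = 0 := by
  by_contra hne
  have hpos : 0 < ‖D z‖ := norm_pos_iff.2 hne
  obtain ⟨N, hN⟩ := hdecay (max z.im (K / ‖D z‖)) ‖D z‖ hpos
  set b := max z.im (K / ‖D z‖) with hb
  let Q : Set ℂ := Set.Icc (-max N 0) (max N 0) ×ℂ Set.Icc 0 b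
  have hzN : |z.re| < N := not_le.1 fun hle => lt_irrefl _ (hN z hle hz.le (le_max_left _ _))
  have hQ : IsCompact Q := isCompact_Icc.reProdIm isCompact_Icc
  have hzQ : z ∈ Q := by
    refine ⟨?_, hz.le, le_max_left _ _⟩
    have := abs_le.1 (hzN.le.trans (le_max_left N 0))
    exact ⟨this.1, this.2⟩
  obtain ⟨w, hwQ, hw⟩ := hQ.exists_isMaxOn ⟨z, hzQ⟩
    ((hc.mono fun x hx => hx.2.1).norm)
  have hzw : ‖D z‖ ≤ ‖D w‖ := hw hzQ
  have hmax : ∀ x : ℂ, 0 ≤ x.im → ‖D x‖ ≤ ‖D w‖ := by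
    intro x hx
    by_cases hxQ : x ∈ Q
    · exact hw hxQ
    refine le_trans ?_ hzw
    by_cases hxb : x.im ≤ b
    · refine (hN x (not_lt.1 fun hlt => hxQ ⟨?_, hx, hxb⟩) hx hxb).le
      have := abs_le.1 (hlt.le.trans (le_max_left N 0))
      exact ⟨this.1, this.2⟩
    · have hxb' : b < x.im := not_le.1 hxb
      have hx0 : 0 < x.im := hz.trans_le (le_max_left _ _) |>.trans hxb'
      refine (hK x hx0).trans ((div_le_iff₀ hx0).2 ?_)
      have : K / ‖D z‖ ≤ x.im := (le_max_right _ _).trans hxb'.le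
      rwa [div_le_iff₀' hpos] at this
  have hw0 : 0 < w.im := by
    refine lt_of_le_of_ne hwQ.2.1 fun h => ?_
    rw [h0 w h.symm, norm_zero] at hzw
    exact absurd hpos (not_lt.2 hzw)
  have hcirc : ∀ θ, 0 ≤ (circleMap w w.im θ).im := fun θ => by
    have h1 := circleMap_mem_closedBall w hw0.le θ
    have h2 := (Complex.abs_im_le_norm _).trans (mem_closedBall_iff_norm.1 h1)
    rw [Complex.sub_im] at h2
    linarith [(abs_le.1 h2).1]
  have hmean : Real.circleAverage D w w.im = D w := by
    have h1 : HarmonicContOnCl D (ball w |w.im|) := by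
      rw [abs_of_pos hw0]
      refine HarmonicContOnCl.mk_ball (fun x hx => hD x (im_pos_of_mem_ball le_rfl hx))
        (hc.mono fun x hx => ?_)
      have h2 := (Complex.abs_im_le_norm _).trans (mem_closedBall_iff_norm.1 hx)
      rw [Complex.sub_im] at h2
      change 0 ≤ x.im
      linarith [(abs_le.1 h2).1]
    exact h1.circleAverage_eq
  have hcont : Continuous fun θ => D (circleMap w w.im θ) :=
    hc.comp_continuous (continuous_circleMap w w.im) hcirc
  have hpi := Real.pi_pos
  -- the circle touches the real line at the angle `3π/2`
  have hlt : (∫ θ in (0 : ℝ)..2 * Real.pi, ‖D (circleMap w w.im θ)‖) <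
      ∫ _ in (0 : ℝ)..2 * Real.pi, ‖D w‖ := by
    refine intervalIntegral.integral_lt_integral_of_continuousOn_of_le_of_exists_lt (by positivity)
      hcont.norm.continuousOn continuousOn_const (fun θ _ => hmax _ (hcirc θ))
      ⟨Real.pi + Real.pi / 2, ⟨by positivity, by linarith⟩, ?_⟩
    rw [h0 _, norm_zero]
    · exact hpos.trans_le hzw
    · rw [circleMap, Complex.exp_mul_I]
      have h1 : Complex.sin ((Real.pi + Real.pi / 2 : ℝ) : ℂ) = -1 := by
        rw [← Complex.ofReal_sin, add_comm, Real.sin_add_pi, Real.sin_pi_div_two]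
        simp
      have h2 : Complex.cos ((Real.pi + Real.pi / 2 : ℝ) : ℂ) = 0 := by
        rw [← Complex.ofReal_cos, add_comm, Real.cos_add_pi, Real.cos_pi_div_two]
        simp
      rw [h1, h2]
      simp
  have h3 : ‖D w‖ ≤ (2 * Real.pi)⁻¹ * ∫ θ in (0 : ℝ)..2 * Real.pi, ‖D (circleMap w w.im θ)‖ := by
    conv_lhs => rw [← hmean, Real.circleAverage_def, norm_smul,
      Real.norm_of_nonneg (by positivity : 0 ≤ (2 * Real.pi)⁻¹)]
    gcongr
    exact intervalIntegral.norm_integral_le_integral_norm (by positivity)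
  rw [intervalIntegral.integral_const, smul_eq_mul, sub_zero] at hlt
  have h4 := mul_lt_mul_of_pos_left hlt (by positivity : 0 < (2 * Real.pi)⁻¹)
  rw [inv_mul_cancel_left₀ (by positivity)] at h4
  exact absurd (h3.trans_lt h4) (lt_irrefl _)

/-- Poisson extensions of functions in `C₀(ℝ)` vanish at infinity on horizontal strips. -/
theorem exists_norm_poissonConv_lt (f : C₀(ℝ, ℂ)) {b ε : ℝ} (hε : 0 < ε) :
    ∃ N : ℝ, ∀ u v : ℝ, N ≤ |u| → 0 ≤ v → v ≤ b → ‖poissonConv f v u‖ < ε := by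
  let l : Filter (ℝ × ℝ) := (comap (fun u => |u|) atTop) ×ˢ 𝓟 (Set.Icc 0 b)
  have hlim : Tendsto (fun p : ℝ × ℝ => ∫ r, cauchyDensity r • f (p.1 - p.2 * r)) l
      (𝓝 (∫ r, cauchyDensity r • (0 : ℂ))) := by
    refine tendsto_integral_filter_of_dominated_convergence (fun r => cauchyDensity r * ‖f‖)
      (Eventually.of_forall fun p => ?_) (Eventually.of_forall fun p => Eventually.of_forall
        fun r => ?_) (integrable_cauchyDensity.mul_const _) (Eventually.of_forall fun r => ?_)
    · have h1 : Continuous fun r : ℝ => f (p.1 - p.2 * r) :=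
        (map_continuous f).comp (by fun_prop)
      exact integrable_cauchyDensity.1.smul h1.aestronglyMeasurable
    · rw [norm_smul, Real.norm_of_nonneg (cauchyDensity_nonneg r)]
      exact mul_le_mul_of_nonneg_left (norm_apply_le f _) (cauchyDensity_nonneg r)
    · refine Tendsto.const_smul ((zero_at_infty f).comp ?_) _
      rw [← Metric.cobounded_eq_cocompact, ← tendsto_norm_atTop_iff_cobounded]
      have h1 : Tendsto (fun p : ℝ × ℝ => |p.1| - b * |r|) l atTop :=
        tendsto_atTop_add_const_right _ _ (tendsto_comap.comp tendsto_fst)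
      refine tendsto_atTop_mono' _ ?_ h1
      have h2 : ∀ᶠ p : ℝ × ℝ in l, p.2 ∈ Set.Icc 0 b := tendsto_snd (mem_principal_self _)
      filter_upwards [h2] with p hp
      have h3 := abs_sub_abs_le_abs_sub p.1 (p.2 * r)
      rw [abs_mul, abs_of_nonneg hp.1] at h3
      have h4 : p.2 * |r| ≤ b * |r| := mul_le_mul_of_nonneg_right hp.2 (abs_nonneg r)
      rw [Real.norm_eq_abs]
      linarith
  simp only [smul_zero, integral_zero] at hlim
  have h1 : ∀ᶠ p : ℝ × ℝ in l, ‖poissonConv f p.2 p.1‖ < ε := by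
    have := hlim.norm.eventually_lt_const (u := ε) (by simpa using hε)
    filter_upwards [this] with p hp
    rwa [poissonConv_apply]
  obtain ⟨N, -, hN⟩ := ((atTop_basis.comap _).eventually_iff).1 (eventually_prod_principal_iff.1 h1)
  exact ⟨N, fun u v hu hv hvb => hN hu v ⟨hv, hvb⟩⟩

theorem continuous_poissonConv_apply (f : C₀(ℝ, ℂ)) :
    Continuous fun z : ℂ => poissonConv f z.im z.re := by
  have h1 : Continuous fun z : ℂ => (poissonConv f z.im).toBCF :=
    ZeroAtInftyContinuousMap.isometry_toBCF.continuous.comp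
      ((continuous_poissonConv f).comp Complex.continuous_im)
  exact h1.eval Complex.continuous_re

variable {X : Type*} [NormedAddCommGroup X] [NormedSpace ℂ X]

/-- The functional `F ↦ ∫ ⟨φ(s), F(s)⟩ ds`, for an integrable `φ : ℝ → X*`. -/
def densityFunctional {φ : ℝ → StrongDual ℂ X} (hφ : Integrable φ) : StrongDual ℂ C₀(ℝ, X) :=
  have hm : ∀ F : C₀(ℝ, X), AEStronglyMeasurable (fun s => φ s (F s)) := fun F =>
    (ContinuousLinearMap.apply ℂ ℂ : X →L[ℂ] _).aestronglyMeasurable_comp₂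
      (map_continuous F).aestronglyMeasurable hφ.1
  have hle : ∀ (F : C₀(ℝ, X)) (s : ℝ), ‖φ s (F s)‖ ≤ ‖φ s‖ * ‖F‖ := fun F s =>
    ((φ s).le_opNorm _).trans (mul_le_mul_of_nonneg_left (norm_apply_le F s) (norm_nonneg _))
  have hi : ∀ F : C₀(ℝ, X), Integrable (fun s => φ s (F s)) := fun F =>
    (hφ.norm.mul_const _).mono' (hm F) (Eventually.of_forall (hle F))
  LinearMap.mkContinuous
    { toFun := fun F => ∫ s, φ s (F s)
      map_add' := fun F G => by
        rw [← integral_add (hi F) (hi G)]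
        exact integral_congr_ae (Eventually.of_forall fun s => map_add (φ s) (F s) (G s))
      map_smul' := fun c F => by
        rw [RingHom.id_apply, ← integral_smul]
        exact integral_congr_ae (Eventually.of_forall fun s => map_smul (φ s) c (F s)) }
    (∫ s, ‖φ s‖) fun F => by
      rw [← integral_mul_const]
      exact norm_integral_le_of_norm_le (hφ.norm.mul_const _) (Eventually.of_forall (hle F))

theorem norm_densityFunctional_le {φ : ℝ → StrongDual ℂ X} (hφ : Integrable φ) :
    ‖densityFunctional hφ‖ ≤ ∫ s, ‖φ s‖ :=
  ContinuousLinearMap.opNorm_le_bound _ (integral_nonneg fun _ => norm_nonneg _) fun F => by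
    rw [← integral_mul_const]
    exact norm_integral_le_of_norm_le (hφ.norm.mul_const _) (Eventually.of_forall fun s =>
      ((φ s).le_opNorm _).trans (mul_le_mul_of_nonneg_left (norm_apply_le F s) (norm_nonneg _)))

theorem harmonicAt_comp_add {h : ℂ → ℂ} {a z : ℂ} (hh : HarmonicAt h (z + a)) :
    HarmonicAt (fun w => h (w + a)) z := by
  have ht : Tendsto (fun w => w + a) (𝓝 z) (𝓝 (z + a)) :=
    (continuous_id.add continuous_const).tendsto z
  refine ⟨hh.1.comp z (contDiffAt_id.add contDiffAt_const), ?_⟩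
  filter_upwards [ht.eventually hh.2] with w hw
  rw [InnerProductSpace.laplacian_eq_iteratedFDeriv_complexPlane] at hw ⊢
  simpa only [Pi.zero_apply, iteratedFDeriv_comp_add_right] using hw

/-- A harmonic function on the upper half-plane with bounded horizontal `L¹` norms is the Poisson
extension of its values on a horizontal line. -/
theorem poisson_representation {h : ℂ → ℂ} (hh : HarmonicOnNhd h {z : ℂ | 0 < z.im}) {C : ℝ}
    (hC0 : 0 ≤ C) (hC : ∀ v : ℝ, 0 < v → ∫⁻ u : ℝ, ‖h (u + v * Complex.I)‖ₑ ≤ ENNReal.ofReal C)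
    {δ : ℝ} (hδ : 0 < δ) {z : ℂ} (hz : 0 < z.im) :
    h (z + δ * Complex.I) = ∫ s : ℝ, h (s + δ * Complex.I) * poissonKer z s := by
  have hpi := Real.pi_pos
  have him : ∀ w : ℂ, (w + δ * Complex.I).im = w.im + δ := fun w => by simp
  have hre : ∀ w : ℂ, (w + δ * Complex.I).re = w.re := fun w => by simp
  let f : C₀(ℝ, ℂ) :=
    { toFun := fun u => h (u + δ * Complex.I)
      continuous_toFun := hh.continuousOn.comp_continuous (by fun_prop) fun u => by simpa using hδ
      zero_at_infty' := by
        rw [← Metric.cobounded_eq_cocompact, ← comap_norm_atTop, Metric.tendsto_nhds]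
        intro ε hε
        obtain ⟨N, hN⟩ := exists_norm_lt_of_strip hh hC hδ (b := δ) hε
        refine ((atTop_basis.comap _).eventually_iff).2 ⟨N, trivial, fun u hu => ?_⟩
        rw [dist_zero_right]
        refine hN _ ?_ (by simp) (by simp)
        simpa using hu }
  have hfapp : ∀ u, f u = h (u + δ * Complex.I) := fun u => rfl
  have hfi : Integrable f :=
    ⟨(map_continuous f).aestronglyMeasurable, (hC δ hδ).trans_lt ENNReal.ofReal_lt_top⟩
  have hφ : Integrable fun s => f s • ContinuousLinearMap.id ℂ ℂ := hfi.smul_const _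
  let Λ : StrongDual ℂ C₀(ℝ, ℂ) := densityFunctional hφ
  have hΛ : ∀ g : C₀(ℝ, ℂ), Λ g = ∫ s, f s * g s := fun g => rfl
  have hrep : ∀ w : ℂ, 0 < w.im → poissonConv f w.im w.re = Λ (poissonKer w) := fun w hw => by
    rw [poissonConv_apply_eq_integral hw, hΛ, Complex.re_add_im]
    exact integral_congr_ae (Eventually.of_forall fun s => mul_comm _ _)
  let D : ℂ → ℂ := fun w => h (w + δ * Complex.I) - poissonConv f w.im w.re
  have hD : HarmonicOnNhd D {w : ℂ | 0 < w.im} := by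
    intro w hw
    have hw' : 0 < w.im := hw
    refine HarmonicAt.sub (harmonicAt_comp_add (hh _ ?_)) ?_
    · change 0 < (w + δ * Complex.I).im
      rw [him]; positivity
    · have h1 : (fun w : ℂ => poissonConv f w.im w.re) =ᶠ[𝓝 w] fun w => Λ (poissonKer w) := by
        filter_upwards [isOpen_upper.mem_nhds hw] with x hx
        exact hrep x hx
      rw [harmonicAt_congr_nhds h1]
      exact (harmonicAt_poissonKer hw'.ne').comp_CLM (Λ.restrictScalars ℝ)
  have h1 := eq_zero_of_harmonic hD (K := 4 * C / Real.pi + (∫ s, ‖f s‖) / Real.pi) ?_ ?_ ?_ ?_ hz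
  · rw [sub_eq_zero, hrep z hz, hΛ] at h1
    exact h1
  · refine ContinuousOn.sub ?_ (continuous_poissonConv_apply f).continuousOn
    refine hh.continuousOn.comp (by fun_prop) fun w hw => ?_
    have hw' : 0 ≤ w.im := hw
    change 0 < (w + δ * Complex.I).im
    rw [him]; positivity
  · intro w hw
    change h (w + δ * Complex.I) - poissonConv f w.im w.re = 0
    rw [hw, poissonConv_zero, hfapp, sub_eq_zero]
    congr 2
    apply Complex.ext <;> simp [hw]
  · intro w hw
    have h2 : ‖h (w + δ * Complex.I)‖ ≤ 4 * C / (Real.pi * w.im) := by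
      refine (norm_le_div_im hh hC0 hC (by rw [him]; positivity)).trans ?_
      rw [him]
      gcongr
      linarith
    have h3 : ‖Λ (poissonKer w)‖ ≤ (∫ s, ‖f s‖) * (Real.pi * w.im)⁻¹ := by
      refine (Λ.le_opNorm _).trans (mul_le_mul ?_ ?_ (norm_nonneg _)
        (integral_nonneg fun _ => norm_nonneg _))
      · refine (norm_densityFunctional_le hφ).trans (le_of_eq ?_)
        refine integral_congr_ae (Eventually.of_forall fun s => ?_)
        simp only [norm_smul]
        rw [ContinuousLinearMap.norm_id, mul_one]
      · have := norm_poissonKer_le hw w.re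
        rwa [Complex.re_add_im] at this
    calc ‖D w‖ ≤ ‖h (w + δ * Complex.I)‖ + ‖Λ (poissonKer w)‖ := by
          rw [← hrep w hw]
          exact norm_sub_le _ _
      _ ≤ 4 * C / (Real.pi * w.im) + (∫ s, ‖f s‖) * (Real.pi * w.im)⁻¹ := add_le_add h2 h3
      _ = _ := by field_simp
  · intro b ε hε
    obtain ⟨N₁, h₁⟩ := exists_norm_lt_of_strip hh hC hδ (b := b + δ) (half_pos hε)
    obtain ⟨N₂, h₂⟩ := exists_norm_poissonConv_lt f (b := b) (half_pos hε)
    refine ⟨max N₁ N₂, fun w hw hw0 hwb => ?_⟩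
    have e1 := h₁ (w + δ * Complex.I) (by rw [hre]; exact (le_max_left _ _).trans hw)
      (by rw [him]; linarith) (by rw [him]; linarith)
    have e2 := h₂ w.re w.im ((le_max_right _ _).trans hw) hw0 hwb
    calc ‖D w‖ ≤ ‖h (w + δ * Complex.I)‖ + ‖poissonConv f w.im w.re‖ := norm_sub_le _ _
      _ < ε := by linarith

end PoissonRepresentation


/-! ### The Poisson transform of vector measures -/

section PoissonTransform

open InnerProductSpace

variable {X : Type*} [NormedAddCommGroup X] [NormedSpace ℂ X]

theorem norm_tensor_le (f : C₀(ℝ, ℂ)) (x : X) : ‖tensor f x‖ ≤ ‖f‖ * ‖x‖ :=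
  zeroAtInfty_norm_le (by positivity) fun t => by
    rw [tensor_apply, norm_smul]
    exact mul_le_mul_of_nonneg_right (norm_apply_le f t) (norm_nonneg x)

theorem tensor_add_left (f g : C₀(ℝ, ℂ)) (x : X) : tensor (f + g) x = tensor f x + tensor g x := by
  ext t; exact add_smul _ _ _

theorem tensor_smul_left (c : ℂ) (f : C₀(ℝ, ℂ)) (x : X) : tensor (c • f) x = c • tensor f x := by
  ext t; exact smul_assoc c (f t) x

theorem tensor_add_right (f : C₀(ℝ, ℂ)) (x y : X) : tensor f (x + y) = tensor f x + tensor f y := by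
  ext t; exact smul_add _ _ _

theorem tensor_smul_right (c : ℂ) (f : C₀(ℝ, ℂ)) (x : X) : tensor f (c • x) = c • tensor f x := by
  ext t; exact smul_comm _ _ _

/-- The operator `C₀(ℝ) → X*`, `f ↦ (x ↦ L (f ⊗ x))`, of a functional `L` on `C₀(ℝ; X)`. -/
def tensorDual (L : StrongDual ℂ C₀(ℝ, X)) : C₀(ℝ, ℂ) →L[ℂ] StrongDual ℂ X :=
  LinearMap.mkContinuous₂ (LinearMap.mk₂ ℂ (fun f x => L (tensor f x))
    (fun f g x => by rw [tensor_add_left, map_add])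
    (fun c f x => by rw [tensor_smul_left, map_smul])
    (fun f x y => by rw [tensor_add_right, map_add])
    (fun c f x => by rw [tensor_smul_right, map_smul])) ‖L‖ fun f x => by
      rw [mul_assoc]
      exact (L.le_opNorm _).trans (mul_le_mul_of_nonneg_left (norm_tensor_le f x) (norm_nonneg _))

@[simp] theorem tensorDual_apply (L : StrongDual ℂ C₀(ℝ, X)) (f : C₀(ℝ, ℂ)) (x : X) :
    tensorDual L f x = L (tensor f x) := rfl

theorem integrable_halfPlanePoisson (m : Measure ℝ) [IsFiniteMeasure m] (z : ℍ) :
    Integrable (halfPlanePoisson z) m := by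
  have h := (integrable_zeroAtInfty m (poissonKer z)).re
  refine h.congr (Eventually.of_forall fun t => ?_)
  change (poissonKer z t).re = _
  rw [poissonKer_apply_coe, Complex.ofReal_re]

theorem poissonIntegral_eq (μ : BddMeasure (StrongDual ℂ X)) (z : ℍ) :
    poissonIntegral μ z = tensorDual (integralFunctional μ) (poissonKer z) := by
  ext x
  let τ : ℝ →L[ℝ] X := (ContinuousLinearMap.id ℝ ℝ).smulRight x
  have h := map_integral (μ := μ.toVM) (ν := μ.toVM) (B := ContinuousLinearMap.lsmul ℝ ℝ)
    (B' := evPairing X) (ℓ := τ)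
    (M := (ContinuousLinearMap.apply ℂ ℂ x : StrongDual ℂ X →L[ℂ] ℂ).restrictScalars ℝ)
    ENNReal.one_ne_top (by simp) (fun e s _ => ?_) (integrable_halfPlanePoisson _ z)
  · refine h.trans ?_
    rw [tensorDual_apply, integralFunctional_apply]
    congr 1
    ext t
    rw [tensor_apply, poissonKer_apply_coe]
    rfl
  · change (((e : ℝ) : ℂ) • μ.toVM s) x = (μ.toVM s) (e • x)
    rw [smul_apply, ← Complex.coe_smul, map_smul]

theorem norm_poissonIntegral_le (μ : BddMeasure (StrongDual ℂ X)) (z : ℍ) :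
    ‖poissonIntegral μ z‖ₑ ≤ ∫⁻ t, ‖poissonKer z t‖ₑ ∂μ.toVM.variation := by
  refine VectorMeasure.enorm_integral_le_lintegral_enorm.trans ?_
  have h1 : ‖(ContinuousLinearMap.lsmul ℝ ℝ : ℝ →L[ℝ] StrongDual ℂ X →L[ℝ] StrongDual ℂ X)‖ₑ ≤ 1 := by
    rw [← ofReal_norm, ← ENNReal.ofReal_one]
    exact ENNReal.ofReal_le_ofReal ContinuousLinearMap.opNorm_lsmul_le
  refine (mul_le_of_le_one_left zero_le h1).trans (lintegral_mono fun t => ?_)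
  rw [poissonKer_apply_coe, ← ofReal_norm, ← ofReal_norm, Complex.norm_real]

theorem slice_poissonIntegral (μ : BddMeasure (StrongDual ℂ X)) {v : ℝ} (hv : 0 < v) (u : ℝ) :
    slice (poissonIntegral μ) v u =
      tensorDual (integralFunctional μ) (poissonKer (u + v * Complex.I)) := by
  rw [slice, poissonIntegral_eq, ofComplex_apply_of_im_pos (by simpa using hv)]

theorem enorm_poissonKer {v : ℝ} (hv : 0 < v) (u t : ℝ) :
    ‖poissonKer (u + v * Complex.I) t‖ₑ =
      ENNReal.ofReal (v⁻¹ * cauchyDensity (v⁻¹ * (u - t))) := by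
  rw [poissonKer_eq_cauchyDensity hv, ← ofReal_norm, Complex.norm_real, Real.norm_of_nonneg]
  exact mul_nonneg (by positivity) (cauchyDensity_nonneg _)

theorem lintegral_poissonKer {v : ℝ} (hv : 0 < v) (t : ℝ) :
    ∫⁻ u : ℝ, ‖poissonKer (u + v * Complex.I) t‖ₑ = 1 := by
  simp_rw [enorm_poissonKer hv]
  rw [lintegral_sub_right_eq_self (fun u => ENNReal.ofReal (v⁻¹ * cauchyDensity (v⁻¹ * u))),
    ← ofReal_integral_eq_lintegral_ofReal]
  · rw [integral_const_mul, Measure.integral_comp_mul_left, inv_inv, abs_of_pos hv,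
      integral_cauchyDensity, smul_eq_mul, mul_one, inv_mul_cancel₀ hv.ne', ENNReal.ofReal_one]
  · exact (integrable_cauchyDensity.comp_mul_left' (inv_ne_zero hv.ne')).const_mul _
  · exact Eventually.of_forall fun u => mul_nonneg (by positivity) (cauchyDensity_nonneg _)

theorem measurable_cauchyDensity : Measurable cauchyDensity := by
  unfold cauchyDensity; fun_prop

theorem lintegral_slice_le (μ : BddMeasure (StrongDual ℂ X)) {v : ℝ} (hv : 0 < v) :
    ∫⁻ u, ‖slice (poissonIntegral μ) v u‖ₑ ≤ μ.toVM.variation Set.univ := by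
  calc ∫⁻ u, ‖slice (poissonIntegral μ) v u‖ₑ
      ≤ ∫⁻ u : ℝ, ∫⁻ t, ‖poissonKer (u + v * Complex.I) t‖ₑ ∂μ.toVM.variation := by
        refine lintegral_mono fun u => ?_
        have h := norm_poissonIntegral_le μ (ofComplex (u + v * Complex.I))
        rw [ofComplex_apply_of_im_pos (by simpa using hv)] at h
        rwa [slice, ofComplex_apply_of_im_pos (by simpa using hv)]
    _ = ∫⁻ t, ∫⁻ u : ℝ, ‖poissonKer (u + v * Complex.I) t‖ₑ ∂volume ∂μ.toVM.variation := by
        refine lintegral_lintegral_swap ?_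
        simp only [Function.uncurry_def, enorm_poissonKer hv]
        exact (ENNReal.measurable_ofReal.comp ((measurable_cauchyDensity.comp
          (by fun_prop)).const_mul _)).aemeasurable
    _ = μ.toVM.variation Set.univ := by
        simp_rw [lintegral_poissonKer hv, lintegral_one]

theorem continuous_slice_poissonIntegral (μ : BddMeasure (StrongDual ℂ X)) {v : ℝ} (hv : 0 < v) :
    Continuous (slice (poissonIntegral μ) v) := by
  rw [show slice (poissonIntegral μ) v = _ from funext (slice_poissonIntegral μ hv)]
  exact (tensorDual _).continuous.comp (continuous_poissonKer_line hv)

theorem integrable_slice_poissonIntegral (μ : BddMeasure (StrongDual ℂ X)) {v : ℝ} (hv : 0 < v) :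
    Integrable (slice (poissonIntegral μ) v) :=
  ⟨(continuous_slice_poissonIntegral μ hv).aestronglyMeasurable,
    (lintegral_slice_le μ hv).trans_lt (measure_lt_top _ _)⟩

theorem integral_slice_poissonIntegral_le (μ : BddMeasure (StrongDual ℂ X)) {v : ℝ} (hv : 0 < v) :
    ∫ u, ‖slice (poissonIntegral μ) v u‖ ≤ ‖μ‖ := by
  rw [integral_norm_eq_lintegral_enorm (continuous_slice_poissonIntegral μ hv).aestronglyMeasurable]
  exact ENNReal.toReal_mono (measure_ne_top _ _) (lintegral_slice_le μ hv)

/-- The Poisson integral of `μ`, as an element of `h¹(P₊; X*)`. -/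
def poissonH1 (μ : BddMeasure (StrongDual ℂ X)) : HarmonicH1 (StrongDual ℂ X) :=
  ⟨poissonIntegral μ, by
    intro z hz
    have hz' : 0 < z.im := hz
    have h1 : poissonIntegral μ ∘ ofComplex =ᶠ[𝓝 z]
        fun w => tensorDual (integralFunctional μ) (poissonKer w) := by
      filter_upwards [isOpen_upper.mem_nhds hz] with w hw
      rw [Function.comp_apply, poissonIntegral_eq, ofComplex_apply_of_im_pos hw]
    rw [harmonicAt_congr_nhds h1]
    exact (harmonicAt_poissonKer hz'.ne').comp_CLM
      ((tensorDual (integralFunctional μ)).restrictScalars ℝ),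
    fun v hv => integrable_slice_poissonIntegral μ hv,
    ‖μ‖, fun v hv => integral_slice_poissonIntegral_le μ hv⟩

@[simp] theorem poissonH1_toFun (μ : BddMeasure (StrongDual ℂ X)) :
    (poissonH1 μ).toFun = poissonIntegral μ := rfl

theorem norm_poissonH1_le (μ : BddMeasure (StrongDual ℂ X)) : ‖poissonH1 μ‖ ≤ ‖μ‖ := by
  have : Nonempty (Set.Ioi (0 : ℝ)) := ⟨⟨1, Set.mem_Ioi.2 one_pos⟩⟩
  exact ciSup_le fun v => integral_slice_poissonIntegral_le μ v.2

theorem poissonH1_add (μ ν : BddMeasure (StrongDual ℂ X)) :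
    poissonH1 (μ + ν) = poissonH1 μ + poissonH1 ν := by
  refine Subtype.ext (funext fun z => ?_)
  change poissonIntegral (μ + ν) z = poissonIntegral μ z + poissonIntegral ν z
  rw [poissonIntegral_eq, poissonIntegral_eq, poissonIntegral_eq, integralFunctional_add]
  rfl

theorem poissonH1_smul (c : ℂ) (μ : BddMeasure (StrongDual ℂ X)) :
    poissonH1 (c • μ) = c • poissonH1 μ := by
  refine Subtype.ext (funext fun z => ?_)
  change poissonIntegral (c • μ) z = c • poissonIntegral μ z
  rw [poissonIntegral_eq, poissonIntegral_eq, integralFunctional_smul]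
  rfl

/-- Every `φ ∈ h¹(P₊; X*)` is a Poisson integral: of a weak* cluster point, as `δ → 0`, of the
measures `φ(s + iδ) ds`. -/
theorem exists_poissonH1_eq (φ : HarmonicH1 (StrongDual ℂ X)) :
    ∃ μ, ‖μ‖ ≤ ‖φ‖ ∧ poissonH1 μ = φ := by
  let δ : ℕ → ℝ := fun n => 1 / ((n : ℝ) + 1)
  have hδ : ∀ n, 0 < δ n := fun n => by positivity
  have hint : ∀ n, Integrable (slice φ.toFun (δ n)) := fun n => φ.2.2.1 _ (hδ n)
  let ξ : ℕ → StrongDual ℂ C₀(ℝ, X) := fun n => densityFunctional (hint n)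
  have hξ : ∀ n, ‖ξ n‖ ≤ ‖φ‖ := fun n =>
    (norm_densityFunctional_le (hint n)).trans (φ.integral_slice_le ⟨δ n, hδ n⟩)
  -- a weak* limit along an ultrafilter
  obtain ⟨η, hη, hlim⟩ := (WeakDual.isCompact_closedBall (𝕜 := ℂ) (0 : StrongDual ℂ C₀(ℝ, X)) ‖φ‖
    ).ultrafilter_le_nhds ((hyperfilter ℕ).map fun n => StrongDual.toWeakDual (ξ n)) (by
      rw [le_principal_iff]
      refine mem_map.2 (univ_mem' fun n => ?_)
      simpa using hξ n)
  have hη' : ‖WeakDual.toStrongDual η‖ ≤ ‖φ‖ := by simpa using hη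
  have hev : ∀ F, Tendsto (fun n => ξ n F) (hyperfilter ℕ) (𝓝 (WeakDual.toStrongDual η F)) :=
    fun F => ((WeakDual.eval_continuous F).tendsto η).comp hlim
  obtain ⟨μ, hμ, hμη⟩ := exists_integralFunctional_eq (WeakDual.toStrongDual η)
  refine ⟨μ, hμ.trans hη', Subtype.ext (funext fun z => ?_)⟩
  change poissonIntegral μ z = φ.toFun z
  ext x
  rw [poissonIntegral_eq, tensorDual_apply, hμη]
  refine tendsto_nhds_unique (hev (tensor (poissonKer z) x)) ?_
  -- the Poisson representation of the scalar function `φ(·) x`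
  let e : StrongDual ℂ X →L[ℂ] ℂ := ContinuousLinearMap.apply ℂ ℂ x
  let h : ℂ → ℂ := fun w => e (φ.toFun (ofComplex w))
  have hh : HarmonicOnNhd h {w : ℂ | 0 < w.im} := φ.2.1.comp_CLM (e.restrictScalars ℝ)
  have hC : ∀ v : ℝ, 0 < v → ∫⁻ u : ℝ, ‖h (u + v * Complex.I)‖ₑ ≤ ENNReal.ofReal (‖x‖ * ‖φ‖) := by
    intro v hv
    have hi : Integrable (slice φ.toFun v) := φ.2.2.1 v hv
    calc ∫⁻ u : ℝ, ‖h (u + v * Complex.I)‖ₑ ≤ ∫⁻ u, ‖x‖ₑ * ‖slice φ.toFun v u‖ₑ :=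
          lintegral_mono fun u => ((slice φ.toFun v u).le_opENorm x).trans_eq (mul_comm _ _)
      _ = ‖x‖ₑ * ENNReal.ofReal (∫ u, ‖slice φ.toFun v u‖) := by
          rw [lintegral_const_mul' _ _ enorm_ne_top, ofReal_integral_norm_eq_lintegral_enorm hi]
      _ ≤ ENNReal.ofReal (‖x‖ * ‖φ‖) := by
          rw [ENNReal.ofReal_mul (norm_nonneg _), ofReal_norm]
          gcongr
          exact φ.integral_slice_le ⟨v, hv⟩
  have hrep : ∀ n, ξ n (tensor (poissonKer z) x) = h (z + δ n * Complex.I) := fun n => by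
    rw [poisson_representation hh (by positivity) hC (hδ n) z.im_pos]
    refine integral_congr_ae (Eventually.of_forall fun s => ?_)
    change slice φ.toFun (δ n) s (poissonKer z s • x) = _
    rw [map_smul, smul_eq_mul, mul_comm]
    rfl
  simp_rw [hrep]
  have hcont : ContinuousAt h z := (hh.continuousOn.continuousAt (isOpen_upper.mem_nhds z.im_pos))
  have hz : h z = φ.toFun z x := by
    change φ.toFun (ofComplex z) x = _
    rw [ofComplex_apply]
  rw [← hz]
  have h1 : Tendsto (fun n => (z : ℂ) + δ n * Complex.I) atTop (𝓝 z) := by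
    have h2 : Tendsto (fun n => ((δ n : ℝ) : ℂ)) atTop (𝓝 ((0 : ℝ) : ℂ)) :=
      (Complex.continuous_ofReal.tendsto 0).comp tendsto_one_div_add_atTop_nhds_zero_nat
    simpa using (h2.mul_const Complex.I).const_add (z : ℂ)
  exact (hcont.tendsto.comp h1).mono_left Nat.hyperfilter_le_atTop

end PoissonTransform


/-! ### Images of vector measures, and bounded pointwise convergence -/

section MapMeasure

variable {X Y : Type*} [NormedAddCommGroup X] [NormedSpace ℂ X] [NormedAddCommGroup Y]
  [NormedSpace ℂ Y]

theorem variation_mapRange_le {Z Z' : Type*} [NormedAddCommGroup Z] [NormedSpace ℂ Z]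
    [NormedAddCommGroup Z'] [NormedSpace ℂ Z'] (T : Z →L[ℂ] Z') (μ : VectorMeasure ℝ Z) :
    (μ.mapRange (T : Z →+ Z') T.continuous).variation ≤ ‖T‖ₑ • μ.variation :=
  VectorMeasure.variation_le_of_forall_enorm_le fun s _ =>
    (T.le_opENorm (μ s)).trans (mul_le_mul_right (VectorMeasure.enorm_measure_le_variation _ _) _)

/-- The image of a bounded measure under a bounded operator. -/
def BddMeasure.mapCLM {Z Z' : Type*} [NormedAddCommGroup Z] [NormedSpace ℂ Z]
    [NormedAddCommGroup Z'] [NormedSpace ℂ Z'] (T : Z →L[ℂ] Z') (μ : BddMeasure Z) :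
    BddMeasure Z' :=
  ⟨μ.toVM.mapRange (T : Z →+ Z') T.continuous,
    ne_top_of_le_ne_top (ENNReal.mul_ne_top enorm_ne_top μ.2) (variation_mapRange_le T μ.toVM _)⟩

@[simp] theorem BddMeasure.mapCLM_apply {Z Z' : Type*} [NormedAddCommGroup Z] [NormedSpace ℂ Z]
    [NormedAddCommGroup Z'] [NormedSpace ℂ Z'] (T : Z →L[ℂ] Z') (μ : BddMeasure Z) (s : Set ℝ) :
    (μ.mapCLM T).toVM s = T (μ.toVM s) := rfl

/-- Precomposition with an operator, on dual spaces. -/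
def dualMap (T : Y →L[ℂ] X) : StrongDual ℂ X →L[ℂ] StrongDual ℂ Y :=
  (ContinuousLinearMap.compL ℂ Y X ℂ).flip T

@[simp] theorem dualMap_apply (T : Y →L[ℂ] X) (φ : StrongDual ℂ X) (y : Y) :
    dualMap T φ y = φ (T y) := rfl

theorem integral_mapCLM_dualMap (T : Y →L[ℂ] X) (μ : BddMeasure (StrongDual ℂ X)) {f : ℝ → Y}
    (hf : Integrable f μ.toVM.variation) :
    ∫ᵛ t, f t ∂[evPairing Y; (μ.mapCLM (dualMap T)).toVM] =
      ∫ᵛ t, T (f t) ∂[evPairing X; μ.toVM] := by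
  have h1 := map_integral (μ := μ.toVM) (ν := μ.toVM)
    (B := (evPairing X).comp (T.restrictScalars ℝ)) (B' := evPairing X)
    (ℓ := T.restrictScalars ℝ) (M := ContinuousLinearMap.id ℝ ℂ) ENNReal.one_ne_top
    (by simp) (fun e s _ => rfl) hf
  have h2 := map_integral (μ := μ.toVM) (ν := (μ.mapCLM (dualMap T)).toVM)
    (B := (evPairing X).comp (T.restrictScalars ℝ)) (B' := evPairing Y)
    (ℓ := ContinuousLinearMap.id ℝ Y) (M := ContinuousLinearMap.id ℝ ℂ) enorm_ne_top
    (variation_mapRange_le (dualMap T) μ.toVM) (fun e s _ => rfl) hf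
  exact h2.symm.trans h1

/-- Functionals on `C₀(ℝ; X)` are continuous for bounded pointwise convergence. -/
theorem tendsto_of_tendsto_pointwise (L : StrongDual ℂ C₀(ℝ, X)) {F : ℕ → C₀(ℝ, X)}
    {G : C₀(ℝ, X)} {C : ℝ} (hC : ∀ n t, ‖F n t‖ ≤ C)
    (hF : ∀ t, Tendsto (fun n => F n t) atTop (𝓝 (G t))) :
    Tendsto (fun n => L (F n)) atTop (𝓝 (L G)) := by
  obtain ⟨μ, -, rfl⟩ := exists_integralFunctional_eq L
  exact VectorMeasure.tendsto_integral_filter_of_norm_le_const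
    (Eventually.of_forall fun n => (map_continuous (F n)).aestronglyMeasurable)
    ⟨C, Eventually.of_forall fun n => Eventually.of_forall (hC n)⟩ (Eventually.of_forall hF)

end MapMeasure

/-! ### Injectivity of the Poisson transform -/

section PoissonInjective

variable {X : Type*} [NormedAddCommGroup X] [NormedSpace ℂ X]

theorem integrable_cutoffMul (n : ℕ) (f : C₀(ℝ, ℂ)) : Integrable (cutoffMul n f) :=
  (map_continuous _).integrable_of_hasCompactSupport (hasCompactSupport_cutoff n).smul_right

/-- The Poisson kernels span a dense subspace of `C₀(ℝ)`. -/
theorem eq_zero_of_poissonKer {Λ : StrongDual ℂ C₀(ℝ, ℂ)}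
    (h : ∀ z : ℂ, 0 < z.im → Λ (poissonKer z) = 0) : Λ = 0 := by
  have h1 : ∀ f : C₀(ℝ, ℂ), Integrable f → Λ f = 0 := by
    intro f hf
    have h2 : ∀ v > 0, Λ (poissonConv f v) = 0 := by
      intro v hv
      rw [poissonConv_eq_integral hv hf, ← Λ.integral_comp_comm (integrable_smul_poissonKer hv hf)]
      refine integral_eq_zero_of_ae (Eventually.of_forall fun s => ?_)
      change Λ (f s • _) = 0
      rw [map_smul, h _ (by simpa using hv), smul_zero]
    have h3 : Tendsto (fun v => Λ (poissonConv f v)) (𝓝[>] 0) (𝓝 (Λ f)) := by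
      have := ((Λ.continuous.comp (continuous_poissonConv f)).tendsto 0)
      rw [Function.comp_apply, poissonConv_zero] at this
      exact this.mono_left nhdsWithin_le_nhds
    refine tendsto_nhds_unique h3 (tendsto_const_nhds.congr' ?_)
    filter_upwards [self_mem_nhdsWithin] with v hv
    exact (h2 v hv).symm
  ext f
  refine tendsto_nhds_unique ((Λ.continuous.tendsto f).comp (tendsto_cutoffMul f))
    (tendsto_const_nhds.congr fun n => (h1 _ (integrable_cutoffMul n f)).symm)

/-- A bounded measure is determined by its pairings with elementary tensors. -/
theorem eq_zero_of_tensorDual_eq_zero {μ : BddMeasure (StrongDual ℂ X)}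
    (h : tensorDual (integralFunctional μ) = 0) : μ = 0 := by
  have h1 : ∀ (x : X) (s : Set ℝ), μ.toVM s x = 0 := by
    intro x s
    let T : ℂ →L[ℂ] X := (ContinuousLinearMap.id ℂ ℂ).smulRight x
    have h2 : μ.mapCLM (dualMap T) = 0 := by
      refine eq_zero_of_integralFunctional_eq_zero ?_
      ext f
      rw [integralFunctional_apply, integral_mapCLM_dualMap T μ (integrable_zeroAtInfty _ f)]
      exact congrArg (fun A => A x) (congrArg (fun A => A f) h)
    have h3 : (μ.mapCLM (dualMap T)).toVM s 1 = 0 := by rw [h2]; rfl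
    simpa [T] using h3
  refine Subtype.ext (VectorMeasure.ext fun s _ => ?_)
  ext x
  exact h1 x s

/-- The Poisson transform is injective, as the Poisson kernels span a dense subspace. -/
theorem eq_zero_of_poissonH1_eq_zero {μ : BddMeasure (StrongDual ℂ X)} (h : poissonH1 μ = 0) :
    μ = 0 := by
  refine eq_zero_of_tensorDual_eq_zero ?_
  have h1 : ∀ x, (ContinuousLinearMap.apply ℂ ℂ x).comp (tensorDual (integralFunctional μ)) = 0 := by
    intro x
    refine eq_zero_of_poissonKer fun z hz => ?_
    have h2 := poissonIntegral_eq μ ⟨z, hz⟩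
    have h3 : poissonIntegral μ ⟨z, hz⟩ = 0 := congrFun (congrArg HarmonicH1.toFun h) _
    rw [h3] at h2
    exact (congrArg (fun A : StrongDual ℂ X => A x) h2).symm
  ext f x
  exact congrArg (fun A => A f) (h1 x)

/-- The Poisson transform as an isometric isomorphism `M(ℝ; X*) ≃ h¹(P₊; X*)`. -/
def poissonEquiv (X : Type*) [NormedAddCommGroup X] [NormedSpace ℂ X] :
    BddMeasure (StrongDual ℂ X) ≃ₗᵢ[ℂ] HarmonicH1 (StrongDual ℂ X) :=
  LinearIsometryEquiv.ofSurjective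
    { toFun := poissonH1
      map_add' := poissonH1_add
      map_smul' := poissonH1_smul
      norm_map' := fun μ => by
        obtain ⟨ν, hν, h⟩ := exists_poissonH1_eq (poissonH1 μ)
        have : ν - μ = 0 := eq_zero_of_poissonH1_eq_zero (by
          have e : ν - μ = ν + (-1 : ℂ) • μ := by module
          rw [e, poissonH1_add, poissonH1_smul, h]
          module)
        rw [sub_eq_zero.1 this] at hν
        exact le_antisymm (norm_poissonH1_le μ) hν }
    fun φ => by
      obtain ⟨μ, -, h⟩ := exists_poissonH1_eq φ
      exact ⟨μ, h⟩

theorem poissonEquiv_apply (μ : BddMeasure (StrongDual ℂ X)) : poissonEquiv X μ = poissonH1 μ := rfl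

end PoissonInjective

/-! ### Holomorphic Poisson integrals -/

section Holomorphic

variable {E : Type*} [NormedAddCommGroup E] [NormedSpace ℂ E]

/-- If the Poisson extension of `Λ` is holomorphic, then so is `z ↦ Λ k_{z̄}`; being also
antiholomorphic, it is constant, and it vanishes at infinity. -/
theorem cauchyKernel_conj_eq_zero {Λ : C₀(ℝ, ℂ) →L[ℂ] E}
    (h : DifferentiableOn ℂ (fun z => Λ (poissonKer z)) {z : ℂ | 0 < z.im}) {z : ℂ}
    (hz : 0 < z.im) : Λ (cauchyKernel (starRingEnd ℂ z)) = 0 := by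
  let B : ℂ → E := fun w => Λ (cauchyKernel (starRingEnd ℂ w))
  have hA : DifferentiableOn ℂ (fun w => Λ (cauchyKernel w)) {w : ℂ | w.im ≠ 0} :=
    Λ.differentiable.comp_differentiableOn differentiableOn_cauchyKernel
  have hB : DifferentiableOn ℂ B {w : ℂ | 0 < w.im} := by
    have h1 : ∀ w, B w = Λ (cauchyKernel w) - (2 * Real.pi * Complex.I : ℂ) • Λ (poissonKer w) := by
      intro w
      rw [poissonKer, map_smul, smul_inv_smul₀ Complex.two_pi_I_ne_zero, map_sub, sub_sub_cancel]
    rw [funext h1]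
    exact (hA.mono fun w (hw : 0 < w.im) => hw.ne').sub (h.const_smul _)
  -- `B` is complex differentiable, and so is its composition with the conjugation
  have hderiv : Set.EqOn (deriv B) 0 {w : ℂ | 0 < w.im} := by
    intro w hw
    have hw' : 0 < w.im := hw
    have hwc : (starRingEnd ℂ w).im ≠ 0 := by simpa using hw'.ne'
    have d1 : HasDerivAt B (deriv B w) w := (hB.differentiableAt (isOpen_upper.mem_nhds hw)).hasDerivAt
    have d2 := (hA.differentiableAt (isOpen_im_ne_zero.mem_nhds hwc)).hasDerivAt
    set b := deriv B w
    set c := deriv (fun w => Λ (cauchyKernel w)) (starRingEnd ℂ w)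
    have f1 := d1.hasFDerivAt.restrictScalars ℝ
    have f2 := (d2.hasFDerivAt.restrictScalars ℝ).comp w
      (Complex.conjCLE : ℂ →L[ℝ] ℂ).hasFDerivAt
    have f3 := f1.unique f2
    have e1 : (1 : ℂ) • b = (starRingEnd ℂ 1) • c := congrArg (fun A : ℂ →L[ℝ] E => A 1) f3
    have e2 : Complex.I • b = (starRingEnd ℂ Complex.I) • c :=
      congrArg (fun A : ℂ →L[ℝ] E => A Complex.I) f3
    rw [map_one, one_smul, one_smul] at e1
    rw [← e1, Complex.conj_I] at e2
    have e3 : (2 * Complex.I) • b = 0 := by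
      rw [show 2 * Complex.I = Complex.I - -Complex.I by ring, sub_smul]
      exact sub_eq_zero.2 e2
    simpa using e3
  have hconst : ∀ w : ℂ, 0 < w.im → B z = B w := fun w hw =>
    isOpen_upper.is_const_of_deriv_eq_zero
      (convex_halfSpace_im_gt 0).isPreconnected hB hderiv hz hw
  have hbound : ∀ n : ℕ, ‖B z‖ ≤ ‖Λ‖ * (1 / ((n : ℝ) + 1)) := by
    intro n
    have hn : (0 : ℝ) < n + 1 := by positivity
    have him : ((((n : ℝ) + 1 : ℝ) : ℂ) * Complex.I).im = n + 1 := by simp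
    rw [hconst ((((n : ℝ) + 1 : ℝ) : ℂ) * Complex.I) (by rw [him]; exact hn)]
    refine (Λ.le_opNorm _).trans (mul_le_mul_of_nonneg_left ?_ (norm_nonneg _))
    refine (norm_cauchyKernel_le (by rw [Complex.conj_im, him]; exact (neg_neg_of_pos hn).ne)).trans ?_
    rw [Complex.conj_im, him, abs_neg, abs_of_pos hn, one_div]
  have hlim : Tendsto (fun n : ℕ => ‖Λ‖ * (1 / ((n : ℝ) + 1))) atTop (𝓝 (‖Λ‖ * 0)) :=
    tendsto_one_div_add_atTop_nhds_zero_nat.const_mul _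
  rw [mul_zero] at hlim
  exact norm_le_zero_iff.1 (ge_of_tendsto' hlim hbound)

theorem differentiableOn_of_cauchyKernel_conj {Λ : C₀(ℝ, ℂ) →L[ℂ] E}
    (h : ∀ z : ℂ, 0 < z.im → Λ (cauchyKernel (starRingEnd ℂ z)) = 0) :
    DifferentiableOn ℂ (fun z => Λ (poissonKer z)) {z : ℂ | 0 < z.im} := by
  have hA : DifferentiableOn ℂ (fun w => (2 * Real.pi * Complex.I : ℂ)⁻¹ • Λ (cauchyKernel w))
      {w : ℂ | 0 < w.im} :=
    (Λ.differentiable.comp_differentiableOn (differentiableOn_cauchyKernel.mono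
      fun w (hw : 0 < w.im) => hw.ne')).const_smul _
  refine hA.congr fun w hw => ?_
  rw [poissonKer, map_smul, map_sub, h w hw, sub_zero]

variable {X : Type*} [NormedAddCommGroup X] [NormedSpace ℂ X]

/-- A Poisson integral is holomorphic iff its antiholomorphic part, the Cauchy integral
`z ↦ ∫ (t - z̄)⁻¹ dμ(t)`, vanishes. -/
theorem poissonH1_mem_holomorphicH1_iff (μ : BddMeasure (StrongDual ℂ X)) :
    poissonH1 μ ∈ HolomorphicH1 (StrongDual ℂ X) ↔ ∀ (z : ℂ), 0 < z.im →
      tensorDual (integralFunctional μ) (cauchyKernel (starRingEnd ℂ z)) = 0 := by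
  have h1 : Set.EqOn (poissonIntegral μ ∘ ofComplex)
      (fun w => tensorDual (integralFunctional μ) (poissonKer w)) {w : ℂ | 0 < w.im} := by
    intro w hw
    rw [Function.comp_apply, poissonIntegral_eq, ofComplex_apply_of_im_pos hw]
  change DifferentiableOn ℂ (poissonIntegral μ ∘ ofComplex) _ ↔ _
  rw [differentiableOn_congr h1]
  exact ⟨fun h z hz => cauchyKernel_conj_eq_zero h hz, differentiableOn_of_cauchyKernel_conj⟩

end Holomorphic


/-! ### Fourier transforms and Cauchy kernels -/

section Fourier

/-- The Cauchy kernel with pole `w̄` is a superposition of the characters `s ↦ exp(2πiξs)`, `ξ > 0`. -/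
theorem cauchyKernel_conj_eq_integral {w : ℂ} (hw : 0 < w.im) (s : ℝ) :
    cauchyKernel (starRingEnd ℂ w) s = -(2 * Real.pi * Complex.I) *
      ∫ ξ in Set.Ioi (0 : ℝ),
        Complex.exp (2 * Real.pi * Complex.I * ((s : ℂ) - starRingEnd ℂ w) * ξ) := by
  have hpi := Real.pi_pos
  have hre : (2 * Real.pi * Complex.I * ((s : ℂ) - starRingEnd ℂ w)).re < 0 := by
    have : (2 * Real.pi * Complex.I * ((s : ℂ) - starRingEnd ℂ w)).re = -(2 * Real.pi * w.im) := by
      simp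
    rw [this]
    have := mul_pos (mul_pos two_pos hpi) hw
    linarith
  have hc : (starRingEnd ℂ w).im ≠ 0 := by simpa using hw.ne'
  have h1 := ofReal_sub_ne_zero hc s
  have h2 := Complex.two_pi_I_ne_zero
  rw [integral_exp_mul_complex_Ioi hre, cauchyKernel_apply hc, Complex.ofReal_zero, mul_zero,
    Complex.exp_zero, mul_div_assoc', mul_neg, neg_mul, neg_neg, mul_one]
  rw [div_mul_cancel_left₀ h2]

theorem fourier_neg_eq {f : ℝ → ℂ} (ξ : ℝ) :
    𝓕 f (-ξ) = ∫ s : ℝ, f s * Complex.exp (2 * Real.pi * Complex.I * (s * ξ)) := by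
  rw [Real.fourier_real_eq_integral_exp_smul]
  refine integral_congr_ae (Eventually.of_forall fun s => ?_)
  change Complex.exp _ * f s = f s * _
  rw [mul_comm]
  congr 2
  push_cast
  ring

/-- An `f ∈ L¹(ℝ)` whose Fourier transform vanishes on `(-∞, 0]` is orthogonal to the Cauchy
kernels with poles in the lower half-plane, these being superpositions of the characters
`s ↦ exp(2πiξs)`, `ξ > 0`. -/
theorem integral_mul_cauchyKernel_eq_zero {f : ℝ → ℂ} (hf : Integrable f)
    (h : ∀ u ≤ 0, 𝓕 f u = 0) {w : ℂ} (hw : 0 < w.im) :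
    ∫ s, f s * cauchyKernel (starRingEnd ℂ w) s = 0 := by
  have hpi := Real.pi_pos
  let g : ℝ → ℝ → ℂ := fun s ξ =>
    f s * Complex.exp (2 * Real.pi * Complex.I * ((s : ℂ) - starRingEnd ℂ w) * ξ)
  have hexp : IntegrableOn (fun ξ : ℝ => Real.exp (-(2 * Real.pi * w.im) * ξ)) (Set.Ioi 0) :=
    integrableOn_exp_mul_Ioi (by have := mul_pos (mul_pos two_pos hpi) hw; linarith) 0
  have hg : Integrable (Function.uncurry g) (volume.prod (volume.restrict (Set.Ioi 0))) := by
    refine (hf.norm.mul_prod hexp).mono' ?_ (Eventually.of_forall fun p => le_of_eq ?_)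
    · refine hf.1.comp_fst.mul (Continuous.aestronglyMeasurable ?_)
      fun_prop
    · simp only [Function.uncurry, g, norm_mul, Complex.norm_exp]
      congr 2
      simp
  have e : ∀ s, f s * cauchyKernel (starRingEnd ℂ w) s =
      -(2 * Real.pi * Complex.I) * ∫ ξ in Set.Ioi (0 : ℝ), g s ξ := fun s => by
    rw [cauchyKernel_conj_eq_integral hw, integral_const_mul]
    ring
  simp_rw [e]
  rw [integral_const_mul, integral_integral_swap hg]
  refine mul_eq_zero_of_right _ (setIntegral_eq_zero_of_forall_eq_zero fun ξ hξ => ?_)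
  have e2 : ∀ s, g s ξ = Complex.exp (-(2 * Real.pi * Complex.I * starRingEnd ℂ w * ξ)) *
      (f s * Complex.exp (2 * Real.pi * Complex.I * (s * ξ))) := fun s => by
    simp only [g]
    rw [mul_left_comm, ← Complex.exp_add]
    congr 2
    ring
  simp_rw [e2]
  rw [integral_const_mul, ← fourier_neg_eq, h _ (by simpa using (Set.mem_Ioi.1 hξ).le), mul_zero]

/-- `G ∈ C₀(ℝ)` belongs to `H^∞(ℝ)`: it annihilates the Fourier transforms of the test functions
supported in `(-∞, 0)`. -/
def IsHardy (G : C₀(ℝ, ℂ)) : Prop :=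
  ∀ φ : 𝓢(ℝ, ℂ), tsupport φ ⊆ Set.Iio 0 → ∫ t, 𝓕 (φ : ℝ → ℂ) t * G t = 0

theorem hardyInfty_apply {g : Lp ℂ ∞ (volume : Measure ℝ)} {G : C₀(ℝ, ℂ)}
    (h : (g : ℝ → ℂ) =ᵐ[volume] G) : g ∈ hardyInfty ↔ IsHardy G := by
  refine forall_congr' fun φ => imp_congr_right fun _ => ?_
  rw [TemperedDistribution.fourier_apply, Lp.toTemperedDistribution_apply]
  refine Eq.congr_left (integral_congr_ae ?_)
  filter_upwards [h] with t ht
  rw [ht, SchwartzMap.fourier_coe]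
  rfl

theorem mem_Z0_iff (f : C₀(ℝ, ℂ)) : f ∈ Z0 ↔ IsHardy (reflect f) := by
  constructor
  · rintro ⟨g, hg, h⟩
    exact (hardyInfty_apply (G := reflect f) h).1 hg
  · intro h
    have hm : MemLp (reflect f) ∞ (volume : Measure ℝ) :=
      memLp_top_of_bound (map_continuous _).aestronglyMeasurable ‖reflect f‖
        (Eventually.of_forall (norm_apply_le _))
    exact ⟨hm.toLp _, (hardyInfty_apply hm.coeFn_toLp).2 h, hm.coeFn_toLp⟩

/-- The functions `t ↦ exp(2πiat) / (t - w̄)`, with `a ≥ 0` and `w` in the upper half-plane. -/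
def modulatedKernel (a : ℝ) (w : ℂ) : C₀(ℝ, ℂ) where
  toFun t := Complex.exp (2 * Real.pi * Complex.I * (t * a)) * cauchyKernel (starRingEnd ℂ w) t
  continuous_toFun := (by fun_prop : Continuous fun t : ℝ =>
    Complex.exp (2 * Real.pi * Complex.I * (t * a))).mul (map_continuous _)
  zero_at_infty' := by
    refine squeeze_zero_norm (fun t => le_of_eq ?_)
      (by simpa using (zero_at_infty (cauchyKernel (starRingEnd ℂ w))).norm)
    rw [norm_mul, Complex.norm_exp]
    simp

theorem modulatedKernel_apply (a : ℝ) (w : ℂ) (t : ℝ) : modulatedKernel a w t =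
    Complex.exp (2 * Real.pi * Complex.I * (t * a)) * cauchyKernel (starRingEnd ℂ w) t := rfl

theorem norm_exp_mul (t a : ℝ) : ‖Complex.exp (2 * Real.pi * Complex.I * (t * a))‖ = 1 := by
  rw [Complex.norm_exp]
  simp

/-- For a test function `φ` supported in `(-∞, 0)`, the product of `𝓕 φ` with the character belongs to
`H¹(ℝ)`, and is therefore orthogonal to the Cauchy kernel. -/
theorem isHardy_modulatedKernel {a : ℝ} (ha : 0 ≤ a) {w : ℂ} (hw : 0 < w.im) :
    IsHardy (modulatedKernel a w) := by
  intro φ hφ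
  let f : ℝ → ℂ := fun t => 𝓕 (φ : ℝ → ℂ) t * Complex.exp (2 * Real.pi * Complex.I * (t * a))
  have hφi : Integrable (𝓕 (φ : ℝ → ℂ)) := (𝓕 φ).integrable
  have hf : Integrable f := by
    refine hφi.norm.mono' (hφi.1.mul (Continuous.aestronglyMeasurable (by fun_prop)))
      (Eventually.of_forall fun t => ?_)
    rw [norm_mul, norm_exp_mul, mul_one]
  have h0 : ∀ u ≤ 0, 𝓕 f u = 0 := by
    intro u hu
    have h1 : 𝓕 f u = 𝓕⁻ (𝓕 (φ : ℝ → ℂ)) (a - u) := by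
      rw [← neg_neg u, fourier_neg_eq, Real.fourierInv_eq']
      refine integral_congr_ae (Eventually.of_forall fun t => ?_)
      simp only [f, smul_eq_mul, neg_neg]
      rw [mul_assoc, ← Complex.exp_add, mul_comm]
      congr 2
      simp
      ring
    have h2 : 𝓕⁻ (𝓕 (φ : ℝ → ℂ)) = φ := by
      have h : (𝓕⁻ (𝓕 φ : 𝓢(ℝ, ℂ)) : 𝓢(ℝ, ℂ)) = φ := FourierTransform.fourierInv_fourier_eq φ
      rw [← SchwartzMap.fourier_coe, ← SchwartzMap.fourierInv_coe, h]
    rw [h1, h2]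
    by_contra hne
    have := Set.mem_Iio.1 (hφ (subset_tsupport _ (Function.mem_support.2 hne)))
    linarith
  rw [← integral_mul_cauchyKernel_eq_zero hf h0 hw]
  refine integral_congr_ae (Eventually.of_forall fun t => ?_)
  simp only [f, modulatedKernel_apply, mul_assoc]

theorem isHardy_cauchyKernel {w : ℂ} (hw : 0 < w.im) :
    IsHardy (cauchyKernel (starRingEnd ℂ w)) := by
  have : modulatedKernel 0 w = cauchyKernel (starRingEnd ℂ w) := by
    ext t; simp [modulatedKernel_apply]
  rw [← this]
  exact isHardy_modulatedKernel le_rfl hw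

end Fourier


/-! ### The annihilator of `Z₀ ⊗ X` -/

section Annihilator

/-- A smooth probability density supported in `[c - ε, c + ε]`, with `ε = 1 / (n + 1)`. -/
def bump (n : ℕ) (c : ℝ) : 𝓢(ℝ, ℂ) :=
  let b : ContDiffBump (0 : ℝ) :=
    ⟨(n + 1 : ℝ)⁻¹ / 2, (n + 1 : ℝ)⁻¹, by positivity, half_lt_self (by positivity)⟩
  HasCompactSupport.toSchwartzMap (f := fun y => ((b.normed volume (y - c) : ℝ) : ℂ))
    ((b.hasCompactSupport_normed.comp_left Complex.ofReal_zero).comp_homeomorph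
      (Homeomorph.subRight c))
    (Complex.ofRealCLM.contDiff.comp (b.contDiff_normed.comp (contDiff_id.sub contDiff_const)))

theorem bump_apply (n : ℕ) (c y : ℝ) : bump n c y = bump n 0 (y - c) := by
  change ((_ : ℝ) : ℂ) = ((_ : ℝ) : ℂ)
  rw [sub_zero]

theorem tsupport_bump_subset (n : ℕ) (c : ℝ) :
    tsupport (bump n c) ⊆ Metric.closedBall c (n + 1 : ℝ)⁻¹ := by
  refine closure_minimal (fun y hy => ?_) Metric.isClosed_closedBall
  have h : (y - c) ∈ Function.support (ContDiffBump.normed (c := (0 : ℝ))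
      ⟨(n + 1 : ℝ)⁻¹ / 2, (n + 1 : ℝ)⁻¹, by positivity, half_lt_self (by positivity)⟩ volume) := by
    intro h0
    exact hy (congrArg Complex.ofReal h0)
  rw [ContDiffBump.support_normed_eq] at h
  refine Metric.ball_subset_closedBall ?_
  simpa [Real.dist_eq] using h

theorem exists_bump_eq_ofReal (n : ℕ) (c : ℝ) : ∃ b : ℝ → ℝ, (∀ y, 0 ≤ b y) ∧ Integrable b ∧
    ∫ y, b y = 1 ∧ ∀ y, bump n c y = b y := by
  let b : ContDiffBump (0 : ℝ) :=
    ⟨(n + 1 : ℝ)⁻¹ / 2, (n + 1 : ℝ)⁻¹, by positivity, half_lt_self (by positivity)⟩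
  refine ⟨fun y => b.normed volume (y - c), fun y => b.nonneg_normed _,
    (b.integrable_normed (μ := volume)).comp_sub_right c, ?_, fun y => rfl⟩
  rw [integral_sub_right_eq_self (fun y => b.normed volume y), b.integral_normed]

/-- Translation becomes modulation under the Fourier transform. -/
theorem fourier_bump_add (n : ℕ) (c d t : ℝ) : 𝓕 (bump n (c + d) : ℝ → ℂ) t =
    Complex.exp ((-2 * Real.pi * d * t : ℝ) * Complex.I) * 𝓕 (bump n c : ℝ → ℂ) t := by
  rw [Real.fourier_real_eq_integral_exp_smul, Real.fourier_real_eq_integral_exp_smul,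
    ← integral_const_mul, ← integral_add_right_eq_self _ d]
  refine integral_congr_ae (Eventually.of_forall fun y => ?_)
  simp only [smul_eq_mul]
  rw [bump_apply n (c + d), bump_apply n c, ← mul_assoc, ← Complex.exp_add]
  congr 2
  · push_cast; ring
  · ring

theorem norm_fourier_bump_le (n : ℕ) (c t : ℝ) : ‖𝓕 (bump n c : ℝ → ℂ) t‖ ≤ 1 := by
  obtain ⟨b, hb0, hbi, hb1, hb⟩ := exists_bump_eq_ofReal n c
  rw [Real.fourier_real_eq_integral_exp_smul, ← hb1]
  refine norm_integral_le_of_norm_le hbi (Eventually.of_forall fun y => le_of_eq ?_)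
  rw [norm_smul, Complex.norm_exp_ofReal_mul_I, one_mul, hb, Complex.norm_real,
    Real.norm_of_nonneg (hb0 y)]

/-- As the bumps concentrate at `0`, their Fourier transforms tend to `1`. -/
theorem norm_fourier_bump_sub_one_le (n : ℕ) (c t : ℝ) :
    ‖𝓕 (bump n c : ℝ → ℂ) t - 1‖ ≤ 2 * Real.pi * (|c| + (n + 1 : ℝ)⁻¹) * |t| := by
  obtain ⟨b, hb0, hbi, hb1, hb⟩ := exists_bump_eq_ofReal n c
  have hi : Integrable fun y : ℝ => (b y : ℂ) := hbi.ofReal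
  have hi2 : Integrable fun y : ℝ =>
      Complex.exp ((-2 * Real.pi * y * t : ℝ) * Complex.I) • (bump n c y) := by
    refine hi.norm.mono' (Continuous.aestronglyMeasurable ?_) (Eventually.of_forall fun y => ?_)
    · have := (bump n c).continuous
      fun_prop
    · rw [norm_smul, Complex.norm_exp_ofReal_mul_I, one_mul, hb]
  have e : 𝓕 (bump n c : ℝ → ℂ) t - 1 =
      ∫ y, (Complex.exp (Complex.I * ((-2 * Real.pi * y * t : ℝ) : ℂ)) - 1) * (b y : ℂ) := by
    rw [Real.fourier_real_eq_integral_exp_smul]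
    have h1 : (1 : ℂ) = ∫ y, (b y : ℂ) := by
      rw [integral_complex_ofReal, hb1, Complex.ofReal_one]
    conv_lhs => rw [h1]
    rw [← integral_sub hi2 hi]
    refine integral_congr_ae (Eventually.of_forall fun y => ?_)
    simp only [smul_eq_mul]
    rw [hb, sub_mul, one_mul, mul_comm Complex.I]
  rw [e]
  have h2 : ∫ y, b y * (2 * Real.pi * (|c| + (n + 1 : ℝ)⁻¹) * |t|) =
      2 * Real.pi * (|c| + (n + 1 : ℝ)⁻¹) * |t| := by rw [integral_mul_const, hb1, one_mul]
  rw [← h2]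
  refine norm_integral_le_of_norm_le (hbi.mul_const _) (Eventually.of_forall fun y => ?_)
  rw [norm_mul, Complex.norm_real, Real.norm_of_nonneg (hb0 y), mul_comm]
  by_cases hy : b y = 0
  · simp [hy]
  refine mul_le_mul_of_nonneg_left (Real.norm_exp_I_mul_ofReal_sub_one_le.trans ?_) (hb0 y)
  have hy' : y ∈ Metric.closedBall c (n + 1 : ℝ)⁻¹ :=
    tsupport_bump_subset n c (subset_tsupport _ (by simpa [hb] using hy))
  have h3 : |y| ≤ |c| + (n + 1 : ℝ)⁻¹ := by
    rw [Metric.mem_closedBall, Real.dist_eq] at hy'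
    have := abs_add_le (y - c) c
    rw [sub_add_cancel] at this
    linarith
  have hpi := Real.pi_pos
  rw [Real.norm_eq_abs, abs_mul, abs_mul, abs_mul, abs_neg, abs_two, abs_of_pos hpi]
  gcongr

/-- A function of `C₀(ℝ) ∩ H^∞(ℝ)` is a bounded pointwise limit of functions of `C₀(ℝ)` that
belong to `H¹(ℝ)`. -/
theorem IsHardy.exists_approx {G : C₀(ℝ, ℂ)} (hG : IsHardy G) : ∃ H : ℕ → C₀(ℝ, ℂ),
    (∀ n, Integrable (H n)) ∧ (∀ n, ∀ u : ℝ, u ≤ 0 → 𝓕 (H n : ℝ → ℂ) u = 0) ∧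
    (∀ n t, ‖H n t‖ ≤ ‖G‖) ∧ ∀ t, Tendsto (fun n => H n t) atTop (𝓝 (G t)) := by
  -- the centre is twice the radius to the left of `0`, so all translates by `u ≤ 0` stay in `(-∞, 0)`
  let c : ℕ → ℝ := fun n => -(2 * (n + 1 : ℝ)⁻¹)
  have hcont : ∀ n, Continuous (𝓕 (bump n (c n) : ℝ → ℂ)) := fun n => by
    rw [← SchwartzMap.fourier_coe]
    exact SchwartzMap.continuous _
  have hle : ∀ n t, ‖𝓕 (bump n (c n) : ℝ → ℂ) t * G t‖ ≤ ‖G t‖ := fun n t => by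
    rw [norm_mul]
    exact mul_le_of_le_one_left (norm_nonneg _) (norm_fourier_bump_le n (c n) t)
  let H : ℕ → C₀(ℝ, ℂ) := fun n =>
    { toFun := fun t => 𝓕 (bump n (c n) : ℝ → ℂ) t * G t
      continuous_toFun := (hcont n).mul (map_continuous G)
      zero_at_infty' := squeeze_zero_norm (hle n) (by simpa using (zero_at_infty G).norm) }
  refine ⟨H, fun n => ?_, fun n u hu => ?_, fun n t => (hle n t).trans (norm_apply_le G t),
    fun t => ?_⟩
  · have hi : Integrable (𝓕 (bump n (c n) : ℝ → ℂ)) := (𝓕 (bump n (c n))).integrable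
    exact hi.mul_bdd (c := ‖G‖) (map_continuous G).aestronglyMeasurable
      (Eventually.of_forall (norm_apply_le G))
  · rw [Real.fourier_real_eq_integral_exp_smul, ← hG (bump n (c n + u)) ?_]
    · refine integral_congr_ae (Eventually.of_forall fun t => ?_)
      change _ • (𝓕 (bump n (c n) : ℝ → ℂ) t * G t) = 𝓕 (bump n (c n + u) : ℝ → ℂ) t * G t
      rw [fourier_bump_add, smul_eq_mul]
      push_cast
      ring_nf
    · refine (tsupport_bump_subset n _).trans fun y hy => ?_
      rw [Metric.mem_closedBall, Real.dist_eq] at hy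
      have h1 := (abs_le.1 hy).2
      have h2 : (0 : ℝ) < (n + 1 : ℝ)⁻¹ := by positivity
      simp only [c] at h1
      rw [Set.mem_Iio]
      linarith
  · have h0 : Tendsto (fun n : ℕ => (n + 1 : ℝ)⁻¹) atTop (𝓝 0) := by
      simpa using tendsto_one_div_add_atTop_nhds_zero_nat (𝕜 := ℝ)
    have h1 : Tendsto (fun n : ℕ => 2 * Real.pi * (|c n| + (n + 1 : ℝ)⁻¹) * |t|) atTop (𝓝 0) := by
      have h2 : Tendsto c atTop (𝓝 0) := by simpa [c] using (h0.const_mul 2).neg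
      simpa using (((h2.abs.add h0).const_mul (2 * Real.pi)).mul_const |t|)
    have h3 : Tendsto (fun n => 𝓕 (bump n (c n) : ℝ → ℂ) t - 1) atTop (𝓝 0) :=
      squeeze_zero_norm (fun n => norm_fourier_bump_sub_one_le n (c n) t) h1
    have h4 := (h3.add_const 1).mul_const (G t)
    rw [zero_add, one_mul] at h4
    exact h4.congr fun n => by rw [sub_add_cancel]; rfl

/-- For `f ∈ H¹(ℝ)` the Cauchy integral `∫ f(s) (t - s - iv)⁻¹ ds` vanishes identically in `t`; this is
an identity in `C₀(ℝ)`, to which `Λ` is applied. -/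
theorem integral_smul_cauchyKernel_eq_zero {f : ℝ → ℂ} (hf : Integrable f)
    (h : ∀ u ≤ 0, 𝓕 f u = 0) {v : ℝ} (hv : 0 < v) (Λ : StrongDual ℂ C₀(ℝ, ℂ)) :
    ∫ s : ℝ, f s * Λ (cauchyKernel (s + v * Complex.I)) = 0 := by
  have hne : ∀ s : ℝ, ((s : ℂ) + v * Complex.I).im ≠ 0 := fun s => by simpa using hv.ne'
  have hc : Continuous fun s : ℝ => cauchyKernel (s + v * Complex.I) :=
    continuous_iff_continuousAt.2 fun s =>
      ContinuousAt.comp (f := fun s : ℝ => (s : ℂ) + v * Complex.I)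
        (continuousAt_cauchyKernel (hne s))
        (by fun_prop : Continuous fun s : ℝ => (s : ℂ) + v * Complex.I).continuousAt
  have hi : Integrable fun s : ℝ => f s • cauchyKernel (s + v * Complex.I) := by
    refine (hf.norm.mul_const v⁻¹).mono' (hf.1.smul hc.aestronglyMeasurable)
      (Eventually.of_forall fun s => ?_)
    rw [norm_smul]
    refine mul_le_mul_of_nonneg_left ((norm_cauchyKernel_le (hne s)).trans ?_) (norm_nonneg _)
    simp [abs_of_pos hv]
  have h0 : ∫ s : ℝ, f s • cauchyKernel (s + v * Complex.I) = 0 := by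
    ext t
    rw [← evalAt_apply, ← (evalAt t).integral_comp_comm hi]
    have h1 := integral_mul_cauchyKernel_eq_zero hf h (w := t + v * Complex.I) (by simpa using hv)
    change _ = (0 : ℂ)
    rw [← neg_zero, ← h1, ← integral_neg]
    refine integral_congr_ae (Eventually.of_forall fun s => ?_)
    change f s * cauchyKernel (s + v * Complex.I) t = - _
    rw [cauchyKernel_apply (hne s), cauchyKernel_apply (by simpa using hv.ne'), ← mul_neg,
      ← inv_neg]
    congr 2
    simp
    ring
  have h2 := Λ.integral_comp_comm hi
  rw [h0, map_zero] at h2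
  rw [← h2]
  refine integral_congr_ae (Eventually.of_forall fun s => ?_)
  change _ = Λ (f s • _)
  rw [map_smul, smul_eq_mul]

/-- The Cauchy kernels with poles in the lower half-plane span a weak-star dense subspace of the
functions of `C₀(ℝ) ∩ H^∞(ℝ)`. -/
theorem IsHardy.apply_eq_zero {Λ : StrongDual ℂ C₀(ℝ, ℂ)}
    (h : ∀ z : ℂ, 0 < z.im → Λ (cauchyKernel (starRingEnd ℂ z)) = 0)
    {G : C₀(ℝ, ℂ)} (hG : IsHardy G) : Λ G = 0 := by
  obtain ⟨H, hi, hF, hb, hlim⟩ := hG.exists_approx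
  have h1 : ∀ n, Λ (H n) = 0 := by
    intro n
    have h2 : ∀ v > 0, Λ (poissonConv (H n) v) = 0 := by
      intro v hv
      rw [poissonConv_eq_integral hv (hi n),
        ← Λ.integral_comp_comm (integrable_smul_poissonKer hv (hi n))]
      have h3 := integral_smul_cauchyKernel_eq_zero (hi n) (hF n) hv Λ
      rw [← mul_zero ((2 * Real.pi * Complex.I)⁻¹ : ℂ), ← h3, ← integral_const_mul]
      refine integral_congr_ae (Eventually.of_forall fun s => ?_)
      change Λ (_ • poissonKer _) = _
      rw [poissonKer, map_smul, map_smul, map_sub, h _ (by simpa using hv), sub_zero, smul_eq_mul,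
        smul_eq_mul, mul_left_comm]
    have h3 : Tendsto (fun v => Λ (poissonConv (H n) v)) (𝓝[>] 0) (𝓝 (Λ (H n))) := by
      have := ((Λ.continuous.comp (continuous_poissonConv (H n))).tendsto 0)
      rw [Function.comp_apply, poissonConv_zero] at this
      exact this.mono_left nhdsWithin_le_nhds
    refine tendsto_nhds_unique h3 (tendsto_const_nhds.congr' ?_)
    filter_upwards [self_mem_nhdsWithin] with v hv
    exact (h2 v hv).symm
  refine tendsto_nhds_unique (tendsto_of_tendsto_pointwise Λ hb hlim)
    (tendsto_const_nhds.congr fun n => (h1 n).symm)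

variable {X : Type*} [NormedAddCommGroup X] [NormedSpace ℂ X]

/-- The annihilator of `Z₀ ⊗ X` corresponds to `𝐇¹(P₊; X*)`: both conditions say that the measure kills
the Cauchy kernels with poles in the lower half-plane. -/
theorem dualEquiv_mem_annihilator_iff (μ : BddMeasure (StrongDual ℂ X)) :
    dualEquiv X μ ∈ annihilator (Z0Tensor X) ↔ poissonH1 μ ∈ HolomorphicH1 (StrongDual ℂ X) := by
  rw [poissonH1_mem_holomorphicH1_iff]
  constructor
  · intro h z hz
    ext x
    have h1 : reflect (cauchyKernel (starRingEnd ℂ z)) ∈ Z0 := by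
      rw [mem_Z0_iff, reflect_reflect]
      exact isHardy_cauchyKernel hz
    have h2 := h _ (Submodule.subset_span ⟨_, h1, x, rfl⟩)
    rw [dualEquiv_apply, reflect_tensor, reflect_reflect] at h2
    exact h2
  · intro h F hF
    have h1 : Z0Tensor X ≤ LinearMap.ker (dualEquiv X μ : C₀(ℝ, X) →L[ℂ] ℂ).toLinearMap := by
      refine Submodule.span_le.2 ?_
      rintro _ ⟨f, hf, x, rfl⟩
      let Λ : StrongDual ℂ C₀(ℝ, ℂ) :=
        (ContinuousLinearMap.apply ℂ ℂ x).comp (tensorDual (integralFunctional μ))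
      have h2 : Λ (reflect f) = 0 := IsHardy.apply_eq_zero (Λ := Λ)
        (fun z hz => congrArg (fun A => A x) (h z hz)) ((mem_Z0_iff f).1 hf)
      exact h2
    exact h1 hF

end Annihilator


/-! ### The theorem of F. and M. Riesz -/

section RieszBrothers

/-- The functional `Λ` on `C₀(ℝ)` vanishes on the Cauchy kernels with poles in the lower
half-plane. -/
def KillsCauchy (Λ : StrongDual ℂ C₀(ℝ, ℂ)) : Prop :=
  ∀ z : ℂ, 0 < z.im → Λ (cauchyKernel (starRingEnd ℂ z)) = 0

/-- By the resolvent identity, a functional which kills the Cauchy kernels kills their products. -/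
theorem KillsCauchy.mul_apply {Λ : StrongDual ℂ C₀(ℝ, ℂ)} (h : KillsCauchy Λ) {z w : ℂ}
    (hz : 0 < z.im) (hw : 0 < w.im) :
    Λ (cauchyKernel (starRingEnd ℂ z) * cauchyKernel (starRingEnd ℂ w)) = 0 := by
  have him : ∀ {z : ℂ}, 0 < z.im → (starRingEnd ℂ z).im ≠ 0 := fun hz => by simpa using hz.ne'
  have key : ∀ w : ℂ, 0 < w.im → w ≠ z →
      Λ (cauchyKernel (starRingEnd ℂ z) * cauchyKernel (starRingEnd ℂ w)) = 0 := by
    intro w hw hne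
    have h1 := congrArg Λ (cauchyKernel_sub (him hz) (him hw))
    rw [map_sub, h z hz, h w hw, sub_zero, map_smul, smul_eq_mul] at h1
    refine (mul_eq_zero.1 h1.symm).resolve_left (sub_ne_zero.2 fun h2 => hne ?_)
    exact ((starRingEnd ℂ).injective h2).symm
  by_cases hne : w = z
  · subst hne
    -- the diagonal case follows from the resolvent identity by continuity
    have hc : ContinuousAt (fun y : ℂ =>
        Λ (cauchyKernel (starRingEnd ℂ w) * cauchyKernel (starRingEnd ℂ y))) w := by
      refine Λ.continuous.continuousAt.comp (continuousAt_const.mul ?_)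
      exact ContinuousAt.comp (f := starRingEnd ℂ) (continuousAt_cauchyKernel (him hw))
        Complex.continuous_conj.continuousAt
    have h2 : ∀ᶠ y in 𝓝[≠] w, Λ (cauchyKernel (starRingEnd ℂ w) *
        cauchyKernel (starRingEnd ℂ y)) = 0 := by
      have h3 : ∀ᶠ y in 𝓝[≠] w, 0 < y.im :=
        nhdsWithin_le_nhds ((isOpen_lt continuous_const Complex.continuous_im).mem_nhds hw)
      filter_upwards [h3, self_mem_nhdsWithin] with y hy hne
      exact key y hy hne
    exact tendsto_nhds_unique (hc.tendsto.mono_left nhdsWithin_le_nhds)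
      (tendsto_const_nhds.congr' (h2.mono fun y hy => hy.symm))
  · exact key w hw hne

/-- The superposition `t ↦ ∫_U i / (t - s + ir) ds` of Cauchy kernels. -/
def cauchySuper (U : Set ℝ) (r : ℝ) : C₀(ℝ, ℂ) :=
  ∫ s in U, Complex.I • cauchyKernel (starRingEnd ℂ (s + r * Complex.I))

variable {U : Set ℝ} {r : ℝ}

theorem integrableOn_cauchySuper (hU : volume U ≠ ∞) (hr : 0 < r) : IntegrableOn
    (fun s : ℝ => Complex.I • cauchyKernel (starRingEnd ℂ (s + r * Complex.I))) U := by
  have hne : ∀ s : ℝ, (starRingEnd ℂ (s + r * Complex.I)).im ≠ 0 := fun s => by simpa using hr.ne'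
  have hc : Continuous fun s : ℝ => cauchyKernel (starRingEnd ℂ (s + r * Complex.I)) :=
    continuous_iff_continuousAt.2 fun s =>
      ContinuousAt.comp (f := fun s : ℝ => starRingEnd ℂ ((s : ℂ) + r * Complex.I))
        (continuousAt_cauchyKernel (hne s)) (Complex.continuous_conj.comp
        (by fun_prop : Continuous fun s : ℝ => (s : ℂ) + r * Complex.I)).continuousAt
  refine Measure.integrableOn_of_bounded (M := r⁻¹) hU (hc.const_smul Complex.I).aestronglyMeasurable
    (Eventually.of_forall fun s => ?_)
  rw [norm_smul, Complex.norm_I, one_mul]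
  refine (norm_cauchyKernel_le (hne s)).trans ?_
  simp [abs_of_pos hr]

theorem cauchySuper_apply (hU : volume U ≠ ∞) (hr : 0 < r) (t : ℝ) :
    cauchySuper U r t = ∫ s in U, Complex.I * ((t - s : ℝ) + r * Complex.I)⁻¹ := by
  rw [cauchySuper, ← evalAt_apply, ← (evalAt t).integral_comp_comm (integrableOn_cauchySuper hU hr)]
  refine integral_congr_ae (Eventually.of_forall fun s => ?_)
  change Complex.I * cauchyKernel _ t = _
  rw [cauchyKernel_apply (by simpa using hr.ne')]
  congr 2
  simp
  ring

theorem re_I_mul_inv (r x : ℝ) :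
    (Complex.I * ((x : ℝ) + r * Complex.I)⁻¹).re = r * (x ^ 2 + r ^ 2)⁻¹ := by
  rw [Complex.mul_re, Complex.inv_re, Complex.inv_im]
  simp [Complex.normSq_apply]
  rw [sq, sq, neg_div, neg_neg, div_eq_mul_inv]

theorem norm_I_mul_inv_le (r : ℝ) {x d : ℝ} (hd : 0 < d) (hx : d ≤ |x|) :
    ‖Complex.I * ((x : ℝ) + r * Complex.I)⁻¹‖ ≤ d⁻¹ := by
  rw [norm_mul, Complex.norm_I, one_mul, norm_inv]
  refine inv_anti₀ hd (hx.trans ?_)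
  simpa using Complex.abs_re_le_norm ((x : ℂ) + r * Complex.I)

theorem integrableOn_cauchySuper_apply (hU : volume U ≠ ∞) (hr : 0 < r) (t : ℝ) :
    IntegrableOn (fun s : ℝ => Complex.I * ((t - s : ℝ) + r * Complex.I)⁻¹) U := by
  refine ((evalAt t).integrable_comp (integrableOn_cauchySuper hU hr)).congr
    (Eventually.of_forall fun s => ?_)
  change Complex.I * cauchyKernel _ t = _
  rw [cauchyKernel_apply (by simpa using hr.ne')]
  congr 2
  simp
  ring

theorem re_cauchySuper (hU : volume U ≠ ∞) (hr : 0 < r) (t : ℝ) :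
    (cauchySuper U r t).re = ∫ s in U, r * ((t - s) ^ 2 + r ^ 2)⁻¹ := by
  rw [cauchySuper_apply hU hr, ← Complex.reCLM_apply,
    ← Complex.reCLM.integral_comp_comm (integrableOn_cauchySuper_apply hU hr t)]
  refine integral_congr_ae (Eventually.of_forall fun s => ?_)
  exact re_I_mul_inv r (t - s)

theorem re_cauchySuper_nonneg (hU : volume U ≠ ∞) (hr : 0 < r) (t : ℝ) :
    0 ≤ (cauchySuper U r t).re := by
  rw [re_cauchySuper hU hr]
  exact integral_nonneg fun s => by positivity

/-- On the interval of radius `r` about `t` the integrand is at least `(2r)⁻¹`. -/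
theorem one_le_re_cauchySuper (hU : volume U ≠ ∞) (hr : 0 < r) {t : ℝ}
    (ht : Set.Icc (t - r) (t + r) ⊆ U) : 1 ≤ (cauchySuper U r t).re := by
  have hi : IntegrableOn (fun s : ℝ => r * ((t - s) ^ 2 + r ^ 2)⁻¹) U :=
    (integrableOn_cauchySuper_apply hU hr t).re.congr
      (Eventually.of_forall fun s => re_I_mul_inv r (t - s))
  rw [re_cauchySuper hU hr]
  calc (1 : ℝ) = ∫ s in Set.Icc (t - r) (t + r), (2 * r)⁻¹ := by
        rw [setIntegral_const, measureReal_def, Real.volume_Icc,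
          ENNReal.toReal_ofReal (by linarith), smul_eq_mul]
        field_simp
        ring
    _ ≤ ∫ s in Set.Icc (t - r) (t + r), r * ((t - s) ^ 2 + r ^ 2)⁻¹ := by
        refine setIntegral_mono_on (integrableOn_const (by simp) enorm_ne_top) (hi.mono_set ht)
          measurableSet_Icc fun s hs => ?_
        have h1 : (t - s) ^ 2 ≤ r ^ 2 := sq_le_sq' (by linarith [hs.2]) (by linarith [hs.1])
        have h2 : (2 * r)⁻¹ = r * (2 * r ^ 2)⁻¹ := by field_simp
        rw [h2]
        gcongr
        linarith
    _ ≤ _ := setIntegral_mono_set hi (Eventually.of_forall fun s => by positivity)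
        ht.eventuallyLE

theorem norm_cauchySuper_le (hU : volume U ≠ ∞) (hr : 0 < r) {t d : ℝ}
    (hd : 0 < d) (h : ∀ s ∈ U, d ≤ |t - s|) : ‖cauchySuper U r t‖ ≤ d⁻¹ * volume.real U := by
  rw [cauchySuper_apply hU hr]
  exact norm_setIntegral_le_of_norm_le_const hU.lt_top fun s hs =>
    norm_I_mul_inv_le r hd (h s hs)

theorem KillsCauchy.apply_cauchySuper {Λ : StrongDual ℂ C₀(ℝ, ℂ)} (h : KillsCauchy Λ)
    (hU : volume U ≠ ∞) (hr : 0 < r) : Λ (cauchySuper U r) = 0 := by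
  rw [cauchySuper, ← Λ.integral_comp_comm (integrableOn_cauchySuper hU hr)]
  refine integral_eq_zero_of_ae (Eventually.of_forall fun s => ?_)
  change Λ (_ • _) = 0
  rw [map_smul, h _ (by simpa using hr), smul_zero]

/-- The property passes to `p ↦ Λ (g p)`, for a superposition `g` of Cauchy kernels; by induction `Λ`
kills the powers of `g`. -/
theorem KillsCauchy.comp_mul {Λ : StrongDual ℂ C₀(ℝ, ℂ)} (h : KillsCauchy Λ)
    (hU : volume U ≠ ∞) (hr : 0 < r) :
    KillsCauchy (Λ.comp (ContinuousLinearMap.mul ℂ C₀(ℝ, ℂ) (cauchySuper U r))) := by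
  intro z hz
  let Λ' : StrongDual ℂ C₀(ℝ, ℂ) :=
    Λ.comp ((ContinuousLinearMap.mul ℂ C₀(ℝ, ℂ)).flip (cauchyKernel (starRingEnd ℂ z)))
  exact KillsCauchy.apply_cauchySuper (Λ := Λ') (fun w hw => h.mul_apply hw hz) hU hr

theorem KillsCauchy.apply_iterate (hU : volume U ≠ ∞) (hr : 0 < r) (k : ℕ) :
    ∀ {Λ : StrongDual ℂ C₀(ℝ, ℂ)}, KillsCauchy Λ →
      Λ ((fun p => cauchySuper U r * p)^[k] (cauchySuper U r)) = 0 := by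
  induction k with
  | zero => exact fun h => h.apply_cauchySuper hU hr
  | succ k ih =>
    intro Λ h
    rw [Function.iterate_succ_apply']
    exact ih (h.comp_mul hU hr)

theorem iterate_mul_apply (g : C₀(ℝ, ℂ)) (k : ℕ) (t : ℝ) :
    (fun p => g * p)^[k] g t = g t ^ (k + 1) := by
  induction k with
  | zero => simp
  | succ k ih => rw [Function.iterate_succ_apply', ZeroAtInftyContinuousMap.mul_apply, ih, pow_succ' _ (k + 1)]

/-- The function `exp(c g) - 1`. -/
def expSubOne (c : ℂ) (g : C₀(ℝ, ℂ)) : C₀(ℝ, ℂ) where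
  toFun t := Complex.exp (c * g t) - 1
  continuous_toFun := by
    have := map_continuous g
    fun_prop
  zero_at_infty' := by
    have h := ((zero_at_infty g).const_mul c).cexp.sub_const 1
    simpa using h

/-- The partial sums of the exponential series are polynomials in `g` without constant term. -/
theorem apply_expSubOne_eq_zero {Λ : StrongDual ℂ C₀(ℝ, ℂ)} {g : C₀(ℝ, ℂ)}
    (h : ∀ k, Λ ((fun p => g * p)^[k] g) = 0) (c : ℂ) : Λ (expSubOne c g) = 0 := by
  let a : ℕ → ℂ := fun k => c ^ (k + 1) / (k + 1).factorial
  let F : ℕ → C₀(ℝ, ℂ) := fun n => ∑ k ∈ Finset.range n, a k • (fun p => g * p)^[k] g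
  have hF : ∀ n t, F n t = ∑ k ∈ Finset.range n, (c * g t) ^ (k + 1) / (k + 1).factorial := by
    intro n t
    rw [← evalAt_apply, map_sum]
    refine Finset.sum_congr rfl fun k _ => ?_
    rw [map_smul, evalAt_apply, iterate_mul_apply, smul_eq_mul, mul_pow]
    ring
  have h0 : ∀ n, Λ (F n) = 0 := fun n => by
    rw [map_sum]
    exact Finset.sum_eq_zero fun k _ => by rw [map_smul, h, smul_zero]
  refine tendsto_nhds_unique (tendsto_of_tendsto_pointwise Λ (F := F)
    (C := Real.exp (‖c‖ * ‖g‖)) (fun n t => ?_) (fun t => ?_))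
    (tendsto_const_nhds.congr fun n => (h0 n).symm)
  · rw [hF]
    calc _ ≤ ∑ k ∈ Finset.range n, (‖c‖ * ‖g‖) ^ (k + 1) / (k + 1).factorial := by
          refine norm_sum_le_of_le _ fun k _ => ?_
          rw [norm_div, norm_pow, norm_mul, Complex.norm_natCast]
          gcongr
          exact norm_apply_le g t
      _ ≤ ∑ k ∈ Finset.range (n + 1), (‖c‖ * ‖g‖) ^ k / k.factorial := by
          rw [Finset.sum_range_succ']
          simp
      _ ≤ _ := Real.sum_le_exp_of_nonneg (by positivity) _
  · have h1 := NormedSpace.expSeries_div_hasSum_exp (c * g t)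
    rw [← Complex.exp_eq_exp_ℂ, ← hasSum_nat_add_iff' 1] at h1
    simp only [Finset.sum_range_one, pow_zero, Nat.factorial_zero, Nat.cast_one, div_one] at h1
    exact h1.tendsto_sum_nat.congr fun n => (hF n t).symm

/-- The indicator function of a compact null set `K` is a bounded pointwise limit of functions
`1 - exp(-n g)`, where `g` is a superposition of Cauchy kernels with poles close to `K` whose real
part is nonnegative, and at least `1` on `K`. -/
theorem exists_tendsto_indicator {K : Set ℝ} (hK : IsCompact K) (h0 : volume K = 0) :
    ∃ ψ : ℕ → C₀(ℝ, ℂ), (∀ n t, ‖ψ n t‖ ≤ 2) ∧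
      (∀ t, Tendsto (fun n => ψ n t) atTop (𝓝 (K.indicator (fun _ => (1 : ℂ)) t))) ∧
      ∀ Λ, KillsCauchy Λ → ∀ n, Λ (ψ n) = 0 := by
  -- the measure of the `r`-neighbourhood is quadratically small, so that `n g` still tends to `0`
  -- off `K`
  have hr : ∀ n : ℕ, ∃ r : ℝ, 0 < r ∧ r < (n + 1 : ℝ)⁻¹ ∧
      volume (Metric.cthickening r K) < ENNReal.ofReal ((n + 1 : ℝ)⁻¹ ^ 2) := by
    intro n
    have h1 := tendsto_measure_cthickening_of_isCompact (μ := volume) hK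
    rw [h0] at h1
    have hn : (0 : ℝ) < (n + 1 : ℝ)⁻¹ := by positivity
    have h2 := h1.eventually (gt_mem_nhds (ENNReal.ofReal_pos.2 (pow_pos hn 2)))
    have h3 : ∀ᶠ r in 𝓝[>] (0 : ℝ), 0 < r ∧ r < (n + 1 : ℝ)⁻¹ ∧
        volume (Metric.cthickening r K) < ENNReal.ofReal ((n + 1 : ℝ)⁻¹ ^ 2) := by
      filter_upwards [self_mem_nhdsWithin, nhdsWithin_le_nhds (gt_mem_nhds hn),
        nhdsWithin_le_nhds h2] with r a b c using ⟨a, b, c⟩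
    exact h3.exists
  choose r hr0 hr1 hrv using hr
  have hU : ∀ n, volume (Metric.cthickening (r n) K) ≠ ∞ := fun n => (hrv n).ne_top
  let g : ℕ → C₀(ℝ, ℂ) := fun n => cauchySuper (Metric.cthickening (r n) K) (r n)
  have hg0 : ∀ n t, 0 ≤ (g n t).re := fun n t => re_cauchySuper_nonneg (hU n) (hr0 n) t
  have hinv : Tendsto (fun n : ℕ => (n + 1 : ℝ)⁻¹) atTop (𝓝 0) := by
    simpa using tendsto_one_div_add_atTop_nhds_zero_nat (𝕜 := ℝ)
  have hnorm : ∀ (n : ℕ) t, ‖Complex.exp (-(n + 1 : ℝ) * g n t)‖ =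
      Real.exp (-((n + 1 : ℝ) * (g n t).re)) := fun n t => by
    rw [Complex.norm_exp, ← Complex.ofReal_neg, Complex.re_ofReal_mul, neg_mul]
  refine ⟨fun n => -expSubOne (-(n + 1 : ℝ)) (g n), fun n t => ?_, fun t => ?_, fun Λ h n => ?_⟩
  · change ‖-(Complex.exp _ - 1)‖ ≤ 2
    rw [norm_neg]
    refine (norm_sub_le _ _).trans ?_
    rw [norm_one, hnorm]
    have : Real.exp (-((n + 1 : ℝ) * (g n t).re)) ≤ 1 :=
      Real.exp_le_one_iff.2 (neg_nonpos.2 (mul_nonneg (by positivity) (hg0 n t)))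
    linarith
  · change Tendsto (fun n : ℕ => -(Complex.exp (-((n + 1 : ℝ) : ℂ) * g n t) - 1)) atTop _
    by_cases ht : t ∈ K
    · rw [Set.indicator_of_mem ht]
      have h1 : Tendsto (fun n : ℕ => Complex.exp (-((n + 1 : ℝ) : ℂ) * g n t)) atTop (𝓝 0) := by
        refine squeeze_zero_norm (a := fun n : ℕ => Real.exp (-(n : ℝ))) (fun n => ?_)
          (Real.tendsto_exp_neg_atTop_nhds_zero.comp tendsto_natCast_atTop_atTop)
        rw [hnorm]
        refine Real.exp_le_exp.2 (neg_le_neg ?_)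
        have h2 : 1 ≤ (g n t).re := one_le_re_cauchySuper (hU n) (hr0 n) (by
          rw [← Real.closedBall_eq_Icc]
          exact Metric.closedBall_subset_cthickening ht _)
        have h3 : (0 : ℝ) ≤ n := Nat.cast_nonneg n
        nlinarith
      simpa using (h1.sub_const 1).neg
    · rw [Set.indicator_of_notMem ht]
      obtain ⟨d, hd, hdK⟩ := Metric.isOpen_iff.1 hK.isClosed.isOpen_compl t ht
      have h1 : Tendsto (fun n : ℕ => -((n + 1 : ℝ) : ℂ) * g n t) atTop (𝓝 0) := by
        refine squeeze_zero_norm' (a := fun n : ℕ => (d / 2)⁻¹ * (n + 1 : ℝ)⁻¹) ?_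
          (by simpa using hinv.const_mul (d / 2)⁻¹)
        filter_upwards [hinv.eventually (gt_mem_nhds (half_pos hd))] with n hn
        have h2 : ∀ s ∈ Metric.cthickening (r n) K, d / 2 ≤ |t - s| := by
          intro s hs
          rw [hK.cthickening_eq_biUnion_closedBall (hr0 n).le] at hs
          obtain ⟨x, hx, hsx⟩ := Set.mem_iUnion₂.1 hs
          rw [Metric.mem_closedBall, Real.dist_eq] at hsx
          have h3 : d ≤ |x - t| := by
            by_contra hlt
            exact hdK (Metric.mem_ball.2 (not_le.1 hlt)) hx
          have h4 := abs_sub_le x s t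
          have h5 := hr1 n
          rw [abs_sub_comm t s]
          rw [abs_sub_comm s x] at hsx
          linarith
        have h6 := norm_cauchySuper_le (hU n) (hr0 n) (half_pos hd) h2
        have h7 : volume.real (Metric.cthickening (r n) K) ≤ (n + 1 : ℝ)⁻¹ ^ 2 :=
          ENNReal.toReal_le_of_le_ofReal (by positivity) (hrv n).le
        have hn0 : (0 : ℝ) < n + 1 := by positivity
        rw [norm_mul, norm_neg, Complex.norm_real, Real.norm_of_nonneg hn0.le]
        calc (n + 1 : ℝ) * ‖g n t‖ ≤ (n + 1) * ((d / 2)⁻¹ * (n + 1 : ℝ)⁻¹ ^ 2) := by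
              refine mul_le_mul_of_nonneg_left (h6.trans ?_) hn0.le
              gcongr
          _ = (d / 2)⁻¹ * (n + 1 : ℝ)⁻¹ := by field_simp
      simpa using (h1.cexp.sub_const 1).neg
  · rw [map_neg, apply_expSubOne_eq_zero fun k => KillsCauchy.apply_iterate (hU n) (hr0 n) k h,
      neg_zero]

variable {X : Type*} [NormedAddCommGroup X] [NormedSpace ℂ X]

/-- The theorem of F. and M. Riesz: an analytic measure is absolutely continuous. -/
theorem variation_absolutelyContinuous {μ : BddMeasure (StrongDual ℂ X)}
    (h : ∀ z : ℂ, 0 < z.im →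
      tensorDual (integralFunctional μ) (cauchyKernel (starRingEnd ℂ z)) = 0) :
    μ.toVM.variation ≪ volume := by
  have hcompact : ∀ K : Set ℝ, IsCompact K → volume K = 0 → μ.toVM K = 0 := by
    intro K hK h0
    ext x
    obtain ⟨ψ, hb, hlim, hψ⟩ := exists_tendsto_indicator hK h0
    let Λ : StrongDual ℂ C₀(ℝ, ℂ) :=
      (ContinuousLinearMap.apply ℂ ℂ x).comp (tensorDual (integralFunctional μ))
    have h1 : ∀ n, Λ (ψ n) = 0 := hψ Λ fun z hz => congrArg (fun A => A x) (h z hz)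
    have h2 : ∀ n, Λ (ψ n) = ∫ᵛ t, ψ n t ∂[ContinuousLinearMap.mul ℝ ℂ; evalMeasure μ x] :=
      fun n => integralFunctional_tensor μ (ψ n) x
    have h3 := VectorMeasure.tendsto_integral_filter_of_norm_le_const
      (μ := evalMeasure μ x) (B := ContinuousLinearMap.mul ℝ ℂ) (l := atTop)
      (Eventually.of_forall fun n => (map_continuous (ψ n)).aestronglyMeasurable)
      ⟨2, Eventually.of_forall fun n => Eventually.of_forall (hb n)⟩ (Eventually.of_forall hlim)
    rw [VectorMeasure.integral_indicator_const _ hK.measurableSet] at h3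
    have h4 := tendsto_nhds_unique h3 (tendsto_const_nhds.congr fun n => ((h2 n).symm.trans (h1 n)).symm)
    rw [ContinuousLinearMap.mul_apply', one_mul] at h4
    exact h4
  have hnull : ∀ E : Set ℝ, MeasurableSet E → volume E = 0 → μ.toVM E = 0 := by
    intro E hE h0
    refine norm_le_zero_iff.1 (le_of_forall_pos_le_add fun ε hε => ?_)
    obtain ⟨K, hKE, hK, hlt⟩ := hE.exists_isCompact_sdiff_lt (μ := μ.toVM.variation)
      (measure_ne_top _ _) (ENNReal.ofReal_pos.2 hε).ne'
    have h1 : μ.toVM E = μ.toVM K + μ.toVM (E \ K) :=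
      (VectorMeasure.of_add_of_sdiff hK.measurableSet hE hKE).symm
    rw [h1, hcompact K hK (measure_mono_null hKE h0), zero_add, zero_add]
    exact (VectorMeasure.norm_measure_le_variation (measure_ne_top _ _)).trans
      (ENNReal.toReal_le_of_le_ofReal hε.le hlt.le)
  refine Measure.AbsolutelyContinuous.mk fun E hE h0 => ?_
  rw [VectorMeasure.variation_apply_eq_zero hE]
  exact fun t hts ht => hnull t ht (measure_mono_null hts h0)

end RieszBrothers


/-! ### Densities of absolutely continuous measures -/

section Density

theorem exists_density_complex {ν : VectorMeasure ℝ ℂ} (h : ν.variation ≪ volume) :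
    ∃ f : ℝ → ℂ, Integrable f ∧ ν = volume.withDensityᵥ f := by
  let c : ComplexMeasure ℝ := ν
  have hac : ∀ s, MeasurableSet s → volume s = 0 → ν s = 0 := fun s _ h0 => by
    have := VectorMeasure.enorm_measure_le_variation ν s
    rw [h h0, nonpos_iff_eq_zero, enorm_eq_zero] at this
    exact this
  have h1 : c ≪ᵥ (volume : Measure ℝ).toENNRealVectorMeasure := by
    refine VectorMeasure.AbsolutelyContinuous.mk fun s hs h0 => ?_
    rw [Measure.toENNRealVectorMeasure_apply_measurable hs] at h0
    exact hac s hs h0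
  rw [ComplexMeasure.absolutelyContinuous_ennreal_iff] at h1
  have hre := SignedMeasure.withDensityᵥ_rnDeriv_eq _ _ h1.1
  have him := SignedMeasure.withDensityᵥ_rnDeriv_eq _ _ h1.2
  have hi := c.integrable_rnDeriv volume
  refine ⟨c.rnDeriv volume, hi, VectorMeasure.ext fun s hs => ?_⟩
  rw [withDensityᵥ_apply hi hs]
  refine Complex.ext ?_ ?_
  · rw [← Complex.reCLM_apply (∫ x in s, _), ← Complex.reCLM.integral_comp_comm hi.integrableOn]
    have : volume.withDensityᵥ (c.re.rnDeriv volume) s = c.re s := by rw [hre]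
    rw [withDensityᵥ_apply (SignedMeasure.integrable_rnDeriv _ _) hs] at this
    exact this.symm
  · rw [← Complex.imCLM_apply (∫ x in s, _), ← Complex.imCLM.integral_comp_comm hi.integrableOn]
    have : volume.withDensityᵥ (c.im.rnDeriv volume) s = c.im s := by rw [him]
    rw [withDensityᵥ_apply (SignedMeasure.integrable_rnDeriv _ _) hs] at this
    exact this.symm

variable {X ι : Type*} [NormedAddCommGroup X] [NormedSpace ℂ X]

/-- The finite-rank operator `∑_{k ∈ s} φ_k ⊗ x_k`. -/
def compression (x : ι → X) (φ : ι → StrongDual ℂ X) (s : Finset ι) : X →L[ℂ] X :=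
  ∑ k ∈ s, (φ k).smulRight (x k)

theorem compression_apply (x : ι → X) (φ : ι → StrongDual ℂ X) (s : Finset ι) (y : X) :
    compression x φ s y = ∑ k ∈ s, φ k y • x k := by
  simp [compression]

theorem dualMap_compression (x : ι → X) (φ : ι → StrongDual ℂ X) (s : Finset ι)
    (ξ : StrongDual ℂ X) : dualMap (compression x φ s) ξ = ∑ k ∈ s, ξ (x k) • φ k := by
  ext y
  rw [dualMap_apply, compression_apply, map_sum, sum_apply]
  refine Finset.sum_congr rfl fun k _ => ?_
  rw [map_smul, smul_apply, smul_eq_mul, smul_eq_mul, mul_comm]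

theorem norm_dualMap_apply_le {T : X →L[ℂ] X} (hT : ‖T‖ ≤ 1) (ξ : StrongDual ℂ X) :
    ‖dualMap T ξ‖ ≤ ‖ξ‖ := by
  have h : ‖dualMap T ξ‖ ≤ ‖ξ‖ * ‖T‖ := ContinuousLinearMap.opNorm_comp_le ξ T
  exact h.trans (mul_le_of_le_one_right (norm_nonneg _) hT)

/-- If `L_n ∈ X*` is a bounded sequence which is consistent with a system of compressions `c_n`,
in the sense that `L_m ∘ c_n = L_n` for `m ≥ n`, then `L_n = L ∘ c_n` for some `L ∈ X*`. -/
theorem exists_dualMap_eq {c : ℕ → X →L[ℂ] X} {L : ℕ → StrongDual ℂ X} {C : ℝ}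
    (hC : ∀ n, ‖L n‖ ≤ C) (hL : ∀ n m, n ≤ m → dualMap (c n) (L m) = L n) :
    ∃ ξ : StrongDual ℂ X, ∀ n, dualMap (c n) ξ = L n := by
  obtain ⟨a, -, ha⟩ := (WeakDual.isCompact_closedBall (0 : StrongDual ℂ X) C).exists_mapClusterPt
    (f := atTop) (u := fun n => StrongDual.toWeakDual (L n)) (by
      rw [le_principal_iff, mem_map]
      exact Eventually.of_forall fun n => mem_closedBall_zero_iff.2 (hC n))
  refine ⟨WeakDual.toStrongDual a, fun n => ?_⟩
  ext y
  have h1 : MapClusterPt (a (c n y)) atTop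
      ((fun w : WeakDual ℂ X => w (c n y)) ∘ fun n => StrongDual.toWeakDual (L n)) :=
    ha.continuousAt_comp (WeakDual.eval_continuous (c n y)).continuousAt
  have h2 : Tendsto ((fun w : WeakDual ℂ X => w (c n y)) ∘ fun n => StrongDual.toWeakDual (L n))
      atTop (𝓝 (L n y)) := by
    refine tendsto_const_nhds.congr' ?_
    filter_upwards [eventually_ge_atTop n] with m hm
    rw [← hL n m hm]
    rfl
  exact eq_of_nhds_neBot (ClusterPt.mono h1 h2)

theorem variation_le_of_norm_le {Z : Type*} [NormedAddCommGroup Z] {ν μ : VectorMeasure ℝ Z}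
    (h : ∀ E, MeasurableSet E → ‖ν E‖ ≤ ‖μ E‖) : ν.variation ≤ μ.variation :=
  VectorMeasure.variation_le_of_forall_enorm_le fun E hE =>
    le_trans (by rw [← ofReal_norm, ← ofReal_norm]; exact ENNReal.ofReal_le_ofReal (h E hE))
      (VectorMeasure.enorm_measure_le_variation μ E)

theorem dualMap_compression_comp [DecidableEq ι] {x : ι → X} {φ : ι → StrongDual ℂ X}
    (hbi : ∀ k l, φ k (x l) = if k = l then 1 else 0) {s t : Finset ι} (hst : s ⊆ t) (a : ι → ℂ) :
    dualMap (compression x φ s) (∑ k ∈ t, a k • φ k) = ∑ k ∈ s, a k • φ k := by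
  rw [dualMap_compression]
  refine Finset.sum_congr rfl fun k hk => ?_
  congr 1
  simp only [sum_apply, smul_apply, hbi, smul_eq_mul, mul_ite, mul_one, mul_zero]
  rw [Finset.sum_ite_eq' t k a, if_pos (hst hk)]

theorem integrable_sum_smul {f : ι → ℝ → ℂ} (hf : ∀ k, Integrable (f k)) (φ : ι → StrongDual ℂ X)
    (s : Finset ι) : Integrable fun t => ∑ k ∈ s, f k t • φ k :=
  integrable_finsetSum (f := fun k t => f k t • φ k) s fun k _ => (hf k).smul_const (φ k)

theorem withDensityᵥ_sum_smul_apply {f : ι → ℝ → ℂ} (hf : ∀ k, Integrable (f k))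
    (φ : ι → StrongDual ℂ X) (s : Finset ι) {E : Set ℝ} (hE : MeasurableSet E) :
    volume.withDensityᵥ (fun t => ∑ k ∈ s, f k t • φ k) E =
      ∑ k ∈ s, (volume.withDensityᵥ (f k) E) • φ k := by
  have hi : ∀ k, Integrable fun t => f k t • φ k := fun k => (hf k).smul_const (φ k)
  rw [withDensityᵥ_apply (integrable_sum_smul hf φ s) hE,
    integral_finsetSum s fun k _ => (hi k).integrableOn]
  refine Finset.sum_congr rfl fun k _ => ?_
  rw [withDensityᵥ_apply (hf k) hE, integral_smul_const]

/-- The Radon-Nikodym theorem in the dual of a space `X` with a system of finite-rank contractions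
whose adjoints converge strongly to the identity: the densities of the compressed measures are
dominated by the density of the variation, and consistent, so they converge. -/
theorem exists_density [DecidableEq ι] {x : ι → X} {φ : ι → StrongDual ℂ X} {s : ℕ → Finset ι}
    (hbi : ∀ k l, φ k (x l) = if k = l then 1 else 0) (hs : Monotone s)
    (hc : ∀ n, ‖compression x φ (s n)‖ ≤ 1)
    (hconv : ∀ ξ, Tendsto (fun n => dualMap (compression x φ (s n)) ξ) atTop (𝓝 ξ))
    {μ : BddMeasure (StrongDual ℂ X)} (hμ : μ.toVM.variation ≪ volume) :
    ∃ h : ℝ → StrongDual ℂ X, Integrable h ∧ μ.toVM = volume.withDensityᵥ h := by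
  have hev : ∀ k, (evalMeasure μ (x k)).variation ≪ volume := fun k =>
    (Measure.absolutelyContinuous_of_le_smul (variation_evalMeasure_le μ (x k))).trans hμ
  choose f hfi hf using fun k => exists_density_complex (hev k)
  let h : ℕ → ℝ → StrongDual ℂ X := fun n t => ∑ k ∈ s n, f k t • φ k
  have hhi : ∀ n, Integrable (h n) := fun n => integrable_sum_smul hfi φ (s n)
  -- `h n` is the density of the compressed measure
  have hν : ∀ n E, MeasurableSet E →
      volume.withDensityᵥ (h n) E = dualMap (compression x φ (s n)) (μ.toVM E) := by
    intro n E hE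
    rw [withDensityᵥ_sum_smul_apply hfi φ (s n) hE, dualMap_compression]
    refine Finset.sum_congr rfl fun k _ => ?_
    rw [← hf k]
    rfl
  -- the density of the variation dominates all `h n`
  let g : ℝ → ℝ≥0∞ := μ.toVM.variation.rnDeriv volume
  have hgd : volume.withDensity g = μ.toVM.variation := Measure.withDensity_rnDeriv_eq _ _ hμ
  have hgt : ∫⁻ t, g t ≠ ∞ := by
    rw [← setLIntegral_univ, ← withDensity_apply _ MeasurableSet.univ, hgd]
    exact measure_ne_top _ _
  have hgm : Measurable g := Measure.measurable_rnDeriv _ _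
  have hle : ∀ n, ∀ᵐ t, ‖h n t‖ₑ ≤ g t := by
    intro n
    have h1 : volume.withDensity (fun t => ‖h n t‖ₑ) ≤ μ.toVM.variation := by
      rw [← Measure.variation_withDensityᵥ (hhi n)]
      refine variation_le_of_norm_le fun E hE => ?_
      rw [hν n E hE]
      exact norm_dualMap_apply_le (hc n) _
    refine ae_le_of_forall_setLIntegral_le_of_sigmaFinite₀ (hhi n).1.enorm fun E hE _ => ?_
    rw [← withDensity_apply _ hE, ← withDensity_apply _ hE, hgd]
    exact h1 E
  have hle' : ∀ᵐ t, g t < ∞ ∧ ∀ n, ‖h n t‖ ≤ (g t).toReal := by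
    filter_upwards [ae_lt_top hgm hgt, ae_all_iff.2 hle] with t ht hn
    refine ⟨ht, fun n => ?_⟩
    rw [← toReal_enorm]
    exact ENNReal.toReal_mono ht.ne (hn n)
  have hlim : ∀ᵐ t, ∃ ξ, Tendsto (fun n => h n t) atTop (𝓝 ξ) := by
    filter_upwards [hle'] with t ht
    obtain ⟨ξ, hξ⟩ := exists_dualMap_eq (c := fun n => compression x φ (s n))
      (L := fun n => h n t) ht.2 fun n m hnm => dualMap_compression_comp hbi (hs hnm) _
    exact ⟨ξ, (hconv ξ).congr hξ⟩
  obtain ⟨H, hHm, hH⟩ := exists_stronglyMeasurable_limit_of_tendsto_ae (fun n => (hhi n).1) hlim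
  have hgi : Integrable fun t => (g t).toReal :=
    integrable_toReal_of_lintegral_ne_top hgm.aemeasurable hgt
  have hHi : Integrable H := by
    refine hgi.mono' hHm.aestronglyMeasurable ?_
    filter_upwards [hle', hH] with t h1 h2
    exact le_of_tendsto h2.norm (Eventually.of_forall h1.2)
  refine ⟨H, hHi, VectorMeasure.ext fun E hE => ?_⟩
  have h1 : Tendsto (fun n => volume.withDensityᵥ (h n) E) atTop (𝓝 (volume.withDensityᵥ H E)) := by
    simp_rw [withDensityᵥ_apply (hhi _) hE, withDensityᵥ_apply hHi hE]
    refine tendsto_integral_of_dominated_convergence (fun t => (g t).toReal)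
      (fun n => (hhi n).1.restrict) hgi.integrableOn (fun n => ?_) (ae_restrict_of_ae hH)
    exact ae_restrict_of_ae (hle'.mono fun t ht => ht.2 n)
  have h2 : Tendsto (fun n => volume.withDensityᵥ (h n) E) atTop (𝓝 (μ.toVM E)) := by
    simp_rw [hν _ E hE]
    exact hconv _
  exact tendsto_nhds_unique h2 h1

end Density


/-! ### Compressions of compact operators -/

section Compressions

/-- If the operators `p_n` converge strongly to the identity, and `p_n a` is nearly orthogonal to
`c - p_n c` in the sense that `‖p_n a + δ (c - p_n c)‖ ≤ 1 + δ²` for contractions `a` and `c`, then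
`ξ ∘ p_n → ξ` in norm for every functional `ξ`: a functional which nearly attains its norm at `a`
has to be small on the range of `1 - p_n`. -/
theorem tendsto_dualMap_of_orthogonal {X : Type*} [NormedAddCommGroup X] [NormedSpace ℂ X]
    {p : ℕ → X →L[ℂ] X} (h1 : ∀ a, Tendsto (fun n => p n a) atTop (𝓝 a))
    (h2 : ∀ (n : ℕ) (a c : X) (δ : ℝ), ‖a‖ ≤ 1 → ‖c‖ ≤ 1 → 0 ≤ δ →
      ‖p n a + (δ : ℂ) • (c - p n c)‖ ≤ 1 + δ ^ 2) (ξ : StrongDual ℂ X) :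
    Tendsto (fun n => dualMap (p n) ξ) atTop (𝓝 ξ) := by
  rw [Metric.tendsto_nhds]
  intro ε hε
  set M := ‖ξ‖ with hM
  have hM0 : 0 ≤ M := norm_nonneg ξ
  -- `ξ` attains its norm at `a` up to `δ²`, and is then at most `(M + 1) δ < ε` on `c - p_n c`
  let δ : ℝ := ε / (M + 2)
  have hδ : 0 < δ := by positivity
  have hlt : M - δ ^ 2 < ‖ξ‖ := by
    have := pow_pos hδ 2
    linarith
  obtain ⟨a, ha, hξ⟩ := ξ.exists_lt_apply_of_lt_opNorm hlt
  have h3 : Tendsto (fun n => ‖ξ (p n a)‖) atTop (𝓝 ‖ξ a‖) :=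
    ((ξ.continuous.tendsto a).comp (h1 a)).norm
  filter_upwards [h3.eventually (lt_mem_nhds hξ)] with n hn
  have h4 : ‖ξ - dualMap (p n) ξ‖ ≤ (M + 1) * δ := by
    refine ContinuousLinearMap.opNorm_le_of_unit_norm (by positivity) fun c hc => ?_
    -- rotate `a` and `c` so that both values of `ξ` become nonnegative
    obtain ⟨u, hu, hua⟩ := exists_unit_mul_eq_norm (ξ (p n a))
    obtain ⟨w, hw, hwc⟩ := exists_unit_mul_eq_norm (ξ (c - p n c))
    have h5 := ξ.le_opNorm (p n (u • a) + (δ : ℂ) • (w • c - p n (w • c)))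
    have h6 := h2 n (u • a) (w • c) δ (by rw [norm_smul, hu, one_mul]; exact ha.le)
      (by rw [norm_smul, hw, one_mul]; exact hc.le) hδ.le
    have h7 : ξ (p n (u • a) + (δ : ℂ) • (w • c - p n (w • c))) =
        ((‖ξ (p n a)‖ + δ * ‖ξ (c - p n c)‖ : ℝ) : ℂ) := by
      rw [map_smul (p n), map_smul (p n), ← smul_sub, map_add, map_smul, map_smul, map_smul,
        smul_eq_mul, smul_eq_mul, smul_eq_mul, hua, hwc]
      push_cast
      rfl
    rw [h7, Complex.norm_real, Real.norm_of_nonneg (by positivity)] at h5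
    have h8 : ‖ξ (p n a)‖ + δ * ‖ξ (c - p n c)‖ ≤ M * (1 + δ ^ 2) :=
      h5.trans (mul_le_mul_of_nonneg_left h6 hM0)
    have h9 : (ξ - dualMap (p n) ξ) c = ξ (c - p n c) := by
      rw [sub_apply, dualMap_apply, map_sub]
    rw [h9]
    have h10 : δ * ‖ξ (c - p n c)‖ ≤ δ * ((M + 1) * δ) := by nlinarith
    exact le_of_mul_le_mul_left h10 hδ
  rw [dist_comm, dist_eq_norm]
  refine h4.trans_lt ?_
  have h11 : (M + 2) * δ = ε := mul_div_cancel₀ _ (by positivity)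
  nlinarith

variable {H : Type*} [NormedAddCommGroup H] [InnerProductSpace ℂ H] [CompleteSpace H]
  {ι : Type*} (b : HilbertBasis ι ℂ H)

/-- The orthogonal projection onto the span of finitely many basis vectors. -/
def coordProj (s : Finset ι) : H →L[ℂ] H := ∑ i ∈ s, InnerProductSpace.rankOne ℂ (b i) (b i)

theorem coordProj_apply (s : Finset ι) (x : H) :
    coordProj b s x = ∑ i ∈ s, (inner ℂ (b i) x : ℂ) • b i := by
  simp [coordProj]

theorem inner_coordProj_left (s : Finset ι) (x y : H) :
    (inner ℂ (coordProj b s x) y : ℂ) = inner ℂ x (coordProj b s y) := by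
  rw [coordProj_apply, coordProj_apply, sum_inner, inner_sum]
  refine Finset.sum_congr rfl fun i _ => ?_
  rw [inner_smul_left, inner_smul_right, inner_conj_symm, mul_comm]

theorem coordProj_basis [DecidableEq ι] (s : Finset ι) (i : ι) :
    coordProj b s (b i) = if i ∈ s then b i else 0 := by
  rw [coordProj_apply]
  have h : ∀ j, (inner ℂ (b j) (b i) : ℂ) • b j = if i = j then b j else 0 := fun j => by
    rw [orthonormal_iff_ite.1 b.orthonormal j i]
    by_cases hij : i = j
    · simp [hij]
    · simp [hij, Ne.symm hij]
  simp_rw [h]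
  rw [Finset.sum_ite_eq]

theorem coordProj_coordProj (s : Finset ι) (x : H) :
    coordProj b s (coordProj b s x) = coordProj b s x := by
  classical
  conv_lhs => rw [coordProj_apply b s x]
  rw [map_sum, coordProj_apply]
  refine Finset.sum_congr rfl fun i hi => ?_
  rw [map_smul, coordProj_basis, if_pos hi]

/-- The theorem of Pythagoras for the projection and its complement. -/
theorem norm_coordProj_add_sq (s : Finset ι) (x y : H) :
    ‖coordProj b s x + (y - coordProj b s y)‖ ^ 2 =
      ‖coordProj b s x‖ ^ 2 + ‖y - coordProj b s y‖ ^ 2 := by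
  have h : (inner ℂ (coordProj b s x) (y - coordProj b s y) : ℂ) = 0 := by
    rw [inner_coordProj_left, map_sub, coordProj_coordProj, sub_self, inner_zero_right]
  have := norm_add_sq_eq_norm_sq_add_norm_sq_of_inner_eq_zero _ _ h
  simpa only [sq] using this

theorem norm_coordProj_sq (s : Finset ι) (x : H) :
    ‖coordProj b s x‖ ^ 2 + ‖x - coordProj b s x‖ ^ 2 = ‖x‖ ^ 2 := by
  rw [← norm_coordProj_add_sq, add_sub_cancel]

theorem norm_coordProj_apply_le (s : Finset ι) (x : H) : ‖coordProj b s x‖ ≤ ‖x‖ := by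
  refine le_of_sq_le_sq ?_ (norm_nonneg x)
  rw [← norm_coordProj_sq b s x]
  nlinarith [sq_nonneg ‖x - coordProj b s x‖]

theorem norm_sub_coordProj_apply_le (s : Finset ι) (x : H) : ‖x - coordProj b s x‖ ≤ ‖x‖ := by
  refine le_of_sq_le_sq ?_ (norm_nonneg x)
  rw [← norm_coordProj_sq b s x]
  nlinarith [sq_nonneg ‖coordProj b s x‖]

theorem norm_coordProj_le (s : Finset ι) : ‖coordProj b s‖ ≤ 1 :=
  ContinuousLinearMap.opNorm_le_bound _ zero_le_one fun x => by
    rw [one_mul]; exact norm_coordProj_apply_le b s x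

theorem tendsto_coordProj (b : HilbertBasis ℕ ℂ H) (x : H) :
    Tendsto (fun n => coordProj b (Finset.range n) x) atTop (𝓝 x) := by
  refine (b.hasSum_repr x).tendsto_sum_nat.congr fun n => ?_
  simp_rw [coordProj_apply, HilbertBasis.repr_apply_apply]

/-- Strong convergence of the projections is uniform on compact sets. -/
theorem tendsto_coordProj_comp (b : HilbertBasis ℕ ℂ H) {T : H →L[ℂ] H} (hT : IsCompactOperator T) :
    Tendsto (fun n => coordProj b (Finset.range n) ∘L T) atTop (𝓝 T) := by
  rw [Metric.tendsto_nhds]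
  intro ε hε
  have hK := (hT.isCompact_closure_image_closedBall (f := T.toLinearMap) 1).totallyBounded
  obtain ⟨t, ht, hcov⟩ := Metric.totallyBounded_iff.1 hK (ε / 3) (by positivity)
  have h1 : ∀ᶠ n in atTop, ∀ y ∈ t, ‖y - coordProj b (Finset.range n) y‖ < ε / 3 := by
    refine (eventually_all_finite ht).2 fun y _ => ?_
    have := (tendsto_coordProj b y).eventually (Metric.ball_mem_nhds y (by positivity : 0 < ε / 3))
    filter_upwards [this] with n hn
    rw [← dist_eq_norm, dist_comm]
    exact hn
  filter_upwards [h1] with n hn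
  rw [dist_comm, dist_eq_norm]
  refine lt_of_le_of_lt (ContinuousLinearMap.opNorm_le_of_unit_norm
    (C := 2 * (ε / 3)) (by positivity) fun x hx => ?_) (by linarith)
  have hTx : T x ∈ closure (T.toLinearMap '' Metric.closedBall 0 1) :=
    subset_closure ⟨x, by simpa using hx.le, rfl⟩
  obtain ⟨y, hy, hxy⟩ := Set.mem_iUnion₂.1 (hcov hTx)
  rw [Metric.mem_ball, dist_eq_norm] at hxy
  have e : (T - coordProj b (Finset.range n) ∘L T) x =
      ((T x - y) - coordProj b (Finset.range n) (T x - y)) +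
        (y - coordProj b (Finset.range n) y) := by
    rw [sub_apply, ContinuousLinearMap.comp_apply, map_sub]
    abel
  rw [e]
  refine (norm_add_le _ _).trans ?_
  have h2 := norm_sub_coordProj_apply_le b (Finset.range n) (T x - y)
  have h3 := hn y hy
  linarith

theorem tendsto_comp_coordProj (b : HilbertBasis ℕ ℂ H) {T : H →L[ℂ] H} (hT : IsCompactOperator T) :
    Tendsto (fun n => T ∘L coordProj b (Finset.range n)) atTop (𝓝 T) := by
  rw [Metric.tendsto_nhds]
  intro ε hε
  obtain ⟨m, hm⟩ := ((Metric.tendsto_nhds.1 (tendsto_coordProj_comp b hT)) (ε / 2)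
    (by positivity)).exists
  -- the rows `T* b_i`, for `i < m`, determine `T` up to an error of `ε / 2`
  let r : ℕ → H := fun i => ContinuousLinearMap.adjoint T (b i)
  have h1 : Tendsto (fun n => ∑ i ∈ Finset.range m, ‖r i - coordProj b (Finset.range n) (r i)‖)
      atTop (𝓝 0) := by
    have : Tendsto (fun n => ∑ i ∈ Finset.range m, ‖r i - coordProj b (Finset.range n) (r i)‖)
        atTop (𝓝 (∑ i ∈ Finset.range m, ‖r i - r i‖)) :=
      tendsto_finsetSum _ fun i _ => ((tendsto_const_nhds).sub (tendsto_coordProj b (r i))).norm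
    simpa using this
  filter_upwards [h1.eventually (gt_mem_nhds (half_pos hε))] with n hn
  rw [dist_eq_norm, norm_sub_rev] at hm ⊢
  set P := coordProj b (Finset.range n)
  set R := coordProj b (Finset.range m)
  refine lt_of_le_of_lt (ContinuousLinearMap.opNorm_le_of_unit_norm
    (C := ‖T - R ∘L T‖ + ∑ i ∈ Finset.range m, ‖r i - P (r i)‖) (by positivity) fun x hx => ?_)
    (by linarith)
  have e : (T - T ∘L P) x = (T - R ∘L T) (x - P x) + R (T (x - P x)) := by
    simp only [sub_apply, ContinuousLinearMap.comp_apply, map_sub]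
    abel
  rw [e]
  refine (norm_add_le _ _).trans (add_le_add ?_ ?_)
  · refine ((T - R ∘L T).le_opNorm _).trans (mul_le_of_le_one_right (norm_nonneg _) ?_)
    exact (norm_sub_coordProj_apply_le b _ x).trans hx.le
  · rw [coordProj_apply]
    refine norm_sum_le_of_le _ fun i _ => ?_
    have e2 : (inner ℂ (b i) (T (x - P x)) : ℂ) = inner ℂ (r i - P (r i)) x := by
      rw [← ContinuousLinearMap.adjoint_inner_left, inner_sub_right, inner_sub_left,
        inner_coordProj_left]
    rw [norm_smul, b.orthonormal.1 i, mul_one, e2]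
    refine (norm_inner_le_norm _ _).trans ?_
    rw [hx, mul_one]

/-- Left multiplication by a bounded operator, on the compact operators. -/
def leftMul (A : H →L[ℂ] H) : CompactOp H →L[ℂ] CompactOp H :=
  LinearMap.mkContinuous
    { toFun := fun a => (⟨A ∘L a.toOp, IsCompactOperator.clm_comp a.2 A⟩ :
        compactOperator (RingHom.id ℂ) H H)
      map_add' := fun a c => Subtype.ext (ContinuousLinearMap.comp_add A a.toOp c.toOp)
      map_smul' := fun k a => Subtype.ext (ContinuousLinearMap.comp_smul A k a.toOp) }
    ‖A‖ fun a => ContinuousLinearMap.opNorm_comp_le A a.toOp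

/-- Right multiplication by a bounded operator, on the compact operators. -/
def rightMul (A : H →L[ℂ] H) : CompactOp H →L[ℂ] CompactOp H :=
  LinearMap.mkContinuous
    { toFun := fun a => (⟨a.toOp ∘L A, IsCompactOperator.comp_clm a.2 A⟩ :
        compactOperator (RingHom.id ℂ) H H)
      map_add' := fun a c => Subtype.ext (ContinuousLinearMap.add_comp a.toOp c.toOp A)
      map_smul' := fun k a => Subtype.ext (ContinuousLinearMap.smul_comp k a.toOp A) }
    ‖A‖ fun a => (ContinuousLinearMap.opNorm_comp_le a.toOp A).trans_eq (mul_comm _ _)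

theorem norm_leftMul_le (A : H →L[ℂ] H) : ‖leftMul A‖ ≤ ‖A‖ :=
  LinearMap.mkContinuous_norm_le _ (norm_nonneg _) _

theorem norm_rightMul_le (A : H →L[ℂ] H) : ‖rightMul A‖ ≤ ‖A‖ :=
  LinearMap.mkContinuous_norm_le _ (norm_nonneg _) _

theorem norm_toOp (a : CompactOp H) : ‖a.toOp‖ = ‖a‖ := rfl

theorem tendsto_compactOp_iff {f : ℕ → CompactOp H} {a : CompactOp H} :
    Tendsto f atTop (𝓝 a) ↔ Tendsto (fun n => (f n).toOp) atTop (𝓝 a.toOp) :=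
  tendsto_subtype_rng

/-- Left multiplication by the projections `P_n` is nearly orthogonal in the sense of
`tendsto_dualMap_of_orthogonal`: the ranges of `P_n a` and of `c - P_n c` are orthogonal. -/
theorem tendsto_dualMap_leftMul (b : HilbertBasis ℕ ℂ H) (ξ : StrongDual ℂ (CompactOp H)) :
    Tendsto (fun n => dualMap (leftMul (coordProj b (Finset.range n))) ξ) atTop (𝓝 ξ) := by
  refine tendsto_dualMap_of_orthogonal (fun a => tendsto_compactOp_iff.2 ?_)
    (fun n a c δ ha hc hδ => ?_) ξ
  · exact tendsto_coordProj_comp b a.2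
  · rw [← norm_toOp]
    refine ContinuousLinearMap.opNorm_le_bound _ (by positivity) fun x => ?_
    set P := coordProj b (Finset.range n)
    change ‖P (a.toOp x) + (δ : ℂ) • (c.toOp x - P (c.toOp x))‖ ≤ _
    have e : (δ : ℂ) • (c.toOp x - P (c.toOp x)) =
        (δ : ℂ) • c.toOp x - P ((δ : ℂ) • c.toOp x) := by rw [smul_sub, map_smul]
    refine le_of_sq_le_sq ?_ (by positivity)
    rw [e, norm_coordProj_add_sq]
    have h1 : ‖P (a.toOp x)‖ ≤ ‖x‖ := (norm_coordProj_apply_le b _ _).trans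
      ((a.toOp.le_opNorm x).trans (mul_le_of_le_one_left (norm_nonneg _) ha))
    have h2 : ‖(δ : ℂ) • c.toOp x - P ((δ : ℂ) • c.toOp x)‖ ≤ δ * ‖x‖ := by
      refine (norm_sub_coordProj_apply_le b _ _).trans ?_
      rw [norm_smul, Complex.norm_real, Real.norm_of_nonneg hδ]
      exact mul_le_mul_of_nonneg_left
        ((c.toOp.le_opNorm x).trans (mul_le_of_le_one_left (norm_nonneg _) hc)) hδ
    calc _ ≤ ‖x‖ ^ 2 + (δ * ‖x‖) ^ 2 := by gcongr
      _ = (1 + δ ^ 2) * ‖x‖ ^ 2 := by ring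
      _ ≤ (1 + δ ^ 2) ^ 2 * ‖x‖ ^ 2 :=
          mul_le_mul_of_nonneg_right (by nlinarith [sq_nonneg δ, sq_nonneg (δ ^ 2)]) (sq_nonneg _)
      _ = _ := by ring

/-- Here the initial spaces of `a P_n` and of `c - c P_n` are orthogonal. -/
theorem tendsto_dualMap_rightMul (b : HilbertBasis ℕ ℂ H) (ξ : StrongDual ℂ (CompactOp H)) :
    Tendsto (fun n => dualMap (rightMul (coordProj b (Finset.range n))) ξ) atTop (𝓝 ξ) := by
  refine tendsto_dualMap_of_orthogonal (fun a => tendsto_compactOp_iff.2 ?_)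
    (fun n a c δ ha hc hδ => ?_) ξ
  · exact tendsto_comp_coordProj b a.2
  · rw [← norm_toOp]
    refine ContinuousLinearMap.opNorm_le_bound _ (by positivity) fun x => ?_
    set P := coordProj b (Finset.range n)
    change ‖a.toOp (P x) + (δ : ℂ) • (c.toOp x - c.toOp (P x))‖ ≤ _
    rw [← map_sub]
    have h0 := norm_coordProj_sq b (Finset.range n) x
    have h1 : ‖a.toOp (P x)‖ ≤ ‖P x‖ :=
      (a.toOp.le_opNorm _).trans (mul_le_of_le_one_left (norm_nonneg _) ha)
    have h2 : ‖(δ : ℂ) • c.toOp (x - P x)‖ ≤ δ * ‖x - P x‖ := by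
      rw [norm_smul, Complex.norm_real, Real.norm_of_nonneg hδ]
      exact mul_le_mul_of_nonneg_left
        ((c.toOp.le_opNorm _).trans (mul_le_of_le_one_left (norm_nonneg _) hc)) hδ
    refine ((norm_add_le _ _).trans (add_le_add h1 h2)).trans ?_
    refine le_of_sq_le_sq ?_ (by positivity)
    calc (‖P x‖ + δ * ‖x - P x‖) ^ 2 ≤ (1 + δ ^ 2) * (‖P x‖ ^ 2 + ‖x - P x‖ ^ 2) := by
          nlinarith [sq_nonneg (δ * ‖P x‖ - ‖x - P x‖)]
      _ = (1 + δ ^ 2) * ‖x‖ ^ 2 := by rw [h0]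
      _ ≤ (1 + δ ^ 2) ^ 2 * ‖x‖ ^ 2 :=
          mul_le_mul_of_nonneg_right (by nlinarith [sq_nonneg δ, sq_nonneg (δ ^ 2)]) (sq_nonneg _)
      _ = _ := by ring

/-- The rank-one operator `z ↦ ⟨y, z⟩ x`, as a compact operator. -/
def compactRankOne (x y : H) : CompactOp H :=
  (⟨InnerProductSpace.rankOne ℂ x y, (isCompactOperator_of_locallyCompactSpace_rng
    (ContinuousLinearMap.toSpanSingleton ℂ x)).comp_clm (innerSL ℂ y)⟩ :
      compactOperator (RingHom.id ℂ) H H)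

theorem toOp_compactRankOne (x y : H) :
    (compactRankOne x y).toOp = InnerProductSpace.rankOne ℂ x y := rfl

/-- The matrix entry `a ↦ ⟨b_i, a b_j⟩`, for `k = (i, j)`. -/
def matrixEntry (k : ι × ι) : StrongDual ℂ (CompactOp H) :=
  LinearMap.mkContinuous
    { toFun := fun a => inner ℂ (b k.1) (a.toOp (b k.2))
      map_add' := fun a c => inner_add_right _ _ _
      map_smul' := fun z a => inner_smul_right _ _ _ }
    1 fun a => by
      refine (norm_inner_le_norm _ _).trans ?_
      rw [b.orthonormal.1, one_mul, one_mul]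
      exact (a.toOp.le_opNorm _).trans_eq (by rw [b.orthonormal.1, mul_one, norm_toOp])

theorem matrixEntry_apply (k : ι × ι) (a : CompactOp H) :
    matrixEntry b k a = inner ℂ (b k.1) (a.toOp (b k.2)) := rfl

theorem matrixEntry_compactRankOne [DecidableEq ι] (k l : ι × ι) :
    matrixEntry b k (compactRankOne (b l.1) (b l.2)) = if k = l then 1 else 0 := by
  rw [matrixEntry_apply, toOp_compactRankOne, InnerProductSpace.rankOne_apply, inner_smul_right,
    orthonormal_iff_ite.1 b.orthonormal, orthonormal_iff_ite.1 b.orthonormal]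
  by_cases h1 : k.1 = l.1 <;> by_cases h2 : k.2 = l.2 <;>
    simp [h1, h2, Prod.ext_iff, eq_comm (a := l.2) (b := k.2)]

/-- The compressions of the system of matrix units are the maps `a ↦ P a P`. -/
theorem compression_compactOp (s : Finset ι) :
    compression (fun k : ι × ι => compactRankOne (b k.1) (b k.2)) (matrixEntry b) (s ×ˢ s) =
      leftMul (coordProj b s) ∘L rightMul (coordProj b s) := by
  ext a
  refine Subtype.ext (ContinuousLinearMap.ext fun x => ?_)
  let ev : CompactOp H →ₗ[ℂ] H :=
    { toFun := fun a => a.toOp x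
      map_add' := fun _ _ => rfl
      map_smul' := fun _ _ => rfl }
  change ev (compression _ _ _ a) = coordProj b s (a.toOp (coordProj b s x))
  rw [compression_apply, map_sum, coordProj_apply b s (a.toOp _),
    Finset.sum_product]
  refine Finset.sum_congr rfl fun i _ => ?_
  rw [coordProj_apply b s x, map_sum, inner_sum, Finset.sum_smul]
  refine Finset.sum_congr rfl fun j _ => ?_
  rw [map_smul, map_smul, inner_smul_right, mul_comm, mul_smul]
  rfl

theorem norm_compression_compactOp_le (s : Finset ι) :
    ‖compression (fun k : ι × ι => compactRankOne (b k.1) (b k.2)) (matrixEntry b) (s ×ˢ s)‖ ≤ 1 := by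
  rw [compression_compactOp]
  refine (ContinuousLinearMap.opNorm_comp_le _ _).trans ?_
  exact mul_le_one₀ ((norm_leftMul_le _).trans (norm_coordProj_le b s)) (norm_nonneg _)
    ((norm_rightMul_le _).trans (norm_coordProj_le b s))

theorem tendsto_dualMap_compression (b : HilbertBasis ℕ ℂ H) (ξ : StrongDual ℂ (CompactOp H)) :
    Tendsto (fun n => dualMap (compression (fun k : ℕ × ℕ => compactRankOne (b k.1) (b k.2))
      (matrixEntry b) (Finset.range n ×ˢ Finset.range n)) ξ) atTop (𝓝 ξ) := by
  let l : ℕ → CompactOp H →L[ℂ] CompactOp H := fun n => leftMul (coordProj b (Finset.range n))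
  let r : ℕ → CompactOp H →L[ℂ] CompactOp H := fun n => rightMul (coordProj b (Finset.range n))
  have hl := tendsto_dualMap_leftMul b ξ
  have hr := tendsto_dualMap_rightMul b ξ
  rw [tendsto_iff_norm_sub_tendsto_zero] at hl hr ⊢
  refine squeeze_zero (fun n => norm_nonneg _) (fun n => ?_) (by simpa using hl.add hr)
  have e : dualMap (compression (fun k : ℕ × ℕ => compactRankOne (b k.1) (b k.2))
      (matrixEntry b) (Finset.range n ×ˢ Finset.range n)) ξ - ξ =
      dualMap (r n) (dualMap (l n) ξ - ξ) + (dualMap (r n) ξ - ξ) := by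
    rw [map_sub, sub_add_sub_cancel, compression_compactOp]
    rfl
  rw [e]
  refine (norm_add_le _ _).trans (add_le_add_left (norm_dualMap_apply_le ?_ _) _)
  exact (norm_rightMul_le _).trans (norm_coordProj_le b _)

end Compressions


/-! ### Trace duality -/

section TraceDuality

theorem summable_of_norm_sum_le {ι : Type*} {f : ι → ℝ} {C : ℝ}
    (h : ∀ s : Finset ι, ‖∑ i ∈ s, f i‖ ≤ C) : Summable f := by
  refine Summable.of_abs (summable_of_sum_le (c := C + C) (fun i => abs_nonneg _) fun s => ?_)
  rw [← Finset.sum_filter_add_sum_filter_not s fun i => 0 ≤ f i]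
  refine add_le_add ?_ ?_
  · rw [Finset.sum_congr rfl fun i hi => abs_of_nonneg (Finset.mem_filter.1 hi).2]
    exact (le_abs_self _).trans (h _)
  · rw [Finset.sum_congr rfl fun i hi => abs_of_neg (not_le.1 (Finset.mem_filter.1 hi).2),
      Finset.sum_neg_distrib]
    exact (neg_le_abs _).trans (h _)

theorem summable_of_norm_sum_le_complex {ι : Type*} {f : ι → ℂ} {C : ℝ}
    (h : ∀ s : Finset ι, ‖∑ i ∈ s, f i‖ ≤ C) : Summable f := by
  have h1 : Summable fun i => (f i).re := summable_of_norm_sum_le (C := C) fun s => by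
    rw [← Complex.re_sum]
    exact (Complex.abs_re_le_norm _).trans (h s)
  have h2 : Summable fun i => (f i).im := summable_of_norm_sum_le (C := C) fun s => by
    rw [← Complex.im_sum]
    exact (Complex.abs_im_le_norm _).trans (h s)
  exact ⟨⟨_, _⟩, (Complex.hasSum_iff _ _).2 ⟨h1.hasSum, h2.hasSum⟩⟩

variable {H : Type*} [NormedAddCommGroup H] [InnerProductSpace ℂ H] [CompleteSpace H]
  {ι : Type*} (b : HilbertBasis ι ℂ H)

/-- The bound of `norm_sum_inner_le` for contractions, applied to `A* / ‖A‖`. -/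
theorem norm_sum_inner_comp_le {T : H →L[ℂ] H} (hT : traceNormE b T ≠ ∞) (A : H →L[ℂ] H)
    (s : Finset ι) :
    ‖∑ n ∈ s, (inner ℂ (b n) (A (T (b n))) : ℂ)‖ ≤ ‖A‖ * (traceNormE b T).toReal := by
  by_cases hA : A = 0
  · simp [hA]
  have hA' : 0 < ‖A‖ := norm_pos_iff.2 hA
  let V : H →L[ℂ] H := ((‖A‖⁻¹ : ℝ) : ℂ) • ContinuousLinearMap.adjoint A
  have hV : ‖V‖ ≤ 1 := by
    rw [norm_smul, Complex.norm_real, norm_inv, norm_norm, LinearIsometryEquiv.norm_map,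
      inv_mul_cancel₀ hA'.ne']
  have h := norm_sum_inner_le b hV hT s
  have e : ∀ n, (inner ℂ (V (b n)) (T (b n)) : ℂ) =
      ((‖A‖⁻¹ : ℝ) : ℂ) * inner ℂ (b n) (A (T (b n))) := fun n => by
    rw [smul_apply, inner_smul_left, Complex.conj_ofReal, ContinuousLinearMap.adjoint_inner_left]
  simp_rw [e] at h
  rw [← Finset.mul_sum, norm_mul, Complex.norm_real, norm_inv, norm_norm,
    inv_mul_le_iff₀ hA'] at h
  exact h

theorem summable_inner_comp {T : H →L[ℂ] H} (hT : traceNormE b T ≠ ∞) (A : H →L[ℂ] H) :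
    Summable fun n => (inner ℂ (b n) ((A ∘L T) (b n)) : ℂ) :=
  summable_of_norm_sum_le_complex (norm_sum_inner_comp_le b hT A)

theorem norm_opTrace_comp_le {T : H →L[ℂ] H} (hT : traceNormE b T ≠ ∞) (A : H →L[ℂ] H) :
    ‖opTrace b (A ∘L T)‖ ≤ (traceNormE b T).toReal * ‖A‖ := by
  rw [mul_comm]
  exact le_of_tendsto (summable_inner_comp b hT A).hasSum.norm
    (Eventually.of_forall (norm_sum_inner_comp_le b hT A))

/-- The trace norm is the supremum of `|∑_{n ∈ s} ⟨V b_n, T b_n⟩|` over contractions `V` and finite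
sets `s`. -/
theorem traceNormE_le_of_forall {T : H →L[ℂ] H} {C : ℝ}
    (h : ∀ V : H →L[ℂ] H, ‖V‖ ≤ 1 → ∀ s : Finset ι,
      ‖∑ n ∈ s, (inner ℂ (V (b n)) (T (b n)) : ℂ)‖ ≤ C) : traceNormE b T ≤ ENNReal.ofReal C := by
  obtain ⟨S, hS1, hS2⟩ := exists_sqrt_absOp T
  have hpos : ∀ n, 0 ≤ (inner ℂ (b n) (absOp T (b n)) : ℂ).re := by
    intro n
    rw [inner_absOp_eq hS1 hS2]
    exact inner_self_nonneg (𝕜 := ℂ)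
  refine ENNReal.summable.tsum_le_of_sum_le fun s => ?_
  rw [← ENNReal.ofReal_sum_of_nonneg fun n _ => hpos n]
  refine ENNReal.ofReal_le_ofReal (le_of_forall_pos_le_add fun δ hδ => ?_)
  obtain ⟨V, hV, hTV, -⟩ := exists_approx_polar T (ε := δ / (s.card + 1)) (by positivity)
  have hb : ∀ n, ‖b n‖ = 1 := fun n => b.orthonormal.1 n
  have main : ∀ n ∈ s, (inner ℂ (b n) (absOp T (b n)) : ℂ).re ≤
      δ / (s.card + 1) + (inner ℂ (V (b n)) (T (b n)) : ℂ).re := by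
    intro n _
    have e : (inner ℂ (b n) (absOp T (b n)) : ℂ) =
        inner ℂ (b n) ((absOp T - star V * T) (b n)) + inner ℂ (V (b n)) (T (b n)) := by
      rw [sub_apply, inner_sub_right, ContinuousLinearMap.star_eq_adjoint]
      change _ = _ - inner ℂ (b n) (ContinuousLinearMap.adjoint V (T (b n))) + _
      rw [ContinuousLinearMap.adjoint_inner_right, sub_add_cancel]
    rw [e, Complex.add_re]
    refine add_le_add_left ?_ _
    refine (Complex.re_le_norm _).trans ((norm_inner_le_norm _ _).trans ?_)
    rw [hb, one_mul]
    refine (ContinuousLinearMap.le_opNorm _ _).trans ?_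
    rw [hb, mul_one]
    exact hTV
  refine (Finset.sum_le_sum main).trans ?_
  rw [Finset.sum_add_distrib, Finset.sum_const, nsmul_eq_mul, ← Complex.re_sum]
  have q1 := (Complex.re_le_norm _).trans (h V hV s)
  have q3 : (s.card : ℝ) * (δ / (s.card + 1)) ≤ δ := by
    have hc : (0 : ℝ) < s.card + 1 := by positivity
    rw [mul_div_assoc', div_le_iff₀ hc]
    nlinarith
  linarith

/-- The functional `a ↦ tr(a T)` on the compact operators, for `T` of trace class. -/
def traceFunctional : TraceClass b →L[ℂ] StrongDual ℂ (CompactOp H) :=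
  LinearMap.mkContinuous₂ (LinearMap.mk₂ ℂ (fun T a => opTrace b (a.toOp ∘L T.toOp))
    (fun T₁ T₂ a => by
      have h := (summable_inner_comp b T₁.2 a.toOp).tsum_add (summable_inner_comp b T₂.2 a.toOp)
      refine Eq.trans (tsum_congr fun n => ?_) h
      rw [← inner_add_right]
      exact congrArg _ (map_add a.toOp _ _))
    (fun c T a => by
      refine Eq.trans (tsum_congr fun n => ?_) tsum_mul_left
      rw [← inner_smul_right]
      exact congrArg _ (map_smul a.toOp c _))
    (fun T a₁ a₂ => by
      have h := (summable_inner_comp b T.2 a₁.toOp).tsum_add (summable_inner_comp b T.2 a₂.toOp)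
      refine Eq.trans (tsum_congr fun n => ?_) h
      rw [← inner_add_right]
      rfl)
    (fun c T a => by
      refine Eq.trans (tsum_congr fun n => ?_) tsum_mul_left
      rw [← inner_smul_right]
      rfl)) 1 fun T a => by
        rw [one_mul]
        exact norm_opTrace_comp_le b T.2 a.toOp

theorem traceFunctional_compactRankOne (T : TraceClass b) (x y : H) :
    traceFunctional b T (compactRankOne x y) = inner ℂ y (T.toOp x) := by
  rw [← ContinuousLinearMap.adjoint_inner_left, ← b.tsum_inner_mul_inner]
  refine tsum_congr fun n => ?_
  rw [ContinuousLinearMap.comp_apply, toOp_compactRankOne, InnerProductSpace.rankOne_apply,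
    inner_smul_right, ContinuousLinearMap.adjoint_inner_left]

/-- The sum is `P V*`, for the projection `P` onto the span of the `b_n` with `n ∈ s`. -/
theorem norm_sum_compactRankOne_le {V : H →L[ℂ] H} (hV : ‖V‖ ≤ 1) (s : Finset ι) :
    ‖∑ n ∈ s, compactRankOne (b n) (V (b n))‖ ≤ 1 := by
  let toOpL : CompactOp H →ₗ[ℂ] H →L[ℂ] H :=
    { toFun := CompactOp.toOp, map_add' := fun _ _ => rfl, map_smul' := fun _ _ => rfl }
  have h : (∑ n ∈ s, compactRankOne (b n) (V (b n))).toOp =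
      coordProj b s ∘L ContinuousLinearMap.adjoint V := by
    change toOpL _ = _
    rw [map_sum]
    ext x
    rw [sum_apply, ContinuousLinearMap.comp_apply, coordProj_apply]
    refine Finset.sum_congr rfl fun n _ => ?_
    rw [ContinuousLinearMap.adjoint_inner_right]
    rfl
  rw [← norm_toOp, h]
  refine (ContinuousLinearMap.opNorm_comp_le _ _).trans ?_
  rw [LinearIsometryEquiv.norm_map]
  exact mul_le_one₀ (norm_coordProj_le b s) (norm_nonneg _) hV

/-- An operator which represents a functional `ξ` on the rank-one operators has a trace norm of at
most `‖ξ‖`. -/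
theorem traceNormE_le_of_compactRankOne {T : H →L[ℂ] H} {ξ : StrongDual ℂ (CompactOp H)}
    (h : ∀ x y, ξ (compactRankOne x y) = inner ℂ y (T x)) :
    traceNormE b T ≤ ENNReal.ofReal ‖ξ‖ := by
  refine traceNormE_le_of_forall b fun V hV s => ?_
  have e : ∑ n ∈ s, (inner ℂ (V (b n)) (T (b n)) : ℂ) =
      ξ (∑ n ∈ s, compactRankOne (b n) (V (b n))) := by
    rw [map_sum]
    exact Finset.sum_congr rfl fun n _ => (h _ _).symm
  rw [e]
  exact (ξ.le_opNorm _).trans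
    (mul_le_of_le_one_right (norm_nonneg _) (norm_sum_compactRankOne_le b hV s))

theorem norm_traceFunctional (T : TraceClass b) : ‖traceFunctional b T‖ = ‖T‖ := by
  refine le_antisymm ?_ ?_
  · exact ContinuousLinearMap.opNorm_le_bound _ (norm_nonneg _) fun a =>
      norm_opTrace_comp_le b T.2 a.toOp
  · rw [TraceClass.norm_def]
    exact ENNReal.toReal_le_of_le_ofReal (norm_nonneg _)
      (traceNormE_le_of_compactRankOne b fun x y => traceFunctional_compactRankOne b T x y)

/-- The sesquilinear form `(y, x) ↦ ξ (x ⊗ y)` is bounded, so it comes from a bounded operator. -/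
theorem exists_inner_eq (ξ : StrongDual ℂ (CompactOp H)) :
    ∃ T : H →L[ℂ] H, ∀ x y, ξ (compactRankOne x y) = inner ℂ y (T x) := by
  let B : H →L⋆[ℂ] H →L[ℂ] ℂ := LinearMap.mkContinuous₂
    (LinearMap.mk₂'ₛₗ (starRingEnd ℂ) (RingHom.id ℂ) (fun y x => ξ (compactRankOne x y))
      (fun y₁ y₂ x => by
        rw [← map_add]
        exact congrArg ξ (Subtype.ext (map_add (InnerProductSpace.rankOne ℂ x) y₁ y₂)))
      (fun c y x => by
        rw [← map_smul]
        exact congrArg ξ (Subtype.ext (map_smulₛₗ (InnerProductSpace.rankOne ℂ x) c y)))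
      (fun y x₁ x₂ => by
        rw [← map_add]
        refine congrArg ξ (Subtype.ext ?_)
        exact congrArg (fun A => A y) (map_add (InnerProductSpace.rankOne ℂ (F := H)) x₁ x₂))
      (fun c y x => by
        rw [RingHom.id_apply, ← map_smul]
        refine congrArg ξ (Subtype.ext ?_)
        exact congrArg (fun A => A y) (map_smul (InnerProductSpace.rankOne ℂ (F := H)) c x)))
    ‖ξ‖ fun y x => by
      refine (ξ.le_opNorm _).trans_eq ?_
      rw [← norm_toOp, toOp_compactRankOne, InnerProductSpace.norm_rankOne]
      ring
  refine ⟨ContinuousLinearMap.adjoint (InnerProductSpace.continuousLinearMapOfBilin B),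
    fun x y => ?_⟩
  rw [ContinuousLinearMap.adjoint_inner_right,
    InnerProductSpace.continuousLinearMapOfBilin_apply]
  rfl

/-- The operator which represents `ξ` on the rank-one operators represents it everywhere, as both
functionals are limits of their compressions. -/
theorem traceFunctional_surjective (b : HilbertBasis ℕ ℂ H) :
    Function.Surjective (traceFunctional b) := by
  intro ξ
  obtain ⟨T, hT⟩ := exists_inner_eq ξ
  have hT1 : traceNormE b T ≠ ∞ :=
    ne_top_of_le_ne_top ENNReal.ofReal_ne_top (traceNormE_le_of_compactRankOne b hT)
  let T' : TraceClass b := (⟨T, hT1⟩ : traceClassSubmodule b)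
  refine ⟨T', tendsto_nhds_unique (tendsto_dualMap_compression b (traceFunctional b T'))
    ((tendsto_dualMap_compression b ξ).congr fun n => ?_)⟩
  rw [dualMap_compression, dualMap_compression]
  refine Finset.sum_congr rfl fun k _ => ?_
  rw [traceFunctional_compactRankOne, hT]
  rfl

/-- Trace duality: the trace-class operators are the dual of the compact operators. -/
def traceDual (b : HilbertBasis ℕ ℂ H) : TraceClass b ≃ₗᵢ[ℂ] StrongDual ℂ (CompactOp H) :=
  LinearIsometryEquiv.ofSurjective
    ⟨(traceFunctional b).toLinearMap, norm_traceFunctional b⟩ (traceFunctional_surjective b)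

end TraceDuality


/-! ### The dual of the quotient by `Z₀ ⊗ X` -/

section QuotientDual

variable {E : Type*} [NormedAddCommGroup E] [NormedSpace ℂ E]

theorem norm_comp_mkQL (W : Submodule ℂ E) (ξ : StrongDual ℂ (E ⧸ W)) : ‖ξ ∘L W.mkQL‖ = ‖ξ‖ := by
  refine le_antisymm ?_ ?_
  · refine ContinuousLinearMap.opNorm_le_bound _ (norm_nonneg ξ) fun x => ?_
    exact (ξ.le_opNorm _).trans
      (mul_le_mul_of_nonneg_left (Submodule.Quotient.norm_mk_le W x) (norm_nonneg ξ))
  · refine ContinuousLinearMap.opNorm_le_bound _ (norm_nonneg _) fun q => ?_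
    refine le_of_forall_pos_le_add fun ε hε => ?_
    obtain ⟨x, rfl, hx⟩ := Submodule.Quotient.norm_mk_lt q
      (ε := ε / (‖ξ ∘L W.mkQL‖ + 1)) (by positivity)
    refine ((ξ ∘L W.mkQL).le_opNorm x).trans
      ((mul_le_mul_of_nonneg_left hx.le (norm_nonneg _)).trans ?_)
    rw [mul_add]
    refine add_le_add_right ?_ _
    rw [mul_div_assoc', div_le_iff₀ (by positivity)]
    nlinarith [norm_nonneg (ξ ∘L W.mkQL)]

theorem mem_annihilator_topologicalClosure {W : Submodule ℂ E} {ξ : StrongDual ℂ E} :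
    ξ ∈ annihilator W.topologicalClosure ↔ ξ ∈ annihilator W := by
  refine ⟨fun h x hx => h x (W.le_topologicalClosure hx), fun h x hx => ?_⟩
  exact W.topologicalClosure_minimal (t := LinearMap.ker ξ.toLinearMap) h ξ.isClosed_ker hx

theorem comp_mkQL_mem_annihilator (W : Submodule ℂ E) (ξ : StrongDual ℂ (E ⧸ W)) :
    ξ ∘L W.mkQL ∈ annihilator W := fun x hx => by
  change ξ (Submodule.Quotient.mk x) = 0
  rw [(Submodule.Quotient.mk_eq_zero W).2 hx, map_zero]

/-- The dual of a quotient is the annihilator of the subspace. -/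
def quotientDualAnnihilator (W : Submodule ℂ E) : StrongDual ℂ (E ⧸ W) ≃ₗᵢ[ℂ] annihilator W where
  toFun ξ := ⟨ξ ∘L W.mkQL, comp_mkQL_mem_annihilator W ξ⟩
  invFun η := W.liftQL η.1 η.2
  map_add' _ _ := rfl
  map_smul' _ _ := rfl
  left_inv ξ := by
    ext q
    obtain ⟨x, rfl⟩ := Submodule.Quotient.mk_surjective W q
    rfl
  right_inv _ := rfl
  norm_map' ξ := norm_comp_mkQL W ξ

/-- The restriction of an isometric isomorphism to corresponding subspaces. -/
def restrictIsometryEquiv {F : Type*} [NormedAddCommGroup F] [NormedSpace ℂ F] (Φ : E ≃ₗᵢ[ℂ] F)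
    (S : Submodule ℂ E) (T : Submodule ℂ F) (h : ∀ v, v ∈ S ↔ Φ v ∈ T) : S ≃ₗᵢ[ℂ] T where
  toFun v := ⟨Φ v, (h v).1 v.2⟩
  invFun w := ⟨Φ.symm w, (h _).2 (by rw [Φ.apply_symm_apply]; exact w.2)⟩
  map_add' _ _ := Subtype.ext (map_add Φ _ _)
  map_smul' _ _ := Subtype.ext (map_smul Φ _ _)
  left_inv v := Subtype.ext (Φ.symm_apply_apply _)
  right_inv w := Subtype.ext (Φ.apply_symm_apply _)
  norm_map' v := Φ.norm_map v

variable (X : Type*) [NormedAddCommGroup X] [NormedSpace ℂ X]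

theorem mem_annihilator_Z0InjTensor_iff (η : StrongDual ℂ C₀(ℝ, X)) :
    η ∈ annihilator (Z0InjTensor X) ↔
      ((dualEquiv X).symm.trans (poissonEquiv X)) η ∈ HolomorphicH1 (StrongDual ℂ X) := by
  rw [LinearIsometryEquiv.trans_apply, poissonEquiv_apply, ← dualEquiv_mem_annihilator_iff,
    LinearIsometryEquiv.apply_symm_apply]
  exact mem_annihilator_topologicalClosure

/-- The identification of the dual of `C₀(ℝ; X) / (Z₀ ⊗ X)` with `𝐇¹(P₊; X*)`. -/
def quotientDualEquiv :
    StrongDual ℂ (C₀(ℝ, X) ⧸ Z0InjTensor X) ≃ₗᵢ[ℂ] HolomorphicH1 (StrongDual ℂ X) :=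
  (quotientDualAnnihilator (Z0InjTensor X)).trans
    (restrictIsometryEquiv ((dualEquiv X).symm.trans (poissonEquiv X)) _ _
      (mem_annihilator_Z0InjTensor_iff X))

theorem coe_quotientDualEquiv (ξ : StrongDual ℂ (C₀(ℝ, X) ⧸ Z0InjTensor X)) :
    (quotientDualEquiv X ξ : HarmonicH1 (StrongDual ℂ X)) =
      poissonEquiv X ((dualEquiv X).symm (ξ ∘L (Z0InjTensor X).mkQL)) :=
  rfl

theorem quotientDualEquiv_formula (ξ : StrongDual ℂ (C₀(ℝ, X) ⧸ Z0InjTensor X)) (F : C₀(ℝ, X)) :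
    ξ ((Z0InjTensor X).mkQ F) =
      dualEquiv X ((poissonEquiv X).symm (quotientDualEquiv X ξ : HarmonicH1 (StrongDual ℂ X))) F := by
  rw [coe_quotientDualEquiv, LinearIsometryEquiv.symm_apply_apply,
    LinearIsometryEquiv.apply_symm_apply]
  rfl

end QuotientDual

/-! ### Densities of analytic measures -/

section AnalyticDensity

/-- An integrable function whose pairings with the Cauchy kernels with poles in the lower half-plane
vanish belongs to `H¹(ℝ)`: the characters `t ↦ exp(2πiat)`, `a ≥ 0`, are bounded pointwise limits of
functions of `C₀(ℝ) ∩ H^∞(ℝ)`. -/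
theorem fourier_eq_zero_of_killsCauchy {f : ℝ → ℂ} (hf : Integrable f)
    {Λ : StrongDual ℂ C₀(ℝ, ℂ)} (hΛ : ∀ G, Λ G = ∫ t, G t * f t) (h : KillsCauchy Λ) {u : ℝ}
    (hu : u ≤ 0) : 𝓕 f u = 0 := by
  -- the factors `w_n / (t + w_n)`, with `w_n = (n + 1) i`, are bounded by `1` and tend to `1`
  let w : ℕ → ℂ := fun n => ((n + 1 : ℝ) : ℂ) * Complex.I
  have hw : ∀ n, 0 < (w n).im := fun n => by
    simp only [w, Complex.im_ofReal_mul, Complex.I_im, mul_one]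
    positivity
  have hwc : ∀ n, starRingEnd ℂ (w n) = -w n := fun n => by
    simp [w]
  have hk : ∀ n (t : ℝ), w n * cauchyKernel (starRingEnd ℂ (w n)) t = (1 + t / w n)⁻¹ := by
    intro n t
    have h0 : w n ≠ 0 := fun h0 => (hw n).ne' (by rw [h0, Complex.zero_im])
    rw [cauchyKernel_apply (by simpa using (hw n).ne'), hwc, sub_neg_eq_add]
    have h1 : (t : ℂ) + w n = w n * (1 + t / w n) := by
      rw [mul_add, mul_one, mul_div_cancel₀ _ h0, add_comm]
    rw [h1, mul_inv, mul_inv_cancel_left₀ h0]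
  have hnorm : ∀ n (t : ℝ), ‖w n * cauchyKernel (starRingEnd ℂ (w n)) t‖ ≤ 1 := by
    intro n t
    have hn : ‖w n‖ = (n + 1 : ℝ) := by
      rw [norm_mul, Complex.norm_I, mul_one, Complex.norm_real, Real.norm_of_nonneg (by positivity)]
    rw [norm_mul, hn]
    have h1 : ‖cauchyKernel (starRingEnd ℂ (w n)) t‖ ≤ (n + 1 : ℝ)⁻¹ := by
      refine (norm_apply_le _ t).trans ((norm_cauchyKernel_le (by simpa using (hw n).ne')).trans_eq ?_)
      rw [Complex.conj_im, abs_neg, abs_of_pos (hw n)]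
      simp [w]
    calc (n + 1 : ℝ) * _ ≤ (n + 1 : ℝ) * (n + 1 : ℝ)⁻¹ := by gcongr
      _ = 1 := mul_inv_cancel₀ (by positivity)
  have hlim : ∀ t : ℝ, Tendsto (fun n => w n * cauchyKernel (starRingEnd ℂ (w n)) t) atTop (𝓝 1) := by
    intro t
    have h1 : Tendsto (fun n : ℕ => (t : ℂ) / w n) atTop (𝓝 0) := by
      refine squeeze_zero_norm (a := fun n : ℕ => |t| * (1 / ((n : ℝ) + 1))) (fun n => le_of_eq ?_)
        (by simpa using tendsto_one_div_add_atTop_nhds_zero_nat.const_mul |t|)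
      rw [norm_div, norm_mul, Complex.norm_I, mul_one, Complex.norm_real, Complex.norm_real,
        Real.norm_of_nonneg (by positivity : (0 : ℝ) ≤ n + 1), Real.norm_eq_abs]
      ring
    simp_rw [hk]
    simpa using (h1.const_add 1).inv₀ (by simp)
  have h0 : ∀ n, ∫ t : ℝ, (w n * cauchyKernel (starRingEnd ℂ (w n)) t) *
      (f t * Complex.exp (2 * Real.pi * Complex.I * (t * ((-u : ℝ) : ℂ)))) = 0 := by
    intro n
    have h1 := IsHardy.apply_eq_zero h (isHardy_modulatedKernel (neg_nonneg.2 hu) (hw n))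
    rw [hΛ] at h1
    rw [← mul_zero (w n), ← h1, ← integral_const_mul]
    refine integral_congr_ae (Eventually.of_forall fun t => ?_)
    simp only [modulatedKernel_apply]
    ring
  have hfi : Integrable fun t : ℝ =>
      f t * Complex.exp (2 * Real.pi * Complex.I * (t * ((-u : ℝ) : ℂ))) := by
    refine hf.norm.mono' (hf.1.mul (Continuous.aestronglyMeasurable (by fun_prop)))
      (Eventually.of_forall fun t => ?_)
    rw [norm_mul, norm_exp_mul, mul_one]
  rw [← neg_neg u, fourier_neg_eq]
  refine tendsto_nhds_unique (tendsto_integral_of_dominated_convergence (fun t => ‖f t‖)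
    (fun n => ?_) hf.norm (fun n => Eventually.of_forall fun t => ?_)
    (Eventually.of_forall fun t => ?_)) (tendsto_const_nhds.congr fun n => (h0 n).symm)
  · exact (continuous_const.mul (map_continuous _)).aestronglyMeasurable.mul hfi.1
  · rw [norm_mul, norm_mul (f t), norm_exp_mul, mul_one]
    exact mul_le_of_le_one_left (norm_nonneg _) (hnorm n t)
  · simpa using (hlim t).mul_const
      (f t * Complex.exp (2 * Real.pi * Complex.I * (t * ((-u : ℝ) : ℂ))))

/-- The measure with a given integrable density. -/
def densityMeasure {Z : Type*} [NormedAddCommGroup Z] [NormedSpace ℂ Z] [CompleteSpace Z]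
    {h : ℝ → Z} (hh : Integrable h) : BddMeasure Z :=
  ⟨volume.withDensityᵥ h, by
    have := isFiniteMeasure_variation_withDensityᵥ hh
    exact measure_ne_top _ _⟩

theorem norm_densityMeasure {Z : Type*} [NormedAddCommGroup Z] [NormedSpace ℂ Z] [CompleteSpace Z]
    {h : ℝ → Z} (hh : Integrable h) : ‖densityMeasure hh‖ = ∫ t, ‖h t‖ := by
  rw [BddMeasure.norm_def]
  change ((volume.withDensityᵥ h).variation Set.univ).toReal = _
  rw [Measure.variation_withDensityᵥ hh, withDensity_apply _ MeasurableSet.univ,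
    setLIntegral_univ, integral_norm_eq_lintegral_enorm hh.1]

variable {X Z : Type*} [NormedAddCommGroup X] [NormedSpace ℂ X] [NormedAddCommGroup Z]
  [NormedSpace ℂ Z] (D : Z ≃ₗᵢ[ℂ] StrongDual ℂ X)

theorem integrable_dual (h : Lp Z 1 (volume : Measure ℝ)) :
    Integrable fun t => D ((h : ℝ → Z) t) :=
  ContinuousLinearMap.integrable_comp D.toContinuousLinearEquiv.toContinuousLinearMap
    (L1.integrable_coeFn h)

/-- The measure `D(h(t)) dt`, for `h ∈ L¹(ℝ; Z)` and an identification `D` of `Z` with `X*`. -/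
def dualDensity : Lp Z 1 (volume : Measure ℝ) →ₗᵢ[ℂ] BddMeasure (StrongDual ℂ X) where
  toFun h := densityMeasure (integrable_dual D h)
  map_add' f g := by
    refine Subtype.ext (Eq.trans ?_ (withDensityᵥ_add (integrable_dual D f) (integrable_dual D g)))
    refine WithDensityᵥEq.congr_ae ?_
    filter_upwards [Lp.coeFn_add f g] with t ht
    rw [ht, Pi.add_apply, map_add, Pi.add_apply]
  map_smul' c f := by
    refine Subtype.ext (Eq.trans ?_ (withDensityᵥ_smul (fun t => D ((f : ℝ → Z) t)) c))
    refine WithDensityᵥEq.congr_ae ?_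
    filter_upwards [Lp.coeFn_smul c f] with t ht
    rw [ht, Pi.smul_apply, map_smul, Pi.smul_apply]
  norm_map' h := by
    refine (norm_densityMeasure (integrable_dual D h)).trans ?_
    rw [L1.norm_eq_integral_norm]
    simp_rw [LinearIsometryEquiv.norm_map]

theorem integralFunctional_dualDensity (h : Lp Z 1 (volume : Measure ℝ)) (F : C₀(ℝ, X)) :
    integralFunctional (dualDensity D h) F = ∫ t, D ((h : ℝ → Z) t) (F t) := by
  rw [integralFunctional_apply]
  exact integral_withDensityᵥ (integrable_dual D h) (evPairing X)
    (map_continuous F).aestronglyMeasurable (norm_apply_le F)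

theorem tensorDual_dualDensity (h : Lp Z 1 (volume : Measure ℝ)) (f : C₀(ℝ, ℂ)) (x : X) :
    tensorDual (integralFunctional (dualDensity D h)) f x = ∫ t, f t * D ((h : ℝ → Z) t) x := by
  rw [tensorDual_apply, integralFunctional_dualDensity]
  refine integral_congr_ae (Eventually.of_forall fun t => ?_)
  simp only [tensor_apply, map_smul, smul_eq_mul]

end AnalyticDensity


/-! ### Operator-valued Hardy spaces as dual spaces -/

section BochnerHardy

variable {X Z : Type*} [NormedAddCommGroup X] [NormedSpace ℂ X] [NormedAddCommGroup Z]
  [NormedSpace ℂ Z] (D : Z ≃ₗᵢ[ℂ] StrongDual ℂ X)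

theorem poissonH1_dualDensity_mem_iff (h : Lp Z 1 (volume : Measure ℝ)) :
    poissonH1 (dualDensity D h) ∈ HolomorphicH1 (StrongDual ℂ X) ↔ ∀ z : ℂ, 0 < z.im → ∀ x,
      ∫ t, cauchyKernel (starRingEnd ℂ z) t * D ((h : ℝ → Z) t) x = 0 := by
  rw [poissonH1_mem_holomorphicH1_iff]
  refine forall_congr' fun z => forall_congr' fun _ => ?_
  rw [ContinuousLinearMap.ext_iff]
  refine forall_congr' fun x => ?_
  rw [tensorDual_dualDensity, zero_apply]

theorem isClosed_poissonH1_dualDensity_mem :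
    IsClosed {h : Lp Z 1 (volume : Measure ℝ) |
      poissonH1 (dualDensity D h) ∈ HolomorphicH1 (StrongDual ℂ X)} := by
  simp_rw [poissonH1_dualDensity_mem_iff, Set.ofPred_forall]
  refine isClosed_iInter fun z => isClosed_iInter fun _ => isClosed_iInter fun x =>
    isClosed_eq ?_ continuous_const
  simp_rw [← tensorDual_dualDensity]
  exact ((ContinuousLinearMap.apply ℂ ℂ (tensor (cauchyKernel (starRingEnd ℂ z)) x)).continuous.comp
    (integralEquiv X).continuous).comp (dualDensity D).continuous

/-- The densities in `H¹(ℝ; Z)` are analytic: the condition is closed, and it holds for the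
elementary tensors. -/
theorem poissonH1_dualDensity_mem {h : Lp Z 1 (volume : Measure ℝ)} (hh : h ∈ bochnerH1 Z) :
    poissonH1 (dualDensity D h) ∈ HolomorphicH1 (StrongDual ℂ X) := by
  let S : Submodule ℂ (Lp Z 1 (volume : Measure ℝ)) := (HolomorphicH1 (StrongDual ℂ X)).comap
    ((poissonEquiv X).toLinearEquiv.toLinearMap ∘ₗ (dualDensity D).toLinearMap)
  refine Submodule.topologicalClosure_minimal (t := S) _ (Submodule.span_le.2 ?_)
    (isClosed_poissonH1_dualDensity_mem D) hh
  rintro F ⟨f, hf, y, hF⟩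
  change poissonH1 (dualDensity D F) ∈ HolomorphicH1 (StrongDual ℂ X)
  rw [poissonH1_dualDensity_mem_iff]
  intro z hz x
  have h1 := integral_mul_cauchyKernel_eq_zero (L1.integrable_coeFn f) hf hz
  rw [← zero_mul (D y x), ← h1, ← integral_mul_const]
  refine integral_congr_ae ?_
  filter_upwards [hF] with t ht
  rw [ht, map_smul, smul_apply, smul_eq_mul]
  ring

/-- The rank-one operator on `Z ≃ X*` which corresponds to `ξ ↦ ξ(x) φ`. -/
def dualRankOne (x : X) (φ : StrongDual ℂ X) : Z →L[ℂ] Z :=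
  ((ContinuousLinearMap.apply ℂ ℂ x).comp
    (D.toContinuousLinearEquiv : Z →L[ℂ] StrongDual ℂ X)).smulRight (D.symm φ)

theorem dualRankOne_apply (x : X) (φ : StrongDual ℂ X) (y : Z) :
    dualRankOne D x φ y = D y x • D.symm φ := rfl

theorem sum_dualRankOne_apply {ι : Type*} (x : ι → X) (φ : ι → StrongDual ℂ X) (s : Finset ι)
    (y : Z) : (∑ k ∈ s, dualRankOne D (x k) (φ k)) y =
      D.symm (dualMap (compression x φ s) (D y)) := by
  rw [dualMap_compression, map_sum, sum_apply]
  refine Finset.sum_congr rfl fun k _ => ?_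
  rw [map_smul, dualRankOne_apply]

/-- If the density `h` is analytic, then so are its coordinates `⟨h(t), x⟩`. -/
theorem compLp_dualRankOne_mem {h : Lp Z 1 (volume : Measure ℝ)}
    (hh : poissonH1 (dualDensity D h) ∈ HolomorphicH1 (StrongDual ℂ X)) (x : X)
    (φ : StrongDual ℂ X) : (dualRankOne D x φ).compLp h ∈ Submodule.span ℂ
      {F : Lp Z 1 (volume : Measure ℝ) | ∃ f ∈ hardyOne, ∃ z : Z,
        (F : ℝ → Z) =ᵐ[volume] fun t => (f : ℝ → ℂ) t • z} := by
  have hi : Integrable fun t => D ((h : ℝ → Z) t) x :=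
    (ContinuousLinearMap.apply ℂ ℂ x).integrable_comp (integrable_dual D h)
  refine Submodule.subset_span ⟨hi.toL1 _, fun u hu => ?_, D.symm φ, ?_⟩
  · have h0 : 𝓕 (fun t => D ((h : ℝ → Z) t) x) u = 0 := by
      refine fourier_eq_zero_of_killsCauchy (Λ := (ContinuousLinearMap.apply ℂ ℂ x).comp
        (tensorDual (integralFunctional (dualDensity D h)))) hi
        (fun G => tensorDual_dualDensity D h G x) (fun z hz => ?_) hu
      have h1 := (poissonH1_mem_holomorphicH1_iff _).1 hh z hz
      exact congrArg (fun ξ : StrongDual ℂ X => ξ x) h1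
    rw [← h0, Real.fourier_eq, Real.fourier_eq]
    refine integral_congr_ae ?_
    filter_upwards [hi.coeFn_toL1] with t ht
    rw [ht]
  · filter_upwards [hi.coeFn_toL1, (dualRankOne D x φ).coeFn_compLp h] with t h1 h2
    rw [h1, h2, dualRankOne_apply]

variable {ι : Type*} {x : ι → X} {φ : ι → StrongDual ℂ X} {s : ℕ → Finset ι}

/-- An analytic density `h` is the limit in `L¹` of its compressions, which are finite sums of
elementary tensors with coefficients in `H¹(ℝ)`. -/
theorem mem_bochnerH1_of_poissonH1_dualDensity_mem (hc : ∀ n, ‖compression x φ (s n)‖ ≤ 1)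
    (hconv : ∀ ξ, Tendsto (fun n => dualMap (compression x φ (s n)) ξ) atTop (𝓝 ξ))
    {h : Lp Z 1 (volume : Measure ℝ)}
    (hh : poissonH1 (dualDensity D h) ∈ HolomorphicH1 (StrongDual ℂ X)) : h ∈ bochnerH1 Z := by
  let T : ℕ → Z →L[ℂ] Z := fun n => ∑ k ∈ s n, dualRankOne D (x k) (φ k)
  have hT : ∀ n y, T n y = D.symm (dualMap (compression x φ (s n)) (D y)) := fun n y =>
    sum_dualRankOne_apply D x φ (s n) y
  have hTn : ∀ n y, ‖T n y‖ ≤ ‖y‖ := fun n y => by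
    rw [hT, LinearIsometryEquiv.norm_map, ← D.norm_map y]
    exact norm_dualMap_apply_le (hc n) _
  have hTt : ∀ y, Tendsto (fun n => T n y) atTop (𝓝 y) := fun y => by
    simp_rw [hT]
    simpa [Function.comp_def] using (D.symm.continuous.tendsto _).comp (hconv (D y))
  refine mem_closure_of_tendsto (f := fun n => (T n).compLp h) (b := atTop) ?_
    (Eventually.of_forall fun n => ?_)
  · rw [tendsto_iff_norm_sub_tendsto_zero]
    have h1 : ∀ n, ‖(T n).compLp h - h‖ = ∫ t, ‖T n ((h : ℝ → Z) t) - (h : ℝ → Z) t‖ := by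
      intro n
      rw [L1.norm_eq_integral_norm]
      refine integral_congr_ae ?_
      filter_upwards [Lp.coeFn_sub ((T n).compLp h) h, (T n).coeFn_compLp h] with t e1 e2
      rw [e1, Pi.sub_apply, e2]
    simp_rw [h1]
    have hi := L1.integrable_coeFn h
    rw [← integral_zero ℝ ℝ (μ := volume)]
    refine tendsto_integral_of_dominated_convergence (fun t => 2 * ‖(h : ℝ → Z) t‖)
      (fun n => (((T n).integrable_comp hi).sub hi).norm.1) (hi.norm.const_mul 2)
      (fun n => Eventually.of_forall fun t => ?_) (Eventually.of_forall fun t => ?_)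
    · rw [norm_norm, two_mul]
      exact (norm_sub_le _ _).trans (add_le_add_left (hTn n _) _)
    · exact tendsto_iff_norm_sub_tendsto_zero.1 (hTt _)
  · refine Finset.sum_induction (fun k => dualRankOne D (x k) (φ k))
      (fun A => A.compLp h ∈ Submodule.span ℂ _) (fun A B hA hB => ?_) ?_
      fun k _ => compLp_dualRankOne_mem D hh (x k) (φ k)
    · rw [ContinuousLinearMap.add_compLp]
      exact add_mem hA hB
    · have : (0 : Z →L[ℂ] Z).compLp h = 0 := by
        refine Lp.ext ?_
        filter_upwards [(0 : Z →L[ℂ] Z).coeFn_compLp h, Lp.coeFn_zero Z 1 volume] with t e1 e2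
        rw [e1, e2]
        rfl
      rw [this]
      exact zero_mem _

/-- Every analytic measure has a density in `L¹(ℝ; Z)`: by the theorem of F. and M. Riesz it is
absolutely continuous, and the compressions of `X` replace the Radon-Nikodym property of `X*`. -/
theorem exists_dualDensity_eq [DecidableEq ι] (hbi : ∀ k l, φ k (x l) = if k = l then 1 else 0)
    (hs : Monotone s) (hc : ∀ n, ‖compression x φ (s n)‖ ≤ 1)
    (hconv : ∀ ξ, Tendsto (fun n => dualMap (compression x φ (s n)) ξ) atTop (𝓝 ξ))
    {μ : BddMeasure (StrongDual ℂ X)} (hμ : poissonH1 μ ∈ HolomorphicH1 (StrongDual ℂ X)) :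
    ∃ h, dualDensity D h = μ := by
  obtain ⟨g, hg, e⟩ := exists_density hbi hs hc hconv
    (variation_absolutelyContinuous ((poissonH1_mem_holomorphicH1_iff μ).1 hμ))
  have hi : Integrable fun t => D.symm (g t) :=
    ContinuousLinearMap.integrable_comp D.symm.toContinuousLinearEquiv.toContinuousLinearMap hg
  refine ⟨hi.toL1 _, Subtype.ext (Eq.trans ?_ e.symm)⟩
  refine WithDensityᵥEq.congr_ae ?_
  filter_upwards [hi.coeFn_toL1] with t ht
  rw [ht, LinearIsometryEquiv.apply_symm_apply]

/-- The isometry `H¹(ℝ; Z) → 𝐇¹(P₊; X*)`, `Z ≃ X*`, given by the Poisson integral. -/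
def hardyPoisson : bochnerH1 Z →ₗᵢ[ℂ] HolomorphicH1 (StrongDual ℂ X) where
  toFun h := ⟨poissonEquiv X (dualDensity D h), poissonH1_dualDensity_mem D h.2⟩
  map_add' f g := Subtype.ext ((congrArg (poissonEquiv X) (map_add (dualDensity D) f.1 g.1)).trans
    (map_add (poissonEquiv X) _ _))
  map_smul' c f := Subtype.ext ((congrArg (poissonEquiv X) (map_smul (dualDensity D) c f.1)).trans
    (map_smul (poissonEquiv X) _ _))
  norm_map' _ := ((poissonEquiv X).norm_map _).trans ((dualDensity D).norm_map _)

theorem coe_hardyPoisson (h : bochnerH1 Z) :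
    (hardyPoisson D h : HarmonicH1 (StrongDual ℂ X)) = poissonEquiv X (dualDensity D h) := rfl

theorem hardyPoisson_surjective [DecidableEq ι]
    (hbi : ∀ k l, φ k (x l) = if k = l then 1 else 0)
    (hs : Monotone s) (hc : ∀ n, ‖compression x φ (s n)‖ ≤ 1)
    (hconv : ∀ ξ, Tendsto (fun n => dualMap (compression x φ (s n)) ξ) atTop (𝓝 ξ)) :
    Function.Surjective (hardyPoisson D) := fun ψ => by
  have h1 : poissonH1 ((poissonEquiv X).symm ψ) = ψ := by
    rw [← poissonEquiv_apply, LinearIsometryEquiv.apply_symm_apply]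
  obtain ⟨h, hh⟩ := exists_dualDensity_eq D hbi hs hc hconv (μ := (poissonEquiv X).symm ψ)
    (by rw [h1]; exact ψ.2)
  have h2 : poissonH1 (dualDensity D h) = ψ := by rw [hh, h1]
  exact ⟨⟨h, mem_bochnerH1_of_poissonH1_dualDensity_mem D hc hconv (by rw [h2]; exact ψ.2)⟩,
    Subtype.ext h2⟩

theorem hardyPoisson_apply (h : bochnerH1 Z) (z : ℍ) (a : X) :
    (hardyPoisson D h : HarmonicH1 (StrongDual ℂ X)).toFun z a =
      ∫ t, halfPlanePoisson z t • D (((h : Lp Z 1 (volume : Measure ℝ)) : ℝ → Z) t) a := by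
  rw [coe_hardyPoisson, poissonEquiv_apply, poissonH1_toFun, poissonIntegral_eq,
    tensorDual_dualDensity]
  refine integral_congr_ae (Eventually.of_forall fun t => ?_)
  simp only [poissonKer_apply_coe, Complex.real_smul]

theorem dualEquiv_dualDensity (h : Lp Z 1 (volume : Measure ℝ)) (F : C₀(ℝ, X)) :
    dualEquiv X (dualDensity D h) F = ∫ t, D ((h : ℝ → Z) t) (F (-t)) := by
  rw [dualEquiv_apply, integralFunctional_dualDensity]
  rfl

end BochnerHardy

/-- The identification of `H¹(ℝ; S¹)` with `𝐇¹(P₊; (S^∞)*)`. -/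
def traceHardyEquiv : bochnerH1 SOne ≃ₗᵢ[ℂ] HolomorphicH1 (StrongDual ℂ SInfty) :=
  LinearIsometryEquiv.ofSurjective (hardyPoisson (traceDual stdBasis))
    (hardyPoisson_surjective (traceDual stdBasis) (matrixEntry_compactRankOne stdBasis)
      (s := fun n => Finset.range n ×ˢ Finset.range n)
      (fun _ _ h => Finset.product_subset_product (Finset.range_mono h) (Finset.range_mono h))
      (fun n => norm_compression_compactOp_le stdBasis (Finset.range n))
      (tendsto_dualMap_compression stdBasis))

theorem coe_traceHardyEquiv (h : bochnerH1 SOne) :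
    (traceHardyEquiv h : HarmonicH1 (StrongDual ℂ SInfty)) =
      poissonEquiv SInfty (dualDensity (traceDual stdBasis) h) := rfl

end VHardy

end

open VHardy
theorem proposition2p2 (X : Type*) [NormedAddCommGroup X] [NormedSpace ℂ X] [CompleteSpace X] :
    (∃ (J : BddMeasure (StrongDual ℂ X) ≃ₗᵢ[ℂ] StrongDual ℂ C₀(ℝ, X))
        (P : BddMeasure (StrongDual ℂ X) ≃ₗᵢ[ℂ] HarmonicH1 (StrongDual ℂ X)),
      -- `J` is the identification `M(ℝ; X*) ≃ C₀(ℝ; X)*`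
      (∀ μ (f : C₀(ℝ, ℂ)) (x : X),
        J μ (tensor f x) = ∫ᵛ t, f (-t) ∂[ContinuousLinearMap.mul ℝ ℂ; evalMeasure μ x]) ∧
      -- `P` is the identification `M(ℝ; X*) ≃ h¹(P₊; X*)` given by the Poisson integral
      (∀ μ z, (P μ).toFun z = poissonIntegral μ z) ∧
      -- `(Z₀ ⊗ X)^⊥ = 𝐇¹(P₊; X*)`
      (∀ μ, J μ ∈ annihilator (Z0Tensor X) ↔ P μ ∈ HolomorphicH1 (StrongDual ℂ X)) ∧
      -- the resulting isometric description of the dual of the quotient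
      ∃ Ψ : StrongDual ℂ (C₀(ℝ, X) ⧸ Z0InjTensor X) ≃ₗᵢ[ℂ] HolomorphicH1 (StrongDual ℂ X),
        ∀ ξ F, ξ ((Z0InjTensor X).mkQ F) = J (P.symm (Ψ ξ)) F) ∧
    -- the case `X = S^∞`
    (∃ (K : bochnerH1 SOne ≃ₗᵢ[ℂ] HolomorphicH1 (StrongDual ℂ SInfty))
        (Θ : StrongDual ℂ (C₀(ℝ, SInfty) ⧸ Z0InjTensor SInfty) ≃ₗᵢ[ℂ] bochnerH1 SOne),
      (∀ (h : bochnerH1 SOne) (z : ℍ) (a : SInfty), ((K h : HarmonicH1 (StrongDual ℂ SInfty)).toFun z) a =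
        ∫ t, halfPlanePoisson z t • tracePairing ((h : Lp SOne 1 (volume : Measure ℝ)) t) a) ∧
      ∀ ξ (F : C₀(ℝ, SInfty)), ξ ((Z0InjTensor SInfty).mkQ F) =
        ∫ t, tracePairing ((Θ ξ : Lp SOne 1 (volume : Measure ℝ)) t) (F (-t))) := by
  refine ⟨⟨dualEquiv X, poissonEquiv X, dualEquiv_tensor, fun μ z => rfl,
    dualEquiv_mem_annihilator_iff, quotientDualEquiv X, quotientDualEquiv_formula X⟩,
    traceHardyEquiv, (quotientDualEquiv SInfty).trans traceHardyEquiv.symm,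
    fun h z a => hardyPoisson_apply (traceDual stdBasis) h z a, fun ξ F => ?_⟩
  have h1 : (quotientDualEquiv SInfty ξ : HarmonicH1 (StrongDual ℂ SInfty)) =
      poissonEquiv SInfty (dualDensity (traceDual stdBasis)
        (traceHardyEquiv.symm (quotientDualEquiv SInfty ξ))) := by
    rw [← coe_traceHardyEquiv, LinearIsometryEquiv.apply_symm_apply]
  rw [quotientDualEquiv_formula, h1, LinearIsometryEquiv.symm_apply_apply, dualEquiv_dualDensity]
  rfl
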